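/- **Proposition.** Let $N>0$ be squarefree, let $t$ be the number of primes dividing $N$, and let $X,Y$ be non-zero complex numbers (equivalently, indeterminates). *Notation.* For $M\mid N$ let $W_M$ be any integer matrix $\left(\begin{smallmatrix}a&b\\c&d\end{smallmatrix}\right)$ with $M\mid a$, $N\mid c$, $M\mid d$ and determinant $M$, and put $(f|_k\gamma)(\tau)=(\det\gamma)^{k/2}(c\tau+d)^{-k}f\bigl(\frac{a\tau+b}{c\tau+d}\bigr)$ for $\gamma=\left(\begin{smallmatrix}a&b\\c&d\end{smallmatrix}\right)$. Let $\mathcal D(N)$ be the set of divisors of $N$ with the group law $a\star b=ab/\gcd(a,b)^2$, and $\mathcal D(N)^\vee$ the group of its characters $\varepsilon:\mathcal D(N)\to\{\pm1\}$. *Hecke forms.* For $k\ge2$ let $\mathcal B_{k,N}$ be the following basis of $M_k(\Gamma_0(N))$. Its cuspidal members are the forms $\sum_{d\mid N_2}\varepsilon(d)\,d^{k/2}f(d\tau)$, where $\varepsilon\in\mathcal D(N)^\vee$, $N=N_1N_2$, and $f$ is a normalized cuspidal newform of weight $k$ and level $N_1$ with $f|_kW_M=\varepsilon(M)f$ for all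 $M\mid N_1$. Its Eisenstein members, for even $k$, are the forms $G_{k,N}^\varepsilon(\tau)=\sum_{d\mid N}\varepsilon(d)\,d^{k/2}G_k(d\tau)$, $\varepsilon\in\mathcal D(N)^\vee$ ($\varepsilon\ne1$ if $k=2$), where $G_k=-\frac{B_k}{2k}+\sum_{n\ge1}\sigma_{k-1}(n)q^n$ and $q=e^{2\pi i\tau}$. *Periods.* For $f\in\mathcal B_{k,N}$ put $$R_f(X,Y)=\frac{r_f^{\rm ev}(X)\,r_f^{\rm od}(Y)+r_f^{\rm od}(X)\,r_f^{\rm ev}(Y)}{(2i)^{k-3}\langle f,f\rangle},$$ where ev/od denote even and odd parts. If $f$ is a cusp form, then $r_f(X)=\int_0^{i\infty}f(\tau)(X-\tau)^{k-2}d\tau$ and $\langle f,f\rangle=\int_{\Gamma_0(N)\backslash\mathbb H}|f|^2y^{k-2}\,dx\,dy$. If $f=G^\varepsilon_{k,N}$ has Fourier coefficients $a_n$, then $$r_f(X)=\widetilde f(X,\tau)-\varepsilon(N)N^{k/2-1}X^{k-2}\widetilde f\bigl(-\tfrac1{NX},-\tfrac1{N\tau}\bigr),\qquad \widetilde f(X,\tau)=\int_\tau^{i\infty}(f(\tau')-a_0)(X-\tau')^{k-2}d\tau'+a_0\frac{(X-\tau)^{k-1}}{k-1}$$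 (this is independent of $\tau\in\mathbb H$), and $$\langle f,f\rangle=\frac\pi3\,[\mathrm{SL}_2(\mathbb Z):\Gamma_0(N)]\,\frac{(k-1)!}{(4\pi)^k}\,\operatorname{Res}_{s=k}\sum_{n\ge1}a_n^2n^{-s}$$ (the residue of the meromorphic continuation). In the degenerate case where $k=2$ and $\varepsilon(p)=-1$ for at least two primes $p\mid N$, the quotient just given is $0/0$, and one sets $R_f(X,Y)=\mathfrak R_\varepsilon(Y)+\mathfrak R_\varepsilon(X)$ with $$\mathfrak R_\varepsilon(Y)=\frac{1-\varepsilon(N)}{2^t\prod_{p\mid N}(1+\varepsilon(p)p)}\cdot\frac1{-1/24}\sum_{d\mid N}\varepsilon(d)\,Q_2(dY),\qquad Q_2(Y)=\tfrac1{12}(Y^{-1}+Y).$$ *Generating function.* Put $$\mathcal C_N(X,Y,\tau,T)=\frac{(X+Y)(NXY-1)}{NX^2Y^2T^2}+\sum_{k\ge2}C_{k,N}(X,Y,\tau)\,T^{k-2},\qquad C_{k,N}=\frac1{(k-2)!}\sum_{f\in\mathcal B_{k,N}}R_f(X,Y)\,f(\tau).$$ For such a series in $T$, the operator $|W_M$ applies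 $|_kW_M$ (in the variable $\tau$) to the coefficient of $T^{k-2}$ for every $k\ge0$, and the value at $\tau=\infty$ is the limit of each coefficient as $\operatorname{Im}\tau\to\infty$. *Statement.* (a) For every divisor $M$ of $N$ the values at $\tau=\infty$ of the coefficients of $\mathcal C_N|W_M$ exist and do not depend on the choice of $W_M$, and $$(\mathcal C_N|W_M)(X,Y,\infty,T)=\frac{\sinh\bigl(\sqrt M(X+Y)T/2\bigr)\,\sinh\bigl((NXY-1)T/(2\sqrt M)\bigr)}{4\,\sinh(\sqrt M XT/2)\,\sinh(\sqrt M YT/2)\,\sinh(T/(2\sqrt M))\,\sinh(NXYT/(2\sqrt M))};$$ the series on the left converges to the right-hand side for all $T\ne0$ such that $|\sqrt M XT|$, $|\sqrt M YT|$, $|T/\sqrt M|$ and $|NXYT/\sqrt M|$ are all less than $2\pi$. (b) Hence the Eisenstein parts of $\mathcal C_N$ and of $$\mathcal B_N(X,Y,\tau,T)=\frac{\theta_\tau'(0)\,\theta_\tau((X+Y)T)}{\theta_\tau(XT)\,\theta_\tau(YT)}\cdot\frac{\theta_{N\tau}'(0)\,\theta_{N\tau}((NXY-1)T)}{\theta_{N\tau}(NXYT)\,\theta_{N\tau}(T)}$$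 agree, where $\theta_\tau(u)=q^{1/8}e^{u/2}\prod_{n\ge1}(1-q^n)(1-q^ne^u)(1-q^{n-1}e^{-u})$. That is: $\mathcal B_N$ has a Laurent expansion $\sum_{k\ge0}B_{k,N}(X,Y,\tau)\,T^{k-2}$ at $T=0$; the coefficients of $\mathcal B_N|W_M$ have the same values at $\tau=\infty$ as those of $\mathcal C_N|W_M$, for every $M\mid N$; the coefficients of $T^{-2}$ and $T^{-1}$ of $\mathcal B_N$ and $\mathcal C_N$ are equal; and $B_{k,N}-C_{k,N}$ is a cusp form of weight $k$ on $\Gamma_0(N)$ for every $k\ge2$. -/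

import Mathlib

open Filter Topology MeasureTheory Complex
open UpperHalfPlane hiding I
open scoped Real MatrixGroups CongruenceSubgroup

noncomputable section

namespace PeriodGen

/-! ### Slash operators, Atkin-Lehner matrices, characters -/

/-- The group `Γ₀(N)`, as a subgroup of `GL₂(ℝ)`. -/
abbrev G0 (N : ℕ) : Subgroup (GL (Fin 2) ℝ) :=
  (CongruenceSubgroup.Gamma0 N).map (Matrix.SpecialLinearGroup.mapGL ℝ)

/-- The slash operator in the normalization that is invariant under scalar matrices,
`(f |_k γ)(τ) = det(γ)^{k/2} (cτ + d)^{-k} f((aτ + b)/(cτ + d))` (for `det γ > 0`). -/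
def slash (k : ℕ) (γ : GL (Fin 2) ℝ) (f : ℍ → ℂ) : ℍ → ℂ := fun τ =>
  (((γ.det.val : ℝ) ^ ((k : ℝ) / 2) : ℝ) : ℂ) * (denom γ τ) ^ (-(k : ℤ)) * f (γ • τ)

/-- `W` is an integer matrix with rows `(a, b)`, `(c, d)`, where `M ∣ a`, `N ∣ c`, `M ∣ d` and
the determinant is `M`: a representative of the Atkin-Lehner involution `W_M` of level `N`. -/
def IsAtkinLehner (N M : ℕ) (W : GL (Fin 2) ℝ) : Prop :=
  ∃ a b c d : ℤ, (M : ℤ) ∣ a ∧ (N : ℤ) ∣ c ∧ (M : ℤ) ∣ d ∧ a * d - b * c = M ∧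
    (W : Matrix (Fin 2) (Fin 2) ℝ) = !![(a : ℝ), (b : ℝ); (c : ℝ), (d : ℝ)]

/-- The characters `ε` of the group of divisors of the squarefree number `N`, with
multiplication `a ⋆ b = ab / gcd(a, b)²`, and with values in `{1, -1}`. -/
def ALChar (N : ℕ) : Type :=
  {ε : N.divisors → ℤˣ // ∀ a b c : N.divisors,
    (c : ℕ) = (a : ℕ) * b / (Nat.gcd a b) ^ 2 → ε c = ε a * ε b}

instance (N : ℕ) : Finite (ALChar N) := by unfold ALChar; infer_instance

instance (N : ℕ) : Fintype (ALChar N) := Fintype.ofFinite _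

/-- The value `ε(d)` as a complex number (only used for divisors `d` of `N`). -/
def ALChar.val {N : ℕ} (ε : ALChar N) (d : ℕ) : ℂ :=
  if h : d ∈ N.divisors then (((ε.1 ⟨d, h⟩ : ℤˣ) : ℤ) : ℂ) else 0

/-- `f ↦ f | ∑_{d ∣ N₂} ε(d) V_d`, where `(f |_k V_d)(τ) = d^{k/2} f(dτ)`. -/
def lift (k N₂ : ℕ) (ε : ℕ → ℂ) (f : ℍ → ℂ) : ℍ → ℂ := fun τ =>
  ∑ d ∈ N₂.divisors, ε d * (((d : ℝ) ^ ((k : ℝ) / 2) : ℝ) : ℂ) * f (ofComplex ((d : ℂ) * τ))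

/-- The `n`-th Fourier coefficient `a_n(f)`. -/
def coeff (f : ℍ → ℂ) (n : ℕ) : ℂ := (qExpansion 1 f).coeff n

/-- Even part of a function of `X`. -/
def evPart (r : ℂ → ℂ) (X : ℂ) : ℂ := (r X + r (-X)) / 2

/-- Odd part of a function of `X`. -/
def odPart (r : ℂ → ℂ) (X : ℂ) : ℂ := (r X - r (-X)) / 2

/-- `(r^ev(X) r^od(Y) + r^od(X) r^ev(Y)) / ((2i)^{k-3} n)`. -/
def periodPair (k : ℕ) (r : ℂ → ℂ) (n : ℂ) (X Y : ℂ) : ℂ :=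
  (evPart r X * odPart r Y + odPart r X * evPart r Y) / ((2 * I) ^ ((k : ℤ) - 3) * n)

/-! ### Hecke cusp forms -/

/-- The Petersson scalar product for `Γ₀(N)`: the integral of `f(τ) conj(g(τ)) y^{k-2} dx dy` over
a fundamental domain for `Γ₀(N)`, namely the union of the translates of the standard
fundamental domain by representatives of `Γ₀(N) \ SL₂(ℤ)`. The measure on `ℍ` is
`dx dy / y²`. -/
def peterssonInner (N k : ℕ) (f g : ℍ → ℂ) : ℂ :=
  ∑ᶠ q : SL(2, ℤ) ⧸ CongruenceSubgroup.Gamma0 N,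
    ∫ τ in ModularGroup.fd, petersson (k : ℤ) g f ((Quotient.out q)⁻¹ • τ)

/-- The Hecke operator `T_n` (for `n` prime to the level). -/
def heckeT (k n : ℕ) (f : ℍ → ℂ) : ℍ → ℂ := fun τ =>
  (n : ℂ) ^ (k - 1) * ∑ a ∈ n.divisors, ∑ b ∈ Finset.range (n / a),
    ((n / a : ℕ) : ℂ) ^ (-(k : ℤ)) * f (ofComplex (((a : ℂ) * τ + b) / ((n / a : ℕ) : ℂ)))

/-- Newforms: cusp forms on `Γ₀(N)` orthogonal to all `g(dτ)` with `g` a modular form of a lower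
level `N₁ ∣ N` and `d ∣ N/N₁`, that are simultaneous eigenforms of the `T_n` with `(n, N) = 1`,
normalized by `a_1 = 1`. -/
def IsNewform (N k : ℕ) (f : CuspForm (G0 N) k) : Prop :=
  (∀ N₁ d : ℕ, N₁ ∣ N → N₁ ≠ N → d ∣ N / N₁ → ∀ g : ModularForm (G0 N₁) k,
    peterssonInner N k f (fun τ => g (ofComplex ((d : ℂ) * τ))) = 0) ∧
  (∀ n : ℕ, 0 < n → n.Coprime N → ∃ c : ℂ, ∀ τ, heckeT k n f τ = c * f τ) ∧
  coeff f 1 = 1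

/-- The cuspidal part of the canonical basis of Hecke forms of weight `k` on `Γ₀(N)`: all
lifts, with the character `ε`, of newforms `f` of level `N₁`, where `N = N₁ N₂` and
`f |_k W_M = ε(M) f` for all `M ∣ N₁`; here `ε` runs over all characters. -/
def cuspBasis (N k : ℕ) : Set (CuspForm (G0 N) k) :=
  {F | ∃ (ε : ALChar N) (N₁ N₂ : ℕ), N₁ * N₂ = N ∧ ∃ f : CuspForm (G0 N₁) k,
    IsNewform N₁ k f ∧
    (∀ (M : ℕ) (W : GL (Fin 2) ℝ), M ∣ N₁ → IsAtkinLehner N₁ M W →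
      ∀ τ, slash k W f τ = ε.val M * f τ) ∧
    ∀ τ, F τ = lift k N₂ ε.val f τ}

/-- The period polynomial `r_f(X) = ∫_0^{i∞} f(τ) (X - τ)^{k-2} dτ` of a cusp form. -/
def cuspPeriod (k : ℕ) (f : ℍ → ℂ) (X : ℂ) : ℂ :=
  ∫ t in Set.Ioi (0 : ℝ), I * (f (ofComplex (I * t)) * (X - I * t) ^ (k - 2))

/-- The polynomial `R_f(X, Y)` of a Hecke cusp form on `Γ₀(N)`. -/
def cuspR (N k : ℕ) (f : ℍ → ℂ) (X Y : ℂ) : ℂ :=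
  periodPair k (cuspPeriod k f) (peterssonInner N k f f) X Y

/-! ### Hecke Eisenstein series -/

/-- `G_k(τ) = -B_k/(2k) + ∑_{n ≥ 1} σ_{k-1}(n) qⁿ`. -/
def eisG (k : ℕ) : ℍ → ℂ := fun τ =>
  -((bernoulli k : ℚ) : ℂ) / (2 * k) +
    ∑' n : ℕ, (ArithmeticFunction.sigma (k - 1) n : ℂ) * cexp (2 * π * I * n * τ)

/-- The Eisenstein series `∑_{d ∣ N} ε(d) d^{k/2} G_k(dτ)`. -/
def heckeEis (N k : ℕ) (ε : ALChar N) : ℍ → ℂ := lift k N ε.val (eisG k)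

/-- `F` is the meromorphic continuation of the Dirichlet series `∑ a_n² n^{-s}`. -/
def IsRankinContinuation (a : ℕ → ℂ) (F : ℂ → ℂ) : Prop :=
  Meromorphic F ∧ ∃ σ : ℝ, ∀ s : ℂ, σ < s.re →
    LSeriesSummable (fun n => a n ^ 2) s ∧ F s = LSeries (fun n => a n ^ 2) s

open Classical in
/-- The residue at the (at most simple) pole `s = k` of the meromorphic continuation of
`∑ a_n² n^{-s}`. -/
def rankinResidue (a : ℕ → ℂ) (k : ℕ) : ℂ :=
  if h : ∃ F : ℂ → ℂ, IsRankinContinuation a F then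
    limUnder (𝓝[≠] (k : ℂ)) (fun s => (s - k) * h.choose s)
  else 0

/-- The extended Petersson norm `⟨f, f⟩` of an Eisenstein series `f`: the multiple
`(π/3) [SL₂(ℤ) : Γ₀(N)] (k-1)! / (4π)^k` of the residue at `s = k` of `∑ a_n(f)² n^{-s}`, which is
the multiple that gives the Petersson norm in the case of a Hecke cusp form. -/
def eisNorm (N k : ℕ) (f : ℍ → ℂ) : ℂ :=
  (π : ℂ) / 3 * ((CongruenceSubgroup.Gamma0 N).index : ℂ) * ((k - 1).factorial : ℂ)
    / (4 * π) ^ k * rankinResidue (coeff f) k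

/-- The truncated period function
`∫_τ^{i∞} (f(τ') - a_0) (X - τ')^{k-2} dτ' + a_0 (X - τ)^{k-1} / (k - 1)`. -/
def truncPeriod (k : ℕ) (f : ℍ → ℂ) (X : ℂ) (τ : ℍ) : ℂ :=
  (∫ t in Set.Ioi (0 : ℝ),
      I * ((f (ofComplex (τ + I * t)) - coeff f 0) * (X - (τ + I * t)) ^ (k - 2)))
    + coeff f 0 * (X - τ) ^ (k - 1) / ((k : ℂ) - 1)

/-- The extended period function `f̃(X, τ) - e N^{k/2-1} X^{k-2} f̃(-1/(NX), -1/(Nτ))` of a form `f`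
of even weight `k` with Fricke eigenvalue `e`. It does not depend on `τ`; the value at
the fixed point `τ = i/√N` of `τ ↦ -1/(Nτ)` is taken. -/
def eisPeriod (N k : ℕ) (e : ℂ) (f : ℍ → ℂ) (X : ℂ) : ℂ :=
  truncPeriod k f X (ofComplex (I / (Real.sqrt N : ℂ))) -
    e * (N : ℂ) ^ (k / 2 - 1) * X ^ (k - 2) *
      truncPeriod k f (-1 / (N * X)) (ofComplex (I / (Real.sqrt N : ℂ)))

/-- `Q_k(Y) = ∑ (B_r/r!) (B_s/s!) Y^{r-1}`, over even `r, s ≥ 0` with `r + s = k`. -/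
def Qk (k : ℕ) (Y : ℂ) : ℂ :=
  ∑ p ∈ (Finset.HasAntidiagonal.antidiagonal k).filter (fun p => Even p.1 ∧ Even p.2),
    ((bernoulli p.1 : ℚ) : ℂ) / (p.1.factorial : ℂ) *
      (((bernoulli p.2 : ℚ) : ℂ) / (p.2.factorial : ℂ)) * Y ^ ((p.1 : ℤ) - 1)

/-- The even-odd part of `R` in weight 2,
`(1 - ε(N)) / (2^t ∏_{p ∣ N} (1 + ε(p) p) G_2(∞)) · ∑_{d ∣ N} ε(d) Q_2(dY)`, where
`t` is the number of primes dividing `N` and `G_2(∞) = -1/24`. -/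
def eisFrakR₂ (N : ℕ) (ε : ALChar N) (Y : ℂ) : ℂ :=
  (1 - ε.val N) /
      (2 ^ N.primeFactors.card * (∏ p ∈ N.primeFactors, (1 + ε.val p * p)) * (-1 / 24)) *
    ∑ d ∈ N.divisors, ε.val d * Qk 2 (d * Y)

open Classical in
/-- `R_f(X, Y)` for the Eisenstein series `f = ∑_{d ∣ N} ε(d) d^{k/2} G_k(dτ)`. If `k = 2` and
`ε(p) = -1` for at least two primes `p ∣ N`, then `r_f^ev` and `⟨f, f⟩` both vanish, and `R_f` has
the value that is left after the common factor `∏_p (1 + ε(p) p^{1-k/2})` is cancelled. -/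
def eisR (N k : ℕ) (ε : ALChar N) (X Y : ℂ) : ℂ :=
  if k = 2 ∧ 2 ≤ (N.primeFactors.filter (fun p => ε.val p = -1)).card then
    eisFrakR₂ N ε Y + eisFrakR₂ N ε X
  else
    periodPair k (eisPeriod N k (ε.val N) (heckeEis N k ε)) (eisNorm N k (heckeEis N k ε)) X Y

/-! ### The generating functions -/

/-- The cuspidal part of `C_{k,N}(X, Y, ·)`. -/
def cuspC (N k : ℕ) (X Y : ℂ) : CuspForm (G0 N) k :=
  (1 / ((k - 2).factorial : ℂ)) • ∑ᶠ f ∈ cuspBasis N k, cuspR N k f X Y • f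

open Classical in
/-- The Eisenstein part of `C_{k,N}(X, Y, ·)`: for even `k`, the Hecke Eisenstein series are the
`heckeEis N k ε` for all characters `ε`, except for the trivial one if `k = 2`. -/
def eisC (N k : ℕ) (X Y : ℂ) : ℍ → ℂ := fun τ =>
  if Even k then
    (1 / ((k - 2).factorial : ℂ)) *
      ∑ ε ∈ Finset.univ.filter (fun ε : ALChar N => ¬ (k = 2 ∧ ∀ d ∈ N.divisors, ε.val d = 1)),
        eisR N k ε X Y * heckeEis N k ε τ
  else 0

/-- `C_{k,N}(X, Y, τ) = (1/(k-2)!) ∑_f R_f(X, Y) f(τ)`, over the basis of Hecke forms (`k ≥ 2`). -/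
def C (N k : ℕ) (X Y : ℂ) : ℍ → ℂ := fun τ => cuspC N k X Y τ + eisC N k X Y τ

/-- The coefficient of `T^{k-2}` in the generating function
`(X + Y)(NXY - 1) / (N X² Y² T²) + ∑_{k ≥ 2} C_{k,N}(X, Y, τ) T^{k-2}`. -/
def genC (N : ℕ) (X Y : ℂ) : ℕ → ℍ → ℂ
  | 0 => fun _ => (X + Y) * (N * X * Y - 1) / (N * X ^ 2 * Y ^ 2)
  | 1 => fun _ => 0
  | (k + 2) => C N (k + 2) X Y

/-- The Jacobi theta function
`θ_τ(u) = q^{1/8} e^{u/2} ∏_{n ≥ 1} (1 - qⁿ)(1 - qⁿ e^u)(1 - q^{n-1} e^{-u})`, `q = e^{2πiτ}`. -/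
def theta (τ u : ℂ) : ℂ :=
  cexp (2 * π * I * τ / 8) * cexp (u / 2) *
    ∏' n : ℕ, (1 - cexp (2 * π * I * τ) ^ (n + 1)) *
      (1 - cexp (2 * π * I * τ) ^ (n + 1) * cexp u) *
      (1 - cexp (2 * π * I * τ) ^ n * cexp (-u))

/-- The product of theta functions
`θ'_τ(0) θ_τ((X+Y)T) / (θ_τ(XT) θ_τ(YT)) · θ'_{Nτ}(0) θ_{Nτ}((NXY-1)T) / (θ_{Nτ}(NXYT) θ_{Nτ}(T))`. -/
def thetaProd (N : ℕ) (X Y : ℂ) (τ : ℍ) (T : ℂ) : ℂ :=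
  deriv (theta τ) 0 * theta τ ((X + Y) * T) / (theta τ (X * T) * theta τ (Y * T)) *
    (deriv (theta (N * τ)) 0 * theta (N * τ) ((N * X * Y - 1) * T) /
      (theta (N * τ) (N * X * Y * T) * theta (N * τ) T))

/-- The ratio of hyperbolic sines, with `m = √M`. -/
def sinhRatio (N : ℕ) (m X Y T : ℂ) : ℂ :=
  (sinh (m * (X + Y) * T / 2) * sinh ((N * X * Y - 1) * T / (2 * m))) /
    (4 * sinh (m * X * T / 2) * sinh (m * Y * T / 2) * sinh (T / (2 * m)) *
      sinh (N * X * Y * T / (2 * m)))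

end PeriodGen

end

/-! Both generating functions have computable values at the cusps. A form on Γ₀(N), N squarefree, is
a cusp form as soon as it vanishes at i∞ after every W_M, so it suffices to show that both have the
values given by the sinh quotient.

Theta side. Near u = 0, log(θ_τ(u)/(θ'_τ(0)u)) = -2 ∑ G_n(τ) uⁿ/n! over even n ≥ 2
(`hasTaylor_thetaLog`). Hence the theta product is (X+Y)(NXY-1)/(NX²Y²T²) times the exponential of a
series in T whose n-th coefficient combines G_n(τ) and G_n(Nτ). W_M permutes the series
d^{n/2}G_n(dτ) by d ↦ d ⋆ M (`slash_eisV`), and the defect of G₂ cancels between its two occurrences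
(`slash_thetaB`). Letting Im τ → ∞ replaces G_n by its constant term -B_n/(2n). Those numbers are
the Taylor coefficients of log(sinh(u/2)/(u/2)), so the limit is the sinh quotient with m = √M
(`tendsto_slash_thetaB`, `hasSum_sinhRatio`).

Hecke side. The cuspidal part contributes nothing at the cusps, and W_M multiplies the Eisenstein
series of ε by ε(M). By Fourier inversion on the group of divisors, the claim becomes one identity
for each ε: R_ε times the constant term, divided by (k-2)!, equals 2^{-t} ∑_M ε(M) c_M
(`eisR_mul_eisConstTerm`), where c_M is the required value. The addition theorem turns the sinh
quotient into a product of two sums of coth, so the right side is a sum of products of Bernoulli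
numbers (`thetaCoeff_eq_sum_bernoulli`, `sum_val_mul_cuspValue`).

For the left side, the L-series is E(s)ζ(s)ζ(s-k+1) with E(s) = ∑ ε(d) d^{k/2-s}. The period
function is a binomial sum of the completed values Λ(j+1) (`eisPeriod_heckeEis`). Trivial zeros of ζ
leave only Λ(1) and Λ(k-1) = ±Λ(1) in the even part, while the odd part is a Bernoulli sum. The norm
comes from Ramanujan's formula for ∑ σ(n)² n^{-s} with modified Euler factors at p ∣ N
(`LSeries_rankin`), and its residue is again an explicit multiple of L(1). Thus L(1) cancels in R_ε.
It vanishes exactly in the degenerate case of weight two, where R_ε is prescribed separately. -/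

noncomputable section

namespace PeriodGen

open scoped Manifold ModularForm

/-! ### Convergent power series at the origin -/

/-- The power series `φ` converges to `f` in a neighbourhood of `0`. -/
def HasTaylor (f : ℂ → ℂ) (φ : PowerSeries ℂ) : Prop :=
  ∀ᶠ z in 𝓝 (0 : ℂ), HasSum (fun n : ℕ => φ.coeff n * z ^ n) (f z)

lemma hasTaylor_iff {f : ℂ → ℂ} {φ : PowerSeries ℂ} :
    HasTaylor f φ ↔
      HasFPowerSeriesAt f (FormalMultilinearSeries.ofScalars ℂ (fun n => φ.coeff n)) 0 := by
  rw [hasFPowerSeriesAt_iff]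
  simp [HasTaylor, FormalMultilinearSeries.coeff_ofScalars, mul_comm]

lemma HasTaylor.analyticAt {f : ℂ → ℂ} {φ : PowerSeries ℂ} (h : HasTaylor f φ) :
    AnalyticAt ℂ f 0 := ⟨_, hasTaylor_iff.1 h⟩

lemma exists_hasTaylor {f : ℂ → ℂ} (h : AnalyticAt ℂ f 0) : ∃ φ, HasTaylor f φ := by
  obtain ⟨p, hp⟩ := h
  refine ⟨PowerSeries.mk fun n => p.coeff n, ?_⟩
  rw [hasFPowerSeriesAt_iff] at hp
  simpa [HasTaylor, mul_comm] using hp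

lemma HasTaylor.congr {f g : ℂ → ℂ} {φ : PowerSeries ℂ} (h : HasTaylor f φ)
    (hfg : ∀ᶠ z in 𝓝 (0 : ℂ), f z = g z) : HasTaylor g φ := by
  filter_upwards [h, hfg] with z h1 h2
  rwa [← h2]

lemma HasTaylor.unique {f : ℂ → ℂ} {φ ψ : PowerSeries ℂ} (h : HasTaylor f φ)
    (h' : HasTaylor f ψ) : φ = ψ := by
  have := (hasTaylor_iff.1 h).eq_formalMultilinearSeries (hasTaylor_iff.1 h')
  ext n
  simpa [FormalMultilinearSeries.coeff_ofScalars] using congrArg (fun p => p.coeff n) this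

lemma HasTaylor.mul {f g : ℂ → ℂ} {φ ψ : PowerSeries ℂ} (hf : HasTaylor f φ)
    (hg : HasTaylor g ψ) : HasTaylor (fun z => f z * g z) (φ * ψ) := by
  filter_upwards [hf, hg] with z h1 h2
  have h3 : Summable fun n => ‖φ.coeff n * z ^ n‖ := h1.summable.norm
  have h4 : Summable fun n => ‖ψ.coeff n * z ^ n‖ := h2.summable.norm
  have key := tsum_mul_tsum_eq_tsum_sum_antidiagonal_of_summable_norm h3 h4
  have hs := (summable_norm_sum_mul_antidiagonal_of_summable_norm h3 h4).of_norm
  rw [h1.tsum_eq, h2.tsum_eq] at key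
  have := hs.hasSum
  rw [← key] at this
  convert! this using 2 with n
  rw [PowerSeries.coeff_mul, Finset.sum_mul]
  refine Finset.sum_congr rfl fun p hp => ?_
  rw [← Finset.HasAntidiagonal.mem_antidiagonal.1 hp, pow_add]
  ring

lemma HasTaylor.add {f g : ℂ → ℂ} {φ ψ : PowerSeries ℂ} (hf : HasTaylor f φ)
    (hg : HasTaylor g ψ) : HasTaylor (fun z => f z + g z) (φ + ψ) := by
  filter_upwards [hf, hg] with z h1 h2
  simpa [add_mul] using h1.add h2

lemma HasTaylor.sub {f g : ℂ → ℂ} {φ ψ : PowerSeries ℂ} (hf : HasTaylor f φ)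
    (hg : HasTaylor g ψ) : HasTaylor (fun z => f z - g z) (φ - ψ) := by
  filter_upwards [hf, hg] with z h1 h2
  simpa [sub_mul] using h1.sub h2

lemma HasTaylor.const_mul {f : ℂ → ℂ} {φ : PowerSeries ℂ} (c : ℂ) (hf : HasTaylor f φ) :
    HasTaylor (fun z => c * f z) (c • φ) := by
  filter_upwards [hf] with z h1
  simpa [mul_assoc] using h1.mul_left c

lemma hasTaylor_const (c : ℂ) : HasTaylor (fun _ => c) (PowerSeries.C c) := by
  refine Eventually.of_forall fun z => ?_
  simpa using hasSum_single (f := fun n : ℕ => (PowerSeries.C c).coeff n * z ^ n) 0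
    fun n hn => by simp [PowerSeries.coeff_C, hn]

lemma hasTaylor_one : HasTaylor (fun _ => 1) 1 := by
  simpa using hasTaylor_const 1

lemma hasTaylor_id : HasTaylor (fun z => z) PowerSeries.X := by
  refine Eventually.of_forall fun z => ?_
  simpa using hasSum_single (f := fun n : ℕ => (PowerSeries.X : PowerSeries ℂ).coeff n * z ^ n) 1
    fun n hn => by simp [PowerSeries.coeff_X, hn]

lemma HasTaylor.comp_mul {f : ℂ → ℂ} {φ : PowerSeries ℂ} (c : ℂ) (hf : HasTaylor f φ) :
    HasTaylor (fun z => f (c * z)) (PowerSeries.rescale c φ) := by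
  have ht : Tendsto (fun z : ℂ => c * z) (𝓝 0) (𝓝 0) := by
    have : Continuous fun z : ℂ => c * z := by fun_prop
    simpa using this.tendsto 0
  filter_upwards [ht.eventually hf] with z hz
  simpa [PowerSeries.coeff_rescale, mul_pow, mul_comm, mul_left_comm, mul_assoc] using hz

lemma HasTaylor.eq_coeff_zero {f : ℂ → ℂ} {φ : PowerSeries ℂ} (hf : HasTaylor f φ) :
    f 0 = φ.coeff 0 := by
  have h := hf.self_of_nhds
  have h' : HasSum (fun n : ℕ => φ.coeff n * (0 : ℂ) ^ n) (φ.coeff 0) := by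
    simpa using hasSum_single (f := fun n : ℕ => φ.coeff n * (0 : ℂ) ^ n) 0
      fun n hn => by simp [hn]
  exact h.unique h'

lemma HasTaylor.deriv {f : ℂ → ℂ} {φ : PowerSeries ℂ} (hf : HasTaylor f φ) :
    HasTaylor (deriv f) (PowerSeries.derivative ℂ φ) := by
  obtain ⟨r, hr⟩ := hasTaylor_iff.1 hf
  have h : HasFPowerSeriesAt (fderiv ℂ f) _ 0 := ⟨r, hr.fderiv⟩
  rw [hasFPowerSeriesAt_iff] at h
  filter_upwards [h] with z hz
  rw [zero_add] at hz
  have hz := hz.mapL (ContinuousLinearMap.apply ℂ ℂ (1 : ℂ))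
  convert! hz using 2 with n
  rw [PowerSeries.coeff_derivative]
  simp only [map_smul, ContinuousLinearMap.apply_apply,
    FormalMultilinearSeries.derivSeries_coeff_one, FormalMultilinearSeries.coeff_ofScalars]
  simp
  ring

/-- The Cauchy expansion on a slightly smaller disc has the same coefficients as the germ, by
uniqueness. This is the source of the explicit domain of convergence of the sinh quotient. -/
lemma HasTaylor.hasSum_of_differentiableOn {f : ℂ → ℂ} {φ : PowerSeries ℂ} (hf : HasTaylor f φ)
    {R : ℝ} (hd : DifferentiableOn ℂ f (Metric.ball 0 R)) {z : ℂ} (hz : ‖z‖ < R) :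
    HasSum (fun n : ℕ => φ.coeff n * z ^ n) (f z) := by
  have hR : 0 < R := (norm_nonneg z).trans_lt hz
  obtain ⟨r, hr1, hr2⟩ := exists_between hz
  have hr0 : 0 < r := (norm_nonneg z).trans_lt hr1
  have hd' : DifferentiableOn ℂ f (Metric.closedBall 0 r) :=
    hd.mono (Metric.closedBall_subset_ball hr2)
  have h := hd'.hasFPowerSeriesOnBall (R := ⟨r, hr0.le⟩) hr0
  have he := h.hasFPowerSeriesAt.eq_formalMultilinearSeries (hasTaylor_iff.1 hf)
  rw [he] at h
  have := h.hasSum (y := z) (by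
    rw [Metric.mem_eball, edist_zero_right, enorm_eq_nnnorm]
    exact ENNReal.coe_lt_coe.2 (show ‖z‖₊ < ⟨r, hr0.le⟩ from hr1))
  simpa [FormalMultilinearSeries.ofScalars_apply_eq, mul_comm] using! this

/-- The coefficients of `exp (∑ p_n zⁿ)`, for a power series without constant term. -/
def expCoeff (p : ℕ → ℂ) : ℕ → ℂ
  | 0 => 1
  | (n + 1) => ((n : ℂ) + 1)⁻¹ *
      ∑ i : Fin (n + 1), ((i : ℕ) + 1 : ℂ) * p (i + 1) * expCoeff p (n - i)

lemma expCoeff_succ (p : ℕ → ℂ) (n : ℕ) : expCoeff p (n + 1) = ((n : ℂ) + 1)⁻¹ *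
      ∑ i ∈ Finset.range (n + 1), ((i : ℂ) + 1) * p (i + 1) * expCoeff p (n - i) := by
  rw [expCoeff, Finset.sum_range]

/-- The recursion defining `expCoeff` is the comparison of coefficients in ψ' = φ'ψ for ψ = exp φ.
The recursive form makes vanishing, homogeneity, limits and holomorphy of the coefficients simple
inductions. -/
lemma HasTaylor.exp {f : ℂ → ℂ} {φ : PowerSeries ℂ} (hf : HasTaylor f φ) (h0 : φ.coeff 0 = 0) :
    HasTaylor (fun z => cexp (f z)) (PowerSeries.mk (expCoeff fun n => φ.coeff n)) := by
  have ha : AnalyticAt ℂ (fun z => cexp (f z)) 0 := hf.analyticAt.cexp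
  obtain ⟨ψ, hψ⟩ := exists_hasTaylor ha
  have hd : PowerSeries.derivative ℂ ψ = PowerSeries.derivative ℂ φ * ψ := by
    refine hψ.deriv.unique ((hf.deriv.mul hψ).congr ?_)
    filter_upwards [hf.analyticAt.eventually_analyticAt] with z hz
    rw [deriv_cexp hz.differentiableAt]
    ring
  have hz : ψ.coeff 0 = 1 := by
    rw [← hψ.eq_coeff_zero, hf.eq_coeff_zero, h0, Complex.exp_zero]
  convert hψ
  ext n
  rw [PowerSeries.coeff_mk]
  induction n using Nat.strong_induction_on with
  | _ n ih =>
    cases n with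
    | zero => rw [expCoeff, hz]
    | succ n =>
      have h := congrArg (PowerSeries.coeff n) hd
      rw [PowerSeries.coeff_mul, Finset.Nat.sum_antidiagonal_eq_sum_range_succ_mk] at h
      simp only [PowerSeries.coeff_derivative] at h
      rw [expCoeff_succ]
      have hn : (n : ℂ) + 1 ≠ 0 := Nat.cast_add_one_ne_zero n
      rw [inv_mul_eq_iff_eq_mul₀ hn, mul_comm _ (ψ.coeff (n + 1)), h]
      refine Finset.sum_congr rfl fun i hi => ?_
      rw [ih (n - i) (by omega)]
      ring

lemma expCoeff_congr {p p' : ℕ → ℂ} (h : ∀ n, 0 < n → p n = p' n) (n : ℕ) :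
    expCoeff p n = expCoeff p' n := by
  induction n using Nat.strong_induction_on with
  | _ n ih =>
    cases n with
    | zero => rw [expCoeff, expCoeff]
    | succ n =>
      rw [expCoeff_succ, expCoeff_succ]
      refine congrArg _ (Finset.sum_congr rfl fun i hi => ?_)
      rw [h (i + 1) (by omega), ih (n - i) (by omega)]

/-- The n-th coefficient is isobaric of weight n in the p_i. With c an automorphy factor, this
distributes the weight-k slash over the exponents of lower weight. -/
lemma expCoeff_mul_pow (p : ℕ → ℂ) (c : ℂ) (n : ℕ) :
    expCoeff (fun n => c ^ n * p n) n = c ^ n * expCoeff p n := by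
  induction n using Nat.strong_induction_on with
  | _ n ih =>
    cases n with
    | zero => simp [expCoeff]
    | succ n =>
      rw [expCoeff_succ, expCoeff_succ]
      simp only [Finset.mul_sum]
      refine Finset.sum_congr rfl fun i hi => ?_
      have hi' : i ≤ n := by simpa [Nat.lt_succ_iff] using hi
      have hp : c ^ (n + 1) = c ^ (i + 1) * c ^ (n - i) := by rw [← pow_add]; congr 1; omega
      rw [ih (n - i) (by omega), hp]
      ring

/-- Homogeneity with c = -1: an even exponent is unchanged, while an odd coefficient changes sign.
-/
lemma expCoeff_odd {p : ℕ → ℂ} (h : ∀ n, Odd n → p n = 0) {n : ℕ} (hn : Odd n) :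
    expCoeff p n = 0 := by
  have h1 := expCoeff_mul_pow p (-1) n
  rw [expCoeff_congr (p' := p) ?_ n, hn.neg_one_pow] at h1
  · linear_combination h1 / 2
  · intro m _
    rcases Nat.even_or_odd m with hm | hm
    · rw [hm.neg_one_pow, one_mul]
    · rw [h m hm, mul_zero]

/-- Each coefficient is a polynomial in finitely many p_i, so limits of the p_i suffice; no
uniformity in n is needed. -/
lemma tendsto_expCoeff {ι : Type*} {l : Filter ι} {p : ι → ℕ → ℂ} {p' : ℕ → ℂ}
    (h : ∀ n, 0 < n → Tendsto (fun i => p i n) l (𝓝 (p' n))) (n : ℕ) :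
    Tendsto (fun i => expCoeff (p i) n) l (𝓝 (expCoeff p' n)) := by
  induction n using Nat.strong_induction_on with
  | _ n ih =>
    cases n with
    | zero => simpa only [expCoeff] using tendsto_const_nhds
    | succ n =>
      simp only [expCoeff_succ]
      refine Tendsto.const_mul _ (tendsto_finsetSum _ fun i hi => ?_)
      exact ((h (i + 1) (by omega)).const_mul _).mul (ih (n - i) (by omega))

/-! ### Hyperbolic functions and Bernoulli numbers -/

/-- The entire function `sinh(u/2)/(u/2)`. -/
def sinhc (u : ℂ) : ℂ := dslope sinh 0 (u / 2)

lemma sinhc_zero : sinhc 0 = 1 := by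
  simp [sinhc, (Complex.hasDerivAt_sinh 0).deriv]

lemma mul_sinhc (u : ℂ) : u * sinhc u = 2 * sinh (u / 2) := by
  rcases eq_or_ne u 0 with rfl | hu
  · simp
  · rw [sinhc, dslope_of_ne _ (by simpa using hu), slope_def_field]
    simp
    field_simp

lemma differentiable_sinhc : Differentiable ℂ sinhc := by
  have h : DifferentiableOn ℂ (dslope sinh 0) Set.univ :=
    (Complex.differentiableOn_dslope univ_mem).2 Complex.differentiable_sinh.differentiableOn
  exact (differentiableOn_univ.1 h).comp (by fun_prop)

lemma sinh_ne_zero_of_norm_lt {u : ℂ} (hu : u ≠ 0) (h : ‖u‖ < 2 * π) : sinh (u / 2) ≠ 0 := by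
  intro h0
  have h1 : cexp (u / 2) = cexp (-(u / 2)) := by
    have : (cexp (u / 2) - cexp (-(u / 2))) / 2 = 0 := h0
    linear_combination 2 * this
  have h2 : cexp u = 1 := by
    rw [show u = u / 2 + u / 2 by ring, Complex.exp_add]
    nth_rewrite 1 [h1]
    rw [← Complex.exp_add]
    simp
  obtain ⟨n, hn⟩ := Complex.exp_eq_one_iff.1 h2
  have hn0 : n ≠ 0 := by
    rintro rfl
    simp at hn
    exact hu hn
  have : (1 : ℝ) ≤ |(n : ℝ)| := by exact_mod_cast Int.one_le_abs hn0
  rw [hn] at h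
  simp [abs_of_pos Real.pi_pos] at h
  nlinarith [Real.pi_pos]

lemma sinhc_ne_zero {u : ℂ} (h : ‖u‖ < 2 * π) : sinhc u ≠ 0 := by
  rcases eq_or_ne u 0 with rfl | hu
  · simp [sinhc_zero]
  · intro h0
    have := mul_sinhc u
    rw [h0] at this
    exact sinh_ne_zero_of_norm_lt hu h (by linear_combination -this / 2)

lemma hasTaylor_exp : HasTaylor cexp (PowerSeries.exp ℂ) := by
  refine Eventually.of_forall fun z => ?_
  have := NormedSpace.expSeries_div_hasSum_exp  z
  rw [← Complex.exp_eq_exp_ℂ] at this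
  simpa [PowerSeries.coeff_exp, div_eq_inv_mul] using this

lemma bernoulli_odd {n : ℕ} (h : Odd n) (h1 : n ≠ 1) : bernoulli n = 0 := by
  exact bernoulli_eq_zero_of_odd h (by have := h.pos; omega)

/-- The Taylor series `∑ B_n uⁿ / n!` (`n` even) of `(u/2) coth(u/2)`. -/
def cothSeries : PowerSeries ℂ :=
  PowerSeries.mk fun n => if Even n then ((bernoulli n : ℚ) : ℂ) / n.factorial else 0

/-- Since (u/2)coth(u/2) - u/2 = u/(e^u - 1), the left side times e^u - 1 is u. The Bernoulli series
solves the same equation, and e^u - 1 can be cancelled. The term u/2 removes B₁ = -1/2, the only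
nonzero Bernoulli number of odd index. -/
lemma hasTaylor_coth : HasTaylor (fun u => cosh (u / 2) / sinhc u) cothSeries := by
  have ha : AnalyticAt ℂ (fun u => cosh (u / 2) / sinhc u) 0 := by
    refine AnalyticAt.div ?_ (differentiable_sinhc.analyticAt 0) (by simp [sinhc_zero])
    exact (by fun_prop : Differentiable ℂ fun u : ℂ => cosh (u / 2)).analyticAt 0
  obtain ⟨ψ, hψ⟩ := exists_hasTaylor ha
  have hev : ∀ᶠ u in 𝓝 (0 : ℂ), sinhc u ≠ 0 :=
    differentiable_sinhc.continuous.continuousAt.eventually_ne (by simp [sinhc_zero])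
  have h1 : (ψ - (1 / 2 : ℂ) • PowerSeries.X) * (PowerSeries.exp ℂ - 1) = PowerSeries.X := by
    refine ((((hψ.sub (hasTaylor_id.const_mul (1 / 2))).mul
      (hasTaylor_exp.sub hasTaylor_one)).congr ?_).unique hasTaylor_id)
    filter_upwards [hev] with u hu
    have e1 := mul_sinhc u
    have e2 : cexp u = cexp (u / 2) * cexp (u / 2) := by rw [← Complex.exp_add]; ring_nf
    have e3 : cexp (u / 2) * cexp (-(u / 2)) = 1 := by rw [← Complex.exp_add]; simp
    have e4 : sinh (u / 2) = (cexp (u / 2) - cexp (-(u / 2))) / 2 := rfl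
    have e5 : cosh (u / 2) = (cexp (u / 2) + cexp (-(u / 2))) / 2 := rfl
    rw [e4] at e1
    rw [e2, e5]
    field_simp
    generalize cexp (u / 2) = a at *
    generalize cexp (-(u / 2)) = b at *
    linear_combination (-(a ^ 2 - 1) - 2) * e1 + 2 * a * e3
  have h2 : (PowerSeries.exp ℂ - 1) ≠ 0 := by
    intro h
    have := congrArg (PowerSeries.coeff 1) h
    simp [PowerSeries.coeff_exp, PowerSeries.coeff_one] at this
  have h3 := bernoulliPowerSeries_mul_exp_sub_one ℂ
  have h4 : ψ - (1 / 2 : ℂ) • PowerSeries.X = bernoulliPowerSeries ℂ :=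
    mul_right_cancel₀ h2 (h1.trans h3.symm)
  have h5 : ψ = bernoulliPowerSeries ℂ + (1 / 2 : ℂ) • PowerSeries.X := by rw [← h4]; ring
  have h6 : ψ = cothSeries := by
    ext n
    rw [h5, cothSeries]
    simp only [map_add, PowerSeries.coeff_mk, bernoulliPowerSeries, PowerSeries.coeff_smul,
      PowerSeries.coeff_X]
    split_ifs with h7 h8 h8
    · subst h7; simp at h8
    · subst h7; norm_num
    · simp
    · rw [bernoulli_odd (Nat.not_even_iff_odd.1 h8) h7]; simp
  rwa [← h6]

/-- The Taylor series `∑ B_n uⁿ / (n n!)` (`n ≥ 2` even) of `log(sinh(u/2)/(u/2))`. -/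
def logSinhcSeries : PowerSeries ℂ :=
  PowerSeries.mk fun n =>
    if Even n ∧ n ≠ 0 then ((bernoulli n : ℚ) : ℂ) / (n * n.factorial) else 0

/-- The operator u·d/du sends log(sinh(u/2)/(u/2)) to (u/2)coth(u/2) - 1, so the coefficients arise
from those of `cothSeries` on division by n. -/
lemma hasTaylor_log_sinhc : HasTaylor (fun u => Complex.log (sinhc u)) logSinhcSeries := by
  have hs : AnalyticAt ℂ sinhc 0 := differentiable_sinhc.analyticAt 0
  have ha : AnalyticAt ℂ (fun u => Complex.log (sinhc u)) 0 :=
    hs.clog (by simp [sinhc_zero])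
  obtain ⟨φ, hφ⟩ := exists_hasTaylor ha
  have hev : ∀ᶠ u in 𝓝 (0 : ℂ), sinhc u ∈ slitPlane :=
    differentiable_sinhc.continuous.continuousAt.eventually
      (isOpen_slitPlane.mem_nhds (by simp [sinhc_zero]))
  have h1 : PowerSeries.X * PowerSeries.derivative ℂ φ = cothSeries - 1 := by
    refine (((hasTaylor_id.mul hφ.deriv).congr ?_).unique (hasTaylor_coth.sub hasTaylor_one))
    filter_upwards [hev] with u hu
    have hd := (differentiable_sinhc u).hasDerivAt
    rw [(hd.clog hu).deriv]
    have hne : sinhc u ≠ 0 := slitPlane_ne_zero hu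
    have e : (fun u => u * sinhc u) = fun u => 2 * sinh (u / 2) := funext mul_sinhc
    have hd1 := ((hasDerivAt_id u).mul hd).unique (e ▸
      (((hasDerivAt_id u).div_const 2).csinh).const_mul 2)
    simp at hd1
    field_simp
    linear_combination hd1
  have h0 : φ.coeff 0 = 0 := by rw [← hφ.eq_coeff_zero]; simp [sinhc_zero]
  have h6 : φ = logSinhcSeries := by
    ext n
    rw [logSinhcSeries, PowerSeries.coeff_mk]
    cases n with
    | zero => simpa using h0
    | succ n =>
      have h := congrArg (PowerSeries.coeff (n + 1)) h1
      rw [PowerSeries.coeff_succ_X_mul, PowerSeries.coeff_derivative] at h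
      simp only [cothSeries, map_sub, PowerSeries.coeff_mk, PowerSeries.coeff_one] at h
      have hn : (n : ℂ) + 1 ≠ 0 := Nat.cast_add_one_ne_zero n
      rw [← eq_div_iff hn] at h
      rw [h]
      have hf : ((n + 1).factorial : ℂ) ≠ 0 := by exact_mod_cast Nat.factorial_ne_zero _
      split_ifs with h3 <;> simp_all
      field_simp
  rwa [← h6]

/-! ### Exponentials of even power series -/

/-- The constant term `-B_n/(2n)` of the Eisenstein series of weight `n`. -/
def eisConst (n : ℕ) : ℂ := -((bernoulli n : ℚ) : ℂ) / (2 * n)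

/-- The series `-∑ 2 g_n uⁿ / n!`, over even `n > 0`. -/
def logSeries (g : ℕ → ℂ) : PowerSeries ℂ :=
  PowerSeries.mk fun n => if Even n ∧ n ≠ 0 then -2 * g n / n.factorial else 0

/-- The exponents of the theta product, in terms of the Eisenstein series. -/
def thetaExponent (N : ℕ) (X Y : ℂ) (g g' : ℕ → ℂ) (n : ℕ) : ℂ :=
  if Even n ∧ n ≠ 0 then
    2 / n.factorial * (g n * (X ^ n + Y ^ n - (X + Y) ^ n) +
      g' n * ((N * X * Y) ^ n + 1 - (N * X * Y - 1) ^ n)) else 0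

/-- The leading coefficient of the theta product. -/
def thetaLead (N : ℕ) (X Y : ℂ) : ℂ := (X + Y) * (N * X * Y - 1) / (N * X ^ 2 * Y ^ 2)

/-- The coefficients of the theta product, in terms of the Eisenstein series. -/
def thetaCoeff (N : ℕ) (X Y : ℂ) (g g' : ℕ → ℂ) (n : ℕ) : ℂ :=
  thetaLead N X Y * expCoeff (thetaExponent N X Y g g') n

lemma thetaCoeff_odd (N : ℕ) (X Y : ℂ) (g g' : ℕ → ℂ) {n : ℕ} (hn : Odd n) :
    thetaCoeff N X Y g g' n = 0 := by
  rw [thetaCoeff, expCoeff_odd _ hn, mul_zero]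
  intro m hm
  rw [thetaExponent, if_neg]
  exact fun h => Nat.not_even_iff_odd.2 hm h.1

/-- This is the case q = 0 of the expansion of the theta logarithm: only the constant terms of the
Eisenstein series remain. -/
lemma logSinhcSeries_eq : logSinhcSeries = logSeries eisConst := by
  ext n
  simp only [logSinhcSeries, logSeries, PowerSeries.coeff_mk, eisConst]
  split_ifs with h
  · have : (n : ℂ) ≠ 0 := by exact_mod_cast h.2
    have hf : (n.factorial : ℂ) ≠ 0 := by exact_mod_cast Nat.factorial_ne_zero _
    field_simp
  · rfl

lemma hasTaylor_log_sinhc_mul (m : ℂ) :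
    HasTaylor (fun u => Complex.log (sinhc (m * u))) (logSeries fun n => m ^ n * eisConst n) := by
  convert hasTaylor_log_sinhc.comp_mul m using 1
  ext n
  simp only [logSinhcSeries_eq, logSeries, PowerSeries.coeff_mk, PowerSeries.coeff_rescale]
  split_ifs <;> ring

/-- The theta product and its values at the cusps have the same shape and differ only in the numbers
g, g'; this lemma serves both. -/
lemma hasTaylor_exp_logSeries (N : ℕ) (X Y : ℂ) {L L' : ℂ → ℂ} {g g' : ℕ → ℂ}
    (h : HasTaylor L (logSeries g)) (h' : HasTaylor L' (logSeries g')) :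
    HasTaylor (fun T => cexp (L ((X + Y) * T) - L (X * T) - L (Y * T) +
      (L' ((N * X * Y - 1) * T) - L' (N * X * Y * T) - L' T)))
      (PowerSeries.mk (expCoeff (thetaExponent N X Y g g'))) := by
  have key := (((h.comp_mul (X + Y)).sub (h.comp_mul X)).sub (h.comp_mul Y)).add
    (((h'.comp_mul (N * X * Y - 1)).sub (h'.comp_mul (N * X * Y))).sub h')
  convert key.exp ?_ using 3
  · ext n
    simp only [thetaExponent, logSeries, map_add, map_sub, PowerSeries.coeff_mk,
      PowerSeries.coeff_rescale]
    split_ifs <;> ring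
  · simp only [map_add, map_sub, PowerSeries.coeff_rescale, logSeries, PowerSeries.coeff_mk]
    simp

lemma eventually_sinhc_ne_zero (c : ℂ) : ∀ᶠ u in 𝓝 (0 : ℂ), sinhc (c * u) ≠ 0 := by
  have h : Continuous fun u => sinhc (c * u) :=
    differentiable_sinhc.continuous.comp (by fun_prop)
  exact h.continuousAt.eventually_ne (by simp [sinhc_zero])

/-- The function `T² sinhRatio`, up to a constant factor. -/
def sinhcRatio (N : ℕ) (m X Y T : ℂ) : ℂ :=
  sinhc (m * ((X + Y) * T)) * sinhc (m⁻¹ * ((N * X * Y - 1) * T)) /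
    (sinhc (m * (X * T)) * sinhc (m * (Y * T)) *
      (sinhc (m⁻¹ * (N * X * Y * T)) * sinhc (m⁻¹ * T)))

lemma hasTaylor_sinhcRatio (N : ℕ) (m X Y : ℂ) :
    HasTaylor (sinhcRatio N m X Y) (PowerSeries.mk (expCoeff (thetaExponent N X Y
      (fun n => m ^ n * eisConst n) (fun n => m⁻¹ ^ n * eisConst n)))) := by
  refine (hasTaylor_exp_logSeries N X Y (hasTaylor_log_sinhc_mul m)
    (hasTaylor_log_sinhc_mul m⁻¹)).congr ?_
  have hc (c d : ℂ) : ∀ᶠ u in 𝓝 (0 : ℂ), sinhc (c * (d * u)) ≠ 0 := by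
    simpa [mul_assoc] using eventually_sinhc_ne_zero (c * d)
  filter_upwards [hc m (X + Y), hc m X, hc m Y, hc m⁻¹ (N * X * Y - 1), hc m⁻¹ (N * X * Y),
    eventually_sinhc_ne_zero m⁻¹] with T h1 h2 h3 h4 h5 h6
  simp only [Complex.exp_add, Complex.exp_sub, Complex.exp_log h1, Complex.exp_log h2,
    Complex.exp_log h3, Complex.exp_log h4, Complex.exp_log h5, Complex.exp_log h6, sinhcRatio]
  field_simp

lemma sinhRatio_eq {N : ℕ} (hN : N ≠ 0) {m X Y T : ℂ} (hm : m ≠ 0) (hX : X ≠ 0) (hY : Y ≠ 0)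
    (hT : T ≠ 0) :
    sinhRatio N m X Y T = T ^ (-2 : ℤ) * (thetaLead N X Y * sinhcRatio N m X Y T) := by
  have h (c : ℂ) : sinh (c / 2) = c * sinhc c / 2 := by rw [mul_sinhc]; ring
  have hN' : (N : ℂ) ≠ 0 := by exact_mod_cast hN
  have e1 : m * (X + Y) * T / 2 = (m * ((X + Y) * T)) / 2 := by ring
  have e2 : (N * X * Y - 1) * T / (2 * m) = (m⁻¹ * ((N * X * Y - 1) * T)) / 2 := by field_simp
  have e3 : m * X * T / 2 = (m * (X * T)) / 2 := by ring
  have e4 : m * Y * T / 2 = (m * (Y * T)) / 2 := by ring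
  have e5 : T / (2 * m) = (m⁻¹ * T) / 2 := by field_simp
  have e6 : N * X * Y * T / (2 * m) = (m⁻¹ * (N * X * Y * T)) / 2 := by field_simp
  rw [sinhRatio, e1, e2, e3, e4, e5, e6, sinhcRatio, thetaLead]
  simp only [h]
  generalize sinhc (m * ((X + Y) * T)) = s1
  generalize sinhc (m⁻¹ * ((N * X * Y - 1) * T)) = s2
  generalize sinhc (m * (X * T)) = s3
  generalize sinhc (m * (Y * T)) = s4
  generalize sinhc (m⁻¹ * (N * X * Y * T)) = s5
  generalize sinhc (m⁻¹ * T) = s6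
  rw [zpow_neg]
  field_simp
  norm_num
  ring

/-- After removal of T⁻² the quotient is holomorphic wherever the four factors `sinhc` of the
denominator have no zero, and `sinhc` has none of absolute value below 2π. -/
lemma hasSum_sinhRatio {N : ℕ} (hN : N ≠ 0) {m X Y T : ℂ} (hm : m ≠ 0) (hX : X ≠ 0) (hY : Y ≠ 0)
    (hT : T ≠ 0) (h1 : ‖m * X * T‖ < 2 * π) (h2 : ‖m * Y * T‖ < 2 * π) (h3 : ‖T / m‖ < 2 * π)
    (h4 : ‖N * X * Y * T / m‖ < 2 * π) :
    HasSum (fun k : ℕ => thetaCoeff N X Y (fun n => m ^ n * eisConst n)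
      (fun n => m⁻¹ ^ n * eisConst n) k * T ^ ((k : ℤ) - 2)) (sinhRatio N m X Y T) := by
  -- K is the largest modulus of the four multipliers of T in the denominator, so the four
  -- hypotheses together say ‖T‖ < 2π/K.
  let K := max (max ‖m * X‖ ‖m * Y‖) (max ‖m⁻¹‖ ‖m⁻¹ * (N * X * Y)‖)
  have hK : 0 < K := lt_max_of_lt_right (lt_max_of_lt_left (by simpa using hm))
  have hT' : ‖T‖ < 2 * π / K := by
    rw [lt_div_iff₀ hK, mul_max_of_nonneg _ _ (norm_nonneg T),
      mul_max_of_nonneg _ _ (norm_nonneg T), mul_max_of_nonneg _ _ (norm_nonneg T)]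
    simp only [← norm_mul, max_lt_iff]
    refine ⟨⟨?_, ?_⟩, ?_, ?_⟩
    · rwa [mul_comm T]
    · rwa [mul_comm T]
    · rwa [← div_eq_mul_inv]
    · rwa [show T * (m⁻¹ * (N * X * Y)) = N * X * Y * T / m by ring]
  have hs (c : ℂ) (hc : ‖c‖ ≤ K) (z : ℂ) (hz : z ∈ Metric.ball (0 : ℂ) (2 * π / K)) :
      sinhc (c * z) ≠ 0 := by
    refine sinhc_ne_zero ?_
    rw [mem_ball_zero_iff, lt_div_iff₀ hK] at hz
    rw [norm_mul]
    nlinarith [norm_nonneg z]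
  have hcomp (c d : ℂ) : DifferentiableOn ℂ (fun z => sinhc (c * (d * z)))
      (Metric.ball 0 (2 * π / K)) :=
    (differentiable_sinhc.comp (by fun_prop : Differentiable ℂ fun z => c * (d *
        z))).differentiableOn
  have hcomp' (c : ℂ) : DifferentiableOn ℂ (fun z => sinhc (c * z))
      (Metric.ball 0 (2 * π / K)) :=
    (differentiable_sinhc.comp (by fun_prop : Differentiable ℂ fun z => c * z)).differentiableOn
  have hd : DifferentiableOn ℂ (sinhcRatio N m X Y) (Metric.ball 0 (2 * π / K)) := by
    refine DifferentiableOn.div ((hcomp _ _).mul (hcomp _ _))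
      (((hcomp _ _).mul (hcomp _ _)).mul ((hcomp _ _).mul (hcomp' _))) fun z hz => ?_
    have a1 := hs (m * X) (by simp [K]) z hz
    have a2 := hs (m * Y) (by simp [K]) z hz
    have a3 := hs m⁻¹ (le_max_of_le_right (le_max_left _ _)) z hz
    have a4 := hs (m⁻¹ * (N * X * Y)) (le_max_of_le_right (le_max_right _ _)) z hz
    rw [mul_assoc] at a1 a2 a4
    exact mul_ne_zero (mul_ne_zero a1 a2) (mul_ne_zero a4 a3)
  have := ((hasTaylor_sinhcRatio N m X Y).hasSum_of_differentiableOn hd hT').mul_left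
    (T ^ (-2 : ℤ) * thetaLead N X Y)
  rw [sinhRatio_eq hN hm hX hY hT, ← mul_assoc]
  convert! this using 2 with k
  rw [thetaCoeff, PowerSeries.coeff_mk, zpow_sub₀ hT, zpow_natCast, zpow_neg]
  ring

/-- The addition theorem: sinh(a+b)/(sinh a sinh b) = coth a + coth b, and similarly for the
difference. It makes the Laurent coefficients bilinear in Bernoulli numbers. -/
lemma lead_mul_sinhcRatio {N : ℕ} (hN : N ≠ 0) {m X Y : ℂ} (hm : m ≠ 0) (hX : X ≠ 0) (hY : Y ≠ 0)
    {T : ℂ} (h1 : sinhc (m * (X * T)) ≠ 0) (h2 : sinhc (m * (Y * T)) ≠ 0)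
    (h3 : sinhc (m⁻¹ * (N * X * Y * T)) ≠ 0) (h4 : sinhc (m⁻¹ * T) ≠ 0) :
    thetaLead N X Y * sinhcRatio N m X Y T =
      ((m * X)⁻¹ * (cosh (m * (X * T) / 2) / sinhc (m * (X * T))) +
        (m * Y)⁻¹ * (cosh (m * (Y * T) / 2) / sinhc (m * (Y * T)))) *
      (m * (cosh (m⁻¹ * T / 2) / sinhc (m⁻¹ * T)) - (m⁻¹ * (N * X * Y))⁻¹ *
        (cosh (m⁻¹ * (N * X * Y * T) / 2) / sinhc (m⁻¹ * (N * X * Y * T)))) := by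
  have hN' : (N : ℂ) ≠ 0 := by exact_mod_cast hN
  -- The identities `g1` and `g2` below are obtained by cancelling T, so T = 0 is checked directly.
  rcases eq_or_ne T 0 with rfl | hT
  · simp [sinhcRatio, sinhc_zero, thetaLead]
    field_simp
    ring
  have e1 : (X + Y) * T * m * sinhc (m * ((X + Y) * T)) = 2 * (sinh (m * (X * T) / 2) *
      cosh (m * (Y * T) / 2) + cosh (m * (X * T) / 2) * sinh (m * (Y * T) / 2)) := by
    rw [← Complex.sinh_add, show m * (X * T) / 2 + m * (Y * T) / 2 = m * ((X + Y) * T) / 2 by ring,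
      ← mul_sinhc]
    ring
  have e2 : (N * X * Y - 1) * T * m⁻¹ * sinhc (m⁻¹ * ((N * X * Y - 1) * T)) =
      2 * (sinh (m⁻¹ * (N * X * Y * T) / 2) * cosh (m⁻¹ * T / 2) -
        cosh (m⁻¹ * (N * X * Y * T) / 2) * sinh (m⁻¹ * T / 2)) := by
    rw [← Complex.sinh_sub, show m⁻¹ * (N * X * Y * T) / 2 - m⁻¹ * T / 2 =
      m⁻¹ * ((N * X * Y - 1) * T) / 2 by ring, ← mul_sinhc]
    ring
  have h (c : ℂ) : 2 * sinh (c / 2) = c * sinhc c := by rw [mul_sinhc]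
  have f1 := h (m * (X * T))
  have f2 := h (m * (Y * T))
  have f3 := h (m⁻¹ * (N * X * Y * T))
  have f4 := h (m⁻¹ * T)
  rw [sinhcRatio, thetaLead]
  generalize sinhc (m * ((X + Y) * T)) = s1 at *
  generalize sinhc (m⁻¹ * ((N * X * Y - 1) * T)) = s2 at *
  generalize sinhc (m * (X * T)) = s3 at *
  generalize sinhc (m * (Y * T)) = s4 at *
  generalize sinhc (m⁻¹ * (N * X * Y * T)) = s5 at *
  generalize sinhc (m⁻¹ * T) = s6 at *
  generalize cosh (m * (X * T) / 2) = c3 at *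
  generalize cosh (m * (Y * T) / 2) = c4 at *
  generalize cosh (m⁻¹ * (N * X * Y * T) / 2) = c5 at *
  generalize cosh (m⁻¹ * T / 2) = c6 at *
  have g1 : (X + Y) * s1 = X * s3 * c4 + Y * c3 * s4 := by
    refine mul_left_cancel₀ (mul_ne_zero hT hm) ?_
    linear_combination e1 + c4 * f1 + c3 * f2
  have g2 : (N * X * Y - 1) * s2 = N * X * Y * s5 * c6 - c5 * s6 := by
    refine mul_left_cancel₀ (mul_ne_zero hT (inv_ne_zero hm)) ?_
    linear_combination e2 + c6 * f3 - c5 * f4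
  field_simp
  linear_combination (X + Y) * s1 * g2 + (N * X * Y * s5 * c6 - c5 * s6) * g1

/-- The Laurent coefficients of `sinhRatio`, in terms of Bernoulli numbers. -/
theorem thetaCoeff_eq_sum_bernoulli {N : ℕ} (hN : N ≠ 0) {m X Y : ℂ} (hm : m ≠ 0) (hX : X ≠ 0)
    (hY : Y ≠ 0) (k : ℕ) :
    thetaCoeff N X Y (fun n => m ^ n * eisConst n) (fun n => m⁻¹ ^ n * eisConst n) k =
    ∑ p ∈ (Finset.HasAntidiagonal.antidiagonal k).filter (fun p => Even p.1 ∧ Even p.2),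
      ((bernoulli p.1 : ℚ) : ℂ) / (p.1.factorial : ℂ) *
      (((bernoulli p.2 : ℚ) : ℂ) / (p.2.factorial : ℂ)) * m ^ ((p.1 : ℤ) - p.2) *
      ((X ^ ((p.1 : ℤ) - 1) + Y ^ ((p.1 : ℤ) - 1)) * (1 - (N * X * Y) ^ ((p.2 : ℤ) - 1))) := by
  have hN' : (N : ℂ) ≠ 0 := by exact_mod_cast hN
  have hc := hasTaylor_coth
  have key := (((hc.comp_mul (m * X)).const_mul (m * X)⁻¹).add
    ((hc.comp_mul (m * Y)).const_mul (m * Y)⁻¹)).mul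
    (((hc.comp_mul m⁻¹).const_mul m).sub
      ((hc.comp_mul (m⁻¹ * (N * X * Y))).const_mul (m⁻¹ * (N * X * Y))⁻¹))
  have h := ((hasTaylor_sinhcRatio N m X Y).const_mul (thetaLead N X Y)).congr
    (g := _) ?_ |>.unique key
  · have := congrArg (PowerSeries.coeff k) h
    rw [PowerSeries.coeff_smul, PowerSeries.coeff_mk, PowerSeries.coeff_mul, smul_eq_mul] at this
    rw [thetaCoeff, this, Finset.sum_filter]
    refine Finset.sum_congr rfl fun p _ => ?_
    simp only [map_add, map_sub, PowerSeries.coeff_smul, PowerSeries.coeff_rescale, cothSeries,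
      PowerSeries.coeff_mk, smul_eq_mul]
    have hX1 : X ^ ((p.1 : ℤ) - 1) = X ^ p.1 * X⁻¹ := by rw [zpow_sub₀ hX]; simp [div_eq_mul_inv]
    have hY1 : Y ^ ((p.1 : ℤ) - 1) = Y ^ p.1 * Y⁻¹ := by rw [zpow_sub₀ hY]; simp [div_eq_mul_inv]
    have hXY : (N * X * Y) ^ ((p.2 : ℤ) - 1) = (N * X * Y) ^ p.2 * (N * X * Y)⁻¹ := by
      rw [zpow_sub₀ (by simp [hX, hY, hN'])]; simp [div_eq_mul_inv]
    have hm1 : m ^ ((p.1 : ℤ) - p.2) = m ^ p.1 * m⁻¹ ^ p.2 := by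
      rw [zpow_sub₀ hm]; simp [div_eq_mul_inv]
    by_cases h1 : Even p.1 <;> by_cases h2 : Even p.2 <;> simp only [h1, h2, if_true, if_false,
      and_self, and_true, and_false, mul_zero, add_zero, zero_mul, sub_zero]
    rw [hX1, hY1, hXY, hm1]
    simp only [mul_pow, mul_inv, inv_inv]
    field_simp
  · have hcc (c d : ℂ) : ∀ᶠ u in 𝓝 (0 : ℂ), sinhc (c * (d * u)) ≠ 0 := by
      simpa [mul_assoc] using eventually_sinhc_ne_zero (c * d)
    filter_upwards [hcc m X, hcc m Y, hcc m⁻¹ (N * X * Y), eventually_sinhc_ne_zero m⁻¹]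
      with T h1 h2 h3 h4
    rw [lead_mul_sinhcRatio hN hm hX hY h1 h2 h3 h4]
    simp only [mul_assoc]

/-! ### The Taylor expansion of the logarithm of the theta function -/

/-- The function `-∑_{n ≥ 1} log(1 - qⁿ e^u)`. -/
def qLog (q u : ℂ) : ℂ := ∑' c : ℕ+ × ℕ+, q ^ (c.1 * c.2 : ℕ) * (cexp (c.2 * u) / c.2)

/-- The sums `∑_{m, n ≥ 1} m^{j-1} q^{mn}`. -/
def qSum (q : ℂ) (j : ℕ) : ℂ := ∑' c : ℕ+ × ℕ+, q ^ (c.1 * c.2 : ℕ) * ((c.2 : ℂ) ^ j / c.2)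

/-- Summing absolute values over the exponent j first gives exp(c₂‖u‖), and the remaining double
series is dominated by (‖q‖e^{‖u‖})^{c₁c₂}. Absolute convergence of the triple sum justifies the
interchange in `hasSum_qLog`. -/
lemma summable_qLog_expansion {q u : ℂ} (h : ‖q‖ * Real.exp ‖u‖ < 1) :
    Summable fun x : (ℕ+ × ℕ+) × ℕ =>
      q ^ (x.1.1 * x.1.2 : ℕ) * (((x.1.2 * u) ^ x.2 / x.2.factorial) / x.1.2) := by
  apply Summable.of_norm
  have hs (c : ℕ+ × ℕ+) : HasSum (fun j : ℕ => ‖q ^ (c.1 * c.2 : ℕ) *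
      (((c.2 * u) ^ j / j.factorial) / c.2)‖)
      (‖q‖ ^ (c.1 * c.2 : ℕ) * (Real.exp (c.2 * ‖u‖) / c.2)) := by
    have := NormedSpace.expSeries_div_hasSum_exp ((c.2 : ℝ) * ‖u‖)
    rw [← Real.exp_eq_exp_ℝ] at this
    convert! (this.div_const (c.2 : ℝ)).mul_left (‖q‖ ^ (c.1 * c.2 : ℕ)) using 2 with j
    simp
  rw [summable_prod_of_nonneg fun _ => norm_nonneg _]
  refine ⟨fun c => (hs c).summable, ?_⟩
  simp only [(hs _).tsum_eq]
  have h1 : ‖‖q‖ * Real.exp ‖u‖‖ < 1 := by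
    rwa [Real.norm_of_nonneg (by positivity)]
  refine Summable.of_nonneg_of_le (fun c => by positivity) (fun c => ?_)
    (summable_prod_mul_pow 0 h1)
  rw [pow_zero, one_mul, mul_pow]
  refine mul_le_mul_of_nonneg_left ?_ (by positivity)
  have hc2 : (1 : ℝ) ≤ c.2 := by exact_mod_cast one_le (a := c.2)
  have hc1 : (1 : ℝ) ≤ c.1 := by exact_mod_cast one_le (a := c.1)
  calc Real.exp (c.2 * ‖u‖) / c.2 ≤ Real.exp (c.2 * ‖u‖) := div_le_self (by positivity) hc2
    _ ≤ Real.exp ((c.1 * c.2 : ℕ) * ‖u‖) := by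
        refine Real.exp_le_exp.2 (mul_le_mul_of_nonneg_right ?_ (norm_nonneg _))
        push_cast
        nlinarith
    _ = Real.exp ‖u‖ ^ (c.1 * c.2 : ℕ) := by rw [← Real.exp_nat_mul]

lemma hasSum_qLog_terms (q u : ℂ) (c : ℕ+ × ℕ+) :
    HasSum (fun j : ℕ => q ^ (c.1 * c.2 : ℕ) * (((c.2 * u) ^ j / j.factorial) / c.2))
      (q ^ (c.1 * c.2 : ℕ) * (cexp (c.2 * u) / c.2)) := by
  have := NormedSpace.expSeries_div_hasSum_exp ((c.2 : ℂ) * u)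
  rw [← Complex.exp_eq_exp_ℂ] at this
  exact (this.div_const _).mul_left _

lemma summable_qLog {q u : ℂ} (h : ‖q‖ * Real.exp ‖u‖ < 1) :
    Summable fun c : ℕ+ × ℕ+ => q ^ (c.1 * c.2 : ℕ) * (cexp (c.2 * u) / c.2) :=
  (summable_qLog_expansion h).hasSum.prod_fiberwise (hasSum_qLog_terms q u) |>.summable

lemma hasSum_qLog {q u : ℂ} (h : ‖q‖ * Real.exp ‖u‖ < 1) :
    HasSum (fun j : ℕ => qSum q j / j.factorial * u ^ j) (qLog q u) := by
  have hs := summable_qLog_expansion h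
  have h1 := (hs.hasSum.prod_fiberwise (hasSum_qLog_terms q u)).tsum_eq
  have h2 := (Equiv.prodComm ℕ (ℕ+ × ℕ+)).hasSum_iff.2 hs.hasSum
  rw [qLog, h1]
  refine h2.prod_fiberwise fun j => ?_
  have h3 := ((Equiv.prodComm _ _).summable_iff.2 hs).prod_factor j
  have h4 := h3.hasSum
  convert! h4 using 1
  rw [qSum, div_mul_eq_mul_div, ← tsum_mul_right, ← tsum_div_const]
  refine tsum_congr fun c => ?_
  simp only [Function.comp, Equiv.prodComm_apply, Prod.swap]
  rw [mul_pow]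
  ring

lemma hasTaylor_qLog {q : ℂ} (hq : ‖q‖ < 1) :
    HasTaylor (qLog q) (PowerSeries.mk fun j => qSum q j / j.factorial) := by
  have h : ContinuousAt (fun u : ℂ => ‖q‖ * Real.exp ‖u‖) 0 := by fun_prop
  filter_upwards [h.eventually_lt (continuousAt_const (y := (1 : ℝ))) (by simpa using hq)]
    with u hu
  simpa using hasSum_qLog hu

/-- Expanding each log(1 - qⁿe^u) gives the double series of `qLog`. Exponentiating the sum of the
logarithms raises no question of branches. -/
lemma hasProd_one_sub_pow {q u : ℂ} (h : ‖q‖ * Real.exp ‖u‖ < 1) :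
    HasProd (fun n : ℕ => 1 - q ^ (n + 1) * cexp u) (cexp (-qLog q u)) := by
  have hn (n : ℕ+) : ‖q ^ (n : ℕ) * cexp u‖ < 1 := by
    have h1 : ‖q‖ ≤ 1 := by
      have : 1 ≤ Real.exp ‖u‖ := Real.one_le_exp (norm_nonneg u)
      nlinarith [norm_nonneg q]
    rw [norm_mul, norm_pow]
    refine lt_of_le_of_lt ?_ h
    refine mul_le_mul (pow_le_of_le_one (norm_nonneg _) h1 n.ne_zero) ?_ (norm_nonneg _)
      (norm_nonneg _)
    rw [Complex.norm_exp]
    exact Real.exp_le_exp.2 (Complex.re_le_norm u)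
  have h1 : HasSum (fun n : ℕ+ => -Complex.log (1 - q ^ (n : ℕ) * cexp u)) (qLog q u) := by
    refine (summable_qLog h).hasSum.prod_fiberwise fun n => ?_
    have h2 := hasSum_taylorSeries_neg_log (hn n)
    rw [← PNat.coe_injective.hasSum_iff] at h2
    · convert! h2 using 2 with m
      simp only [Function.comp]
      rw [mul_pow, ← pow_mul, ← Complex.exp_nat_mul, mul_div_assoc]
    · intro m hm
      rcases Nat.eq_zero_or_pos m with rfl | h0
      · simp
      · exact absurd ⟨⟨m, h0⟩, rfl⟩ hm
  have h2 := (Equiv.pnatEquivNat.symm.hasSum_iff.2 h1).neg.cexp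
  convert! h2 using 2 with n
  simp only [Function.comp, neg_neg]
  rw [Complex.exp_log]
  · rfl
  · intro h0
    have := hn (Equiv.pnatEquivNat.symm n)
    rw [← sub_eq_zero.1 h0] at this
    simp at this

/-- Pairs are grouped by their product. -/
lemma qSum_succ {q : ℂ} (hq : ‖q‖ < 1) (j : ℕ) :
    qSum q (j + 1) = ∑' n : ℕ, (ArithmeticFunction.sigma j n : ℂ) * q ^ n := by
  have h1 := tsum_prod_pow_eq_tsum_sigma j hq
  rw [← (summable_prod_mul_pow j hq).tsum_prod] at h1
  have h2 : qSum q (j + 1) = ∑' c : ℕ+ × ℕ+, (c.2 : ℂ) ^ j * q ^ (c.1 * c.2 : ℕ) := by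
    refine tsum_congr fun c => ?_
    have : (c.2 : ℂ) ≠ 0 := by exact_mod_cast c.2.ne_zero
    field_simp
    ring
  rw [h2, h1]
  refine PNat.coe_injective.tsum_eq (f := fun n : ℕ =>
    (ArithmeticFunction.sigma j n : ℂ) * q ^ n) fun m hm => ?_
  rcases Nat.eq_zero_or_pos m with rfl | h0
  · simp at hm
  · exact ⟨⟨m, h0⟩, rfl⟩

/-- The logarithm of `θ_τ(u) / (θ'_τ(0) u)`. -/
def thetaLog (q u : ℂ) : ℂ :=
  Complex.log (sinhc u) - (qLog q u + qLog q (-1 * u) - 2 * qLog q 0)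

lemma norm_cexp_lt_one {τ : ℂ} (hτ : 0 < τ.im) : ‖cexp (2 * π * I * τ)‖ < 1 :=
  norm_exp_two_pi_I_lt_one ⟨τ, hτ⟩

lemma eisG_eq (k : ℕ) (τ : ℍ) : eisG k τ = eisConst k +
    ∑' n : ℕ, (ArithmeticFunction.sigma (k - 1) n : ℂ) * cexp (2 * π * I * τ) ^ n := by
  rw [eisG, eisConst]
  congr 2
  ext n
  rw [← Complex.exp_nat_mul]
  congr 2
  ring

/-- In `qLog q u + qLog q (-u)` odd powers cancel and even powers double, giving the divisor sums of
G_n. The logarithm of `sinhc` supplies the constant terms, and 2 `qLog q 0` removes the term of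
degree zero. -/
lemma hasTaylor_thetaLog (τ : ℍ) :
    HasTaylor (thetaLog (cexp (2 * π * I * τ))) (logSeries fun n => eisG n τ) := by
  set q := cexp (2 * π * I * τ) with hqdef
  have hq : ‖q‖ < 1 := norm_cexp_lt_one τ.im_pos
  have h0 := hasTaylor_qLog hq
  have h1 : HasTaylor (thetaLog q) _ := hasTaylor_log_sinhc.sub ((h0.add (h0.comp_mul (-1))).sub
    (hasTaylor_const (2 * qLog q 0)))
  convert h1 using 1
  ext n
  simp only [logSinhcSeries_eq, logSeries, map_sub, map_add, PowerSeries.coeff_mk,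
    PowerSeries.coeff_rescale, PowerSeries.coeff_C]
  have hz : qLog q 0 = qSum q 0 := by rw [h0.eq_coeff_zero]; simp
  rcases n with _ | n
  · simp [hz]; ring
  · rw [qSum_succ hq, eisG_eq, Nat.add_sub_cancel]
    rcases Nat.even_or_odd (n + 1) with he | ho
    · simp only [he, he.neg_one_pow, Nat.succ_ne_zero, ne_eq, not_false_eq_true, and_self, if_true,
        if_false]
      ring
    · simp only [ho.neg_one_pow, Nat.not_even_iff_odd.2 ho, Nat.succ_ne_zero, false_and, if_false]
      ring

/-- The factor `θ'_τ(0)`. -/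
def thetaFactor (τ : ℂ) : ℂ :=
  cexp (2 * π * I * τ / 8) * cexp (-3 * qLog (cexp (2 * π * I * τ)) 0)

/-- The factor 1 - e^{-u} of the product, together with e^{u/2}, is 2 sinh(u/2) = u `sinhc u`. The
identity is local because expanding the logarithms requires ‖q‖e^{‖u‖} < 1. -/
lemma theta_eq (τ : ℍ) : ∀ᶠ u in 𝓝 (0 : ℂ),
    theta τ u = thetaFactor τ * (u * cexp (thetaLog (cexp (2 * π * I * τ)) u)) := by
  have hq : ‖cexp (2 * π * I * τ)‖ < 1 := norm_cexp_lt_one τ.im_pos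
  have h : ContinuousAt (fun u : ℂ => ‖cexp (2 * π * I * τ)‖ * Real.exp ‖u‖) 0 := by fun_prop
  have hs : ∀ᶠ u in 𝓝 (0 : ℂ), sinhc u ≠ 0 := by
    simpa using eventually_sinhc_ne_zero 1
  filter_upwards [h.eventually_lt (continuousAt_const (y := (1 : ℝ))) (by simpa using hq), hs]
    with u hu hsu
  rw [theta, thetaFactor, thetaLog]
  set q := cexp (2 * π * I * τ) with hqdef
  have p1 := hasProd_one_sub_pow (q := q) (u := 0) (by simpa using hq)
  have p2 := hasProd_one_sub_pow hu
  have p3 := hasProd_one_sub_pow (q := q) (u := -u) (by simpa using hu)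
  -- The family with e^{-u} starts at q⁰, one step earlier than the other two; its first factor is
  -- split off.
  have p3' := HasProd.zero_mul (f := fun n : ℕ => 1 - q ^ n * cexp (-u)) p3
  have hp := ((p1.mul p2).mul p3').tprod_eq
  simp only [Complex.exp_zero, mul_one, pow_zero, one_mul] at hp
  rw [hp, Complex.exp_sub, Complex.exp_log hsu, ← mul_div_assoc u, neg_one_mul]
  have e1 : u * sinhc u = cexp (u / 2) * (1 - cexp (-u)) := by
    rw [mul_sinhc, mul_sub, ← Complex.exp_add, Complex.sinh]
    ring_nf
  have e2 : cexp (-qLog q 0) * cexp (-qLog q u) * cexp (-qLog q (-u)) =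
      cexp (-3 * qLog q 0) / cexp (qLog q u + qLog q (-u) - 2 * qLog q 0) := by
    rw [← Complex.exp_add, ← Complex.exp_add, ← Complex.exp_sub]
    ring_nf
  rw [e1]
  linear_combination cexp (2 * π * I * τ / 8) * cexp (u / 2) * (1 - cexp (-u)) * e2

lemma deriv_theta (τ : ℍ) : deriv (theta τ) 0 = thetaFactor τ := by
  have h1 : deriv (theta τ) 0 = _ := Filter.EventuallyEq.deriv_eq (theta_eq τ)
  rw [h1]
  have hd : DifferentiableAt ℂ (fun u => cexp (thetaLog (cexp (2 * π * I * τ)) u)) 0 :=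
    (hasTaylor_thetaLog τ).analyticAt.cexp.differentiableAt
  have h2 := ((hasDerivAt_id (0 : ℂ)).mul hd.hasDerivAt).const_mul (thetaFactor τ)
  have h3 : thetaLog (cexp (2 * π * I * τ)) 0 = 0 := by
    rw [(hasTaylor_thetaLog τ).eq_coeff_zero]
    simp [logSeries]
  simpa [h3] using h2.deriv

lemma thetaFactor_ne_zero (τ : ℂ) : thetaFactor τ ≠ 0 :=
  mul_ne_zero (Complex.exp_ne_zero _) (Complex.exp_ne_zero _)

/-- The point `Nτ` of the upper half plane. -/
abbrev scale (N : ℕ) (τ : ℍ) : ℍ := ofComplex ((N : ℂ) * τ)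

lemma coe_scale {N : ℕ} (hN : N ≠ 0) (τ : ℍ) : (scale N τ : ℂ) = N * τ := by
  rw [scale, ofComplex_apply_of_im_pos]
  have : (0 : ℝ) < N := by positivity
  simpa using mul_pos this τ.im_pos

/-- The Laurent coefficients of the theta product. -/
def thetaB (N : ℕ) (X Y : ℂ) (k : ℕ) (τ : ℍ) : ℂ :=
  thetaCoeff N X Y (fun n => eisG n τ) (fun n => eisG n (scale N τ)) k

lemma exp_sub_add_sub (a b c d e f : ℂ) : cexp (a - b - c + (d - e - f)) =
    cexp a / (cexp b * cexp c) * (cexp d / (cexp e * cexp f)) := by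
  simp only [← Complex.exp_add, ← Complex.exp_sub]
  ring_nf

lemma theta_ratio_aux {n X Y T F F' a b c d e f : ℂ} (hn : n ≠ 0) (hX : X ≠ 0) (hY : Y ≠ 0)
    (hT : T ≠ 0) (hF : F ≠ 0) (hF' : F' ≠ 0) (hb : b ≠ 0) (hc : c ≠ 0) (he : e ≠ 0) (hf : f ≠ 0) :
    F * (F * ((X + Y) * T * a)) / (F * (X * T * b) * (F * (Y * T * c))) *
      (F' * (F' * ((n * X * Y - 1) * T * d)) / (F' * (n * X * Y * T * e) * (F' * (T * f)))) =
    (T ^ (2 : ℤ))⁻¹ * ((X + Y) * (n * X * Y - 1) / (n * X ^ 2 * Y ^ 2)) *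
      (a / (b * c) * (d / (e * f))) := by
  rw [show (2 : ℤ) = ((2 : ℕ) : ℤ) by rfl, zpow_natCast]
  field_simp

/-- The Laurent expansion of the theta product at the origin. -/
theorem hasSum_thetaProd {N : ℕ} (hN : N ≠ 0) {X Y : ℂ} (hX : X ≠ 0) (hY : Y ≠ 0) (τ : ℍ) :
    ∀ᶠ T in 𝓝[≠] (0 : ℂ),
      HasSum (fun k : ℕ => thetaB N X Y k τ * T ^ ((k : ℤ) - 2)) (thetaProd N X Y τ T) := by
  have hN' : (N : ℂ) ≠ 0 := by exact_mod_cast hN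
  have key := hasTaylor_exp_logSeries N X Y (hasTaylor_thetaLog τ) (hasTaylor_thetaLog (scale N τ))
  have ht (c : ℂ) : Tendsto (fun z : ℂ => c * z) (𝓝 0) (𝓝 0) := by
    have : Continuous fun z : ℂ => c * z := by fun_prop
    simpa using this.tendsto 0
  have e (c : ℂ) := (ht c).eventually (theta_eq τ)
  have e' (c : ℂ) := (ht c).eventually (theta_eq (scale N τ))
  filter_upwards [nhdsWithin_le_nhds key, nhdsWithin_le_nhds (e (X + Y)), nhdsWithin_le_nhds (e X),
    nhdsWithin_le_nhds (e Y), nhdsWithin_le_nhds (e' (N * X * Y - 1)),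
    nhdsWithin_le_nhds (e' (N * X * Y)), nhdsWithin_le_nhds (theta_eq (scale N τ)),
    self_mem_nhdsWithin] with T hk h1 h2 h3 h4 h5 h6 hT
  have hT' : T ≠ 0 := hT
  have key2 := hk.mul_left (T ^ (-2 : ℤ) * thetaLead N X Y)
  convert! key2 using 1
  · ext k
    rw [thetaB, thetaCoeff, PowerSeries.coeff_mk, zpow_sub₀ hT', zpow_natCast, zpow_neg]
    ring
  · have h7 := deriv_theta τ
    have h8 := deriv_theta (scale N τ)
    have f1 := thetaFactor_ne_zero τ
    have f2 := thetaFactor_ne_zero (scale N τ)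
    rw [coe_scale hN] at h4 h5 h6 h8 f2 ⊢
    rw [thetaProd, h1, h2, h3, h4, h5, h6, h7, h8, thetaLead, exp_sub_add_sub]
    generalize thetaFactor τ = F at *
    generalize thetaFactor (N * τ) = F' at *
    rw [zpow_neg]
    exact theta_ratio_aux hN' hX hY hT' f1 f2 (Complex.exp_ne_zero _) (Complex.exp_ne_zero _)
      (Complex.exp_ne_zero _) (Complex.exp_ne_zero _)

/-! ### Eisenstein series of level one -/

lemma zeta_even_eq {k : ℕ} (hk : Even k) (hk0 : k ≠ 0) :
    riemannZeta k = -(-1) ^ (k / 2) * (2 * π) ^ k * ((bernoulli k : ℚ) : ℂ) / (2 * k.factorial)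
        := by
  obtain ⟨m, rfl⟩ := hk
  have hm : m ≠ 0 := by omega
  have h := riemannZeta_two_mul_nat hm
  rw [← two_mul, Nat.mul_div_cancel_left _ two_pos, Nat.cast_mul, Nat.cast_two, h, pow_succ,
    mul_pow 2]
  have h2 : (2 : ℂ) ^ (2 * m) = 2 ^ (2 * m - 1) * 2 := by
    rw [← pow_succ]
    congr 1
    omega
  rw [h2]
  field_simp

/-- By Euler's formula B_k = 0 would force ζ(k) = 0, which is impossible for Re s ≥ 1. -/
lemma bernoulli_ne_zero_of_even {k : ℕ} (hk : Even k) (hk0 : k ≠ 0) :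
    ((bernoulli k : ℚ) : ℂ) ≠ 0 := by
  intro h
  have h1 := zeta_even_eq hk hk0
  rw [h] at h1
  refine riemannZeta_ne_zero_of_one_le_re (s := k) ?_ (by simpa using h1)
  simp
  omega

lemma tsum_pnat_sigma (j : ℕ) (q : ℂ) :
    ∑' n : ℕ+, (ArithmeticFunction.sigma j n : ℂ) * q ^ (n : ℕ) =
      ∑' n : ℕ, (ArithmeticFunction.sigma j n : ℂ) * q ^ n := by
  refine PNat.coe_injective.tsum_eq (f := fun n : ℕ =>
    (ArithmeticFunction.sigma j n : ℂ) * q ^ n) fun m hm => ?_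
  rcases Nat.eq_zero_or_pos m with rfl | h0
  · simp at hm
  · exact ⟨⟨m, h0⟩, rfl⟩

lemma eisG_eq_E {k : ℕ} (hk : 3 ≤ k) (hk2 : Even k) (τ : ℍ) :
    eisG k τ = eisConst k * ModularForm.E hk τ := by
  have hb := bernoulli_ne_zero_of_even hk2 (by omega)
  have hk' : (k : ℂ) ≠ 0 := by exact_mod_cast (by omega : k ≠ 0)
  rw [eisG_eq, EisensteinSeries.q_expansion_bernoulli hk hk2]
  simp only [zpow_natCast]
  rw [tsum_pnat_sigma, eisConst]
  field_simp
  ring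

lemma eisG_two (τ : ℍ) : eisG 2 τ = -1 / 24 * EisensteinSeries.E2 τ := by
  rw [eisG_eq, EisensteinSeries.E2_eq_tsum_cexp, tsum_pnat_sigma, eisConst, bernoulli_two]
  push_cast
  ring

/-- The constant in the transformation formula of `G₂`. -/
def quasiConst : ℂ := 1 / 24 * (1 / (2 * riemannZeta 2)) * (2 * π * I)

/-- Only the shape of the correction in weight two matters below: a fixed constant times c(cτ+d).
Its value always cancels. -/
lemma eisG_smul {k : ℕ} (hk : 2 ≤ k) (hk2 : Even k) (γ : SL(2, ℤ)) (τ : ℍ) :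
    eisG k (γ • τ) = denom γ τ ^ k * eisG k τ +
      if k = 2 then quasiConst * (γ 1 0 : ℂ) * denom γ τ else 0 := by
  have hd : denom γ τ ≠ 0 := denom_ne_zero _ _
  rcases eq_or_ne k 2 with rfl | hk3
  · have h := congrFun (EisensteinSeries.E2_slash_action γ) τ
    rw [ModularForm.SL_slash_apply] at h
    simp only [Pi.sub_apply, Pi.smul_apply, EisensteinSeries.D2, smul_eq_mul] at h
    rw [eisG_two, eisG_two, quasiConst, if_pos rfl]
    rw [zpow_neg, ← div_eq_mul_inv, div_eq_iff (zpow_ne_zero _ hd)] at h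
    rw [h]
    rw [show (2 : ℤ) = ((2 : ℕ) : ℤ) by rfl, zpow_natCast]
    field_simp
    ring
  · have hk4 : 3 ≤ k := by omega
    rw [eisG_eq_E hk4 hk2, eisG_eq_E hk4 hk2, if_neg hk3]
    have h : ModularForm.E hk4 (γ • τ) = denom γ τ ^ (k : ℤ) * ModularForm.E hk4 τ :=
      SlashInvariantForm.slash_action_eqn'' (ModularForm.E hk4) (MonoidHom.mem_range.2 ⟨γ, rfl⟩) τ
    rw [h, zpow_natCast]
    ring

lemma mdifferentiable_eisG {k : ℕ} (hk : 2 ≤ k) (hk2 : Even k) : MDiff (eisG k) := by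
  rcases eq_or_ne k 2 with rfl | hk3
  · rw [show eisG 2 = (-1 / 24 : ℂ) • EisensteinSeries.E2 from funext eisG_two]
    exact _root_.E2_mdifferentiable.const_smul _
  · have hk4 : 3 ≤ k := by omega
    rw [show eisG k = eisConst k • (ModularForm.E hk4 : ℍ → ℂ) from
      funext (eisG_eq_E hk4 hk2)]
    exact (ModularFormClass.holo (ModularForm.E hk4)).const_smul _

/-- Every nonzero q in the unit disc is e^{2πiτ} for some τ in ℍ, so convergence on ℍ gives
convergence on the disc. -/
lemma hasTaylor_of_hasSum_qParam {f : ℍ → ℂ} {φ : PowerSeries ℂ}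
    (h : ∀ τ : ℍ, HasSum (fun n => φ.coeff n * cexp (2 * π * I * τ) ^ n) (f τ)) :
    HasTaylor (fun z => ∑' n, φ.coeff n * z ^ n) φ := by
  filter_upwards [Metric.ball_mem_nhds (0 : ℂ) one_pos] with z hz
  rw [mem_ball_zero_iff] at hz
  refine Summable.hasSum ?_
  rcases eq_or_ne z 0 with rfl | hz0
  · exact (hasSum_single (f := fun n : ℕ => φ.coeff n * (0 : ℂ) ^ n) 0
      fun n hn => by simp [hn]).summable
  · have h1 := Function.Periodic.im_invQParam_pos_of_norm_lt_one one_pos hz hz0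
    have h2 := (h ⟨_, h1⟩).summable
    have h3 := Function.Periodic.qParam_right_inv one_ne_zero hz0
    rw [Function.Periodic.qParam] at h3
    simp only [ofReal_one, div_one] at h3
    simpa only [h3] using h2

lemma tendsto_of_hasSum_qParam {f : ℍ → ℂ} {φ : PowerSeries ℂ}
    (h : ∀ τ : ℍ, HasSum (fun n => φ.coeff n * cexp (2 * π * I * τ) ^ n) (f τ)) :
    Tendsto f atImInfty (𝓝 (φ.coeff 0)) := by
  have h1 := hasTaylor_of_hasSum_qParam h
  have h2 := h1.analyticAt.continuousAt.tendsto
  rw [h1.eq_coeff_zero] at h2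
  have h3 := h2.comp (qParam_tendsto_atImInfty one_pos)
  refine h3.congr fun τ => ?_
  simp only [Function.comp, Function.Periodic.qParam, ofReal_one, div_one]
  exact (h τ).tsum_eq

/-- The Fourier series of `G_k`. -/
def eisSeries (k : ℕ) : PowerSeries ℂ :=
  PowerSeries.mk fun n => if n = 0 then eisConst k else (ArithmeticFunction.sigma (k - 1) n : ℂ)

lemma hasSum_eisG {k : ℕ} (hk : 1 ≤ k) (τ : ℍ) :
    HasSum (fun n => (eisSeries k).coeff n * cexp (2 * π * I * τ) ^ n) (eisG k τ) := by
  have h := (EisensteinSeries.summable_sigma_mul_cexp_pow hk τ).hasSum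
  have h2 := (hasSum_ite_eq (0 : ℕ) (eisConst k)).add h
  rw [eisG_eq]
  convert! h2 using 2 with n
  rw [eisSeries, PowerSeries.coeff_mk]
  split_ifs with h0
  · simp [h0]
  · simp

lemma tendsto_eisG {k : ℕ} (hk : 1 ≤ k) : Tendsto (eisG k) atImInfty (𝓝 (eisConst k)) := by
  simpa [eisSeries] using tendsto_of_hasSum_qParam (hasSum_eisG hk)

/-! ### Multiples of the argument, and the Atkin-Lehner matrices -/

/-- The function `d^{k/2} G_k(dτ)`, for even `k`. -/
def eisV (k d : ℕ) (τ : ℍ) : ℂ := (d : ℂ) ^ (k / 2) * eisG k (scale d τ)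

lemma tendsto_scale {d : ℕ} (hd : d ≠ 0) : Tendsto (scale d) atImInfty atImInfty := by
  rw [atImInfty, tendsto_comap_iff]
  have hd' : (0 : ℝ) < d := by positivity
  have h : UpperHalfPlane.im ∘ scale d = fun τ => (d : ℝ) * τ.im := by
    ext τ
    have := congrArg Complex.im (coe_scale hd τ)
    simpa using this
  rw [h]
  exact tendsto_comap.const_mul_atTop hd'

lemma tendsto_eisV {k d : ℕ} (hk : 1 ≤ k) (hd : d ≠ 0) :
    Tendsto (eisV k d) atImInfty (𝓝 ((d : ℂ) ^ (k / 2) * eisConst k)) :=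
  ((tendsto_eisG hk).comp (tendsto_scale hd)).const_mul _

lemma mdifferentiable_comp_scale {f : ℍ → ℂ} (hf : MDiff f) {d : ℕ} (hd : d ≠ 0) :
    MDiff (fun τ => f (scale d τ)) := by
  rw [UpperHalfPlane.mdifferentiable_iff] at hf ⊢
  have hd' : (0 : ℝ) < d := by positivity
  have : DifferentiableOn ℂ ((f ∘ ofComplex) ∘ fun z => (d : ℂ) * z) {z | 0 < z.im} := by
    refine hf.comp (by fun_prop) fun z hz => ?_
    simpa using mul_pos hd' hz
  refine this.congr fun z hz => ?_
  simp only [Function.comp, scale]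
  rw [ofComplex_apply_of_im_pos hz]

lemma mdifferentiable_eisV {k d : ℕ} (hk : 2 ≤ k) (hk2 : Even k) (hd : d ≠ 0) :
    MDiff (eisV k d) := by
  have := (mdifferentiable_comp_scale (mdifferentiable_eisG hk hk2) hd).const_smul
    ((d : ℂ) ^ (k / 2))
  exact this

/-- The product `a ⋆ b = ab / gcd(a, b)²` of two divisors of a squarefree number. -/
def star (a b : ℕ) : ℕ := a * b / Nat.gcd a b ^ 2

lemma star_mul (a b : ℕ) : star a b * Nat.gcd a b ^ 2 = a * b := by
  rw [star, Nat.div_mul_cancel]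
  rw [sq]
  exact mul_dvd_mul (Nat.gcd_dvd_left a b) (Nat.gcd_dvd_right a b)

lemma IsAtkinLehner.det_eq {N M : ℕ} {W : GL (Fin 2) ℝ} (h : IsAtkinLehner N M W) :
    W.det.val = M := by
  obtain ⟨a, b, c, d, -, -, -, hdet, hW⟩ := h
  have h1 : W.det.val = (W : Matrix (Fin 2) (Fin 2) ℝ).det := rfl
  rw [h1, hW, Matrix.det_fin_two]
  simp
  exact_mod_cast hdet

lemma slash_eq_of_det {k M : ℕ} {W : GL (Fin 2) ℝ} (h : W.det.val = M) (f : ℍ → ℂ) (τ : ℍ) :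
    slash k W f τ = ((Real.sqrt M : ℂ) / denom W τ) ^ k * f (W • τ) := by
  rw [slash, h, div_pow, zpow_neg, zpow_natCast, ← ofReal_pow]
  congr 2
  rw [Real.sqrt_eq_rpow, ← Real.rpow_natCast, ← Real.rpow_mul (by positivity)]
  congr 2
  ring

lemma sqrt_pow_even {k : ℕ} (hk : Even k) (d : ℕ) :
    (Real.sqrt d : ℂ) ^ k = (d : ℂ) ^ (k / 2) := by
  obtain ⟨m, rfl⟩ := hk
  rw [← two_mul, Nat.mul_div_cancel_left _ two_pos, pow_mul, ← ofReal_pow,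
    Real.sq_sqrt (by positivity)]
  simp

/-- With g = gcd(d, M) one has diag(d,1)·W = g·γ·diag(d ⋆ M, 1) for some γ in SL₂(ℤ), and G_k is
(quasi)modular under γ. The correction in weight two does not depend on d; every later cancellation
rests on this. -/
lemma slash_eisV {N M d k : ℕ} (hN : N ≠ 0) (hk : 2 ≤ k) (hk2 : Even k) {W : GL (Fin 2) ℝ}
    (hW : IsAtkinLehner N M W) (hM : M ∣ N) (hd : d ∣ N) (τ : ℍ) :
    slash k W (eisV k d) τ = eisV k (star d M) τ +
      if k = 2 then quasiConst * (W 1 0) / denom W τ else 0 := by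
  have hM0 : M ≠ 0 := ne_zero_of_dvd_ne_zero hN hM
  have hd0 : d ≠ 0 := ne_zero_of_dvd_ne_zero hN hd
  rw [slash_eq_of_det hW.det_eq, div_pow, sqrt_pow_even hk2]
  obtain ⟨a, b, c, e, ⟨a', ha⟩, hc, ⟨e', he⟩, hdet, hWm⟩ := hW
  obtain ⟨g, hg⟩ : ∃ g, g = Nat.gcd d M := ⟨_, rfl⟩
  have hg0 : 0 < g := hg ▸ Nat.gcd_pos_of_pos_left _ (Nat.pos_of_ne_zero hd0)
  obtain ⟨d1, hd1⟩ : g ∣ d := hg ▸ Nat.gcd_dvd_left d M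
  obtain ⟨M1, hM1⟩ : g ∣ M := hg ▸ Nat.gcd_dvd_right d M
  have hstar : star d M = d1 * M1 := by
    have h := star_mul d M
    rw [← hg, hd1, hM1] at h
    rw [hd1, hM1]
    exact Nat.eq_of_mul_eq_mul_right (pow_pos hg0 2) (by rw [h]; ring)
  -- This number is lcm(d, M). Its dividing N, hence c, makes the lower left entry of γ integral.
  have hlcm : d1 * M1 * g ∣ N := by
    have h := Nat.lcm_dvd hd hM
    rw [Nat.lcm, ← hg, Nat.div_eq_of_eq_mul_left hg0 (show d * M = d1 * M1 * g * g by
      rw [hd1, hM1]; ring)] at h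
    exact h
  obtain ⟨c', hc'⟩ : ((d1 * M1 * g : ℕ) : ℤ) ∣ c := (Int.natCast_dvd_natCast.2 hlcm).trans hc
  have hd10 : d1 ≠ 0 := by rintro rfl; simp at hd1; exact hd0 hd1
  have hM10 : M1 ≠ 0 := by rintro rfl; simp at hM1; exact hM0 hM1
  have hgz : (g : ℤ) ≠ 0 := by exact_mod_cast hg0.ne'
  have hM1z : (M1 : ℤ) ≠ 0 := by exact_mod_cast hM10
  let γ : SL(2, ℤ) := ⟨!![g * a', d1 * b; c', M1 * e'], by
    rw [Matrix.det_fin_two_of]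
    refine mul_left_cancel₀ (mul_ne_zero hgz hM1z) ?_
    rw [ha, he, hc', hM1] at hdet
    push_cast at hdet
    linear_combination hdet⟩
  have hdenW : denom W τ = c * τ + e := by simp [denom, hWm]
  have hγd : denom γ (scale (star d M) τ) * g = denom W τ := by
    rw [hdenW, ModularGroup.denom_apply, coe_scale (hstar ▸ mul_ne_zero hd10 hM10), hstar, hc', he,
      hM1]
    simp [γ]
    ring
  have hden0 : denom W τ ≠ 0 := denom_ne_zero _ _
  have hg0' : (g : ℂ) ≠ 0 := by exact_mod_cast hg0.ne'
  have hγd0 : denom γ (scale (star d M) τ) ≠ 0 := by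
    intro h0
    rw [h0, zero_mul] at hγd
    exact hden0 hγd.symm
  have hpos : 0 < W.det.val := by
    rw [IsAtkinLehner.det_eq ⟨a, b, c, e, ⟨a', ha⟩, hc, ⟨e', he⟩, hdet, hWm⟩]
    positivity
  have hpt : scale d (W • τ) = γ • scale (star d M) τ := by
    ext
    rw [coe_scale hd0, coe_smul_of_det_pos hpos, coe_specialLinearGroup_apply,
      coe_scale (hstar ▸ mul_ne_zero hd10 hM10), mul_div_assoc', div_eq_div_iff hden0]
    · rw [hdenW, hstar, hd1]
      simp only [num, hWm, γ, hc', he, hM1, ha]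
      simp
      ring
    · rw [ModularGroup.denom_apply, coe_scale (hstar ▸ mul_ne_zero hd10 hM10)] at hγd0
      simpa using hγd0
  rw [eisV, hpt, eisG_smul hk hk2, ← hγd, eisV, hstar, hWm]
  rw [hstar] at hγd0
  generalize denom γ (scale (d1 * M1) τ) = D at *
  have hγ10 : γ 1 0 = c' := rfl
  rw [hγ10, hd1, hM1]
  obtain ⟨m, rfl⟩ := hk2
  rw [← two_mul, Nat.mul_div_cancel_left _ two_pos]
  simp only [pow_mul, Matrix.of_apply, Matrix.cons_val', Matrix.cons_val_zero,
    Matrix.cons_val_one, hc']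
  split_ifs with h2
  · obtain rfl : m = 1 := by omega
    simp
    field_simp
  · push_cast
    rw [← pow_mul, mul_pow D, add_zero, add_zero, pow_mul]
    field_simp
    simp only [mul_pow]
    ring

/-! ### Modularity of the coefficients of the theta product -/

lemma scale_one (τ : ℍ) : scale 1 τ = τ := by
  ext
  rw [coe_scale one_ne_zero]
  simp

lemma eisV_one (k : ℕ) : eisV k 1 = eisG k := by
  ext τ
  simp [eisV, scale_one]

lemma star_one_left (M : ℕ) : star 1 M = M := by simp [star]

lemma star_of_dvd {N M : ℕ} (hM0 : M ≠ 0) (hM : M ∣ N) : star N M = N / M := by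
  rw [star, Nat.gcd_eq_right hM, sq, Nat.mul_div_mul_right _ _ (Nat.pos_of_ne_zero hM0)]

/-- The expansion of `B_k | W_M` in terms of Eisenstein series. -/
def thetaBAt (N M : ℕ) (X Y : ℂ) (k : ℕ) (τ : ℍ) : ℂ :=
  thetaCoeff N X Y (fun n => eisV n M τ)
    (fun n => ((N : ℂ) ^ (n / 2))⁻¹ * eisV n (N / M) τ) k

lemma thetaB_eq {N : ℕ} (hN : N ≠ 0) (X Y : ℂ) (k : ℕ) : thetaB N X Y k = thetaBAt N 1 X Y k := by
  have hN' : (N : ℂ) ≠ 0 := by exact_mod_cast hN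
  ext τ
  rw [thetaB, thetaBAt]
  congr 1
  · ext n
    rw [eisV_one]
  · ext n
    rw [Nat.div_one, eisV, inv_mul_cancel_left₀ (pow_ne_zero _ hN')]

/-- By homogeneity the slash acts on each exponent in its own weight. There W_M sends the indices 1
and N to 1 ⋆ M = M and N ⋆ M = N/M. -/
theorem slash_thetaB {N M : ℕ} (hN : N ≠ 0) (X Y : ℂ) (k : ℕ) {W : GL (Fin 2) ℝ}
    (hW : IsAtkinLehner N M W) (hM : M ∣ N) :
    slash k W (thetaB N X Y k) = thetaBAt N M X Y k := by
  have hN' : (N : ℂ) ≠ 0 := by exact_mod_cast hN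
  have hM0 : M ≠ 0 := ne_zero_of_dvd_ne_zero hN hM
  ext τ
  rw [slash_eq_of_det hW.det_eq, thetaB, thetaBAt, thetaCoeff, thetaCoeff, mul_left_comm,
    ← expCoeff_mul_pow]
  refine congrArg _ (expCoeff_congr (fun n hn => ?_) k)
  rw [thetaExponent, thetaExponent]
  split_ifs with h
  · have hn2 : 2 ≤ n := by
      rcases h with ⟨⟨m, rfl⟩, h0⟩
      omega
    have e1 := slash_eisV hN hn2 h.1 hW hM (one_dvd N) τ
    have e2 := slash_eisV hN hn2 h.1 hW hM dvd_rfl τ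
    rw [slash_eq_of_det hW.det_eq, star_one_left, eisV_one] at e1
    rw [slash_eq_of_det hW.det_eq, star_of_dvd hM0 hM, eisV, mul_left_comm,
      ← eq_inv_mul_iff_mul_eq₀ (pow_ne_zero _ hN')] at e2
    rw [mul_left_comm, mul_add, ← mul_assoc _ (eisG n (W • τ)),
      ← mul_assoc _ (eisG n (scale N (W • τ))), e1, e2]
    -- In weight two the multipliers are X²+Y²-(X+Y)² = -2XY and (NXY)²+1-(NXY-1)² = 2NXY. The
    -- second comes with the factor N⁻¹, so the two equal corrections cancel.
    split_ifs with h2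
    · subst h2
      simp
      field_simp
      ring
    · simp
  · simp

lemma differentiableOn_expCoeff {p : ℕ → ℂ → ℂ} {s : Set ℂ}
    (h : ∀ n, 0 < n → DifferentiableOn ℂ (p n) s) (n : ℕ) :
    DifferentiableOn ℂ (fun z => expCoeff (fun j => p j z) n) s := by
  induction n using Nat.strong_induction_on with
  | _ n ih =>
    cases n with
    | zero => simpa only [expCoeff] using differentiableOn_const 1
    | succ n =>
      simp only [expCoeff_succ]
      refine DifferentiableOn.const_mul (DifferentiableOn.fun_sum fun i _ => ?_) _
      exact ((h (i + 1) (by omega)).const_mul _).mul (ih (n - i) (by omega))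

lemma mdifferentiable_thetaB {N : ℕ} (hN : N ≠ 0) (X Y : ℂ) (k : ℕ) : MDiff (thetaB N X Y k) := by
  rw [UpperHalfPlane.mdifferentiable_iff]
  refine DifferentiableOn.const_mul (differentiableOn_expCoeff (p := fun n z =>
    thetaExponent N X Y (fun n => eisG n (ofComplex z)) (fun n => eisG n (scale N (ofComplex z))) n)
    (fun n hn => ?_) k) _
  simp only [thetaExponent]
  split_ifs with h
  · have hn2 : 2 ≤ n := by
      rcases h with ⟨⟨m, rfl⟩, h0⟩
      omega
    have h1 := UpperHalfPlane.mdifferentiable_iff.1 (mdifferentiable_eisG hn2 h.1)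
    have h2 := UpperHalfPlane.mdifferentiable_iff.1
      (mdifferentiable_comp_scale (mdifferentiable_eisG hn2 h.1) hN)
    exact ((h1.mul_const _).add (h2.mul_const _)).const_mul _
  · exact differentiableOn_const 0

/-- The values at the cusps of the coefficients of the generating function. -/
def cuspValue (N : ℕ) (X Y : ℂ) (M k : ℕ) : ℂ :=
  thetaCoeff N X Y (fun n => (Real.sqrt M : ℂ) ^ n * eisConst n)
    (fun n => (Real.sqrt M : ℂ)⁻¹ ^ n * eisConst n) k

/-- At i∞ the first family tends to M^{n/2} and the second to N^{-n/2}(N/M)^{n/2} = M^{-n/2}, each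
times the constant term of G_n. These are the exponents of the sinh quotient with m = √M. -/
theorem tendsto_slash_thetaB {N M : ℕ} (hN : N ≠ 0) (X Y : ℂ) (k : ℕ) {W : GL (Fin 2) ℝ}
    (hW : IsAtkinLehner N M W) (hM : M ∣ N) :
    Tendsto (slash k W (thetaB N X Y k)) atImInfty (𝓝 (cuspValue N X Y M k)) := by
  have hM0 : M ≠ 0 := ne_zero_of_dvd_ne_zero hN hM
  have hN' : (N : ℂ) ≠ 0 := by exact_mod_cast hN
  have hM' : (M : ℂ) ≠ 0 := by exact_mod_cast hM0
  rw [slash_thetaB hN X Y k hW hM]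
  refine Tendsto.const_mul _ (tendsto_expCoeff (fun n hn => ?_) k)
  simp only [thetaExponent]
  split_ifs with h
  · have hNM : N / M ≠ 0 := by
      rw [Nat.div_ne_zero_iff_of_dvd hM]
      exact ⟨hN, hM0⟩
    have e1 := tendsto_eisV (k := n) (by omega) hM0
    have e2 := (tendsto_eisV (k := n) (by omega) hNM).const_mul ((N : ℂ) ^ (n / 2))⁻¹
    rw [inv_pow, sqrt_pow_even h.1]
    have e3 : ((N : ℂ) ^ (n / 2))⁻¹ * (((N / M : ℕ) : ℂ) ^ (n / 2) * eisConst n) =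
        ((M : ℂ) ^ (n / 2))⁻¹ * eisConst n := by
      rw [Nat.cast_div hM hM', div_pow]
      field_simp
    rw [e3] at e2
    exact ((e1.mul_const _).add (e2.mul_const _)).const_mul _
  · exact tendsto_const_nhds

/-! ### Cusp forms from the Atkin-Lehner matrices -/

lemma isAtkinLehner_of_mem_Gamma0 {N : ℕ} {γ : SL(2, ℤ)} (hγ : γ ∈ CongruenceSubgroup.Gamma0 N) :
    IsAtkinLehner N 1 (Matrix.SpecialLinearGroup.mapGL ℝ γ) := by
  refine ⟨γ 0 0, γ 0 1, γ 1 0, γ 1 1, by simp, ?_, by simp, ?_, ?_⟩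
  · rw [CongruenceSubgroup.Gamma0_mem] at hγ
    exact (ZMod.intCast_zmod_eq_zero_iff_dvd _ _).1 hγ
  · have := γ.2
    rw [Matrix.det_fin_two] at this
    simpa using this
  · ext i j
    fin_cases i <;> fin_cases j <;> simp

/-- The cusp γ∞ is W_M∞ for M = N/gcd(c, N), where c is the lower left entry of γ. Squarefreeness
makes c prime to M, so a translation u can be found with M ∣ cu + d. Thus the Atkin-Lehner matrices
reach all cusps. -/
lemma exists_isAtkinLehner_mul {N : ℕ} (hN : Squarefree N) (γ : SL(2, ℤ)) :
    ∃ (M : ℕ) (W : GL (Fin 2) ℝ) (u : ℤ), M ∣ N ∧ IsAtkinLehner N M W ∧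
      (W : Matrix (Fin 2) (Fin 2) ℝ) = (Matrix.SpecialLinearGroup.mapGL ℝ γ :
        Matrix (Fin 2) (Fin 2) ℝ) * !![(M : ℝ), (u : ℝ); 0, 1] := by
  have hN0 : N ≠ 0 := hN.ne_zero
  obtain ⟨g, hg⟩ : ∃ g, g = Int.gcd (γ 1 0) N := ⟨_, rfl⟩
  have hgN : g ∣ N := by
    have := Int.gcd_dvd_right (γ 1 0) N
    rw [← hg] at this
    exact_mod_cast this
  have hgc : (g : ℤ) ∣ γ 1 0 := hg ▸ Int.gcd_dvd_left (γ 1 0) N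
  obtain ⟨M, hM⟩ := hgN
  have hcop : Nat.Coprime g M := Nat.coprime_of_squarefree_mul (hM ▸ hN)
  have hdet := γ.2
  rw [Matrix.det_fin_two] at hdet
  have hcM : IsCoprime (γ 1 0) (M : ℤ) := by
    rw [Int.isCoprime_iff_gcd_eq_one]
    set e := Int.gcd (γ 1 0) M with he
    have h1 : (e : ℤ) ∣ γ 1 0 := Int.gcd_dvd_left _ _
    have h2 : (e : ℤ) ∣ M := Int.gcd_dvd_right _ _
    have h3 : (e : ℤ) ∣ N := h2.trans (by rw [hM]; push_cast; exact dvd_mul_left _ _)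
    have h4 : e ∣ g := hg ▸ (by exact_mod_cast Int.dvd_coe_gcd h1 h3)
    exact Nat.eq_one_of_dvd_coprimes hcop h4 (by exact_mod_cast h2)
  -- From xc + yM = 1 the choice u = -xd gives cu + d = d(1 - xc) = ydM.
  obtain ⟨x, y, hxy⟩ := hcM
  have hM0 : M ≠ 0 := by rintro rfl; simp at hM; exact hN0 hM
  have hWdet : (!![((γ 0 0 : ℤ) : ℝ) * M, (γ 0 0 : ℤ) * (-(x * γ 1 1) : ℤ) + (γ 0 1 : ℤ);
      ((γ 1 0 : ℤ) : ℝ) * M, (γ 1 0 : ℤ) * (-(x * γ 1 1) : ℤ) + (γ 1 1 : ℤ)]).det ≠ 0 := by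
    rw [Matrix.det_fin_two_of]
    have : ((γ 0 0 : ℤ) : ℝ) * (γ 1 1 : ℤ) - (γ 0 1 : ℤ) * (γ 1 0 : ℤ) = 1 := by
      exact_mod_cast hdet
    have hM' : (M : ℝ) ≠ 0 := by exact_mod_cast hM0
    convert hM' using 1
    linear_combination (M : ℝ) * this
  refine ⟨M, Matrix.GeneralLinearGroup.mkOfDetNeZero _ hWdet, -(x * γ 1 1),
    ⟨g, by rw [hM, mul_comm]⟩, ⟨γ 0 0 * M, γ 0 0 * (-(x * γ 1 1)) + γ 0 1, γ 1 0 * M,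
      γ 1 0 * (-(x * γ 1 1)) + γ 1 1, dvd_mul_left _ _, ?_, ?_, ?_, ?_⟩, ?_⟩
  · rw [hM]
    push_cast
    exact mul_dvd_mul hgc dvd_rfl
  · exact ⟨y * γ 1 1, by linear_combination -(γ 1 1) * hxy⟩
  · linear_combination (M : ℤ) * hdet
  · ext i j
    fin_cases i <;> fin_cases j <;> simp [Matrix.GeneralLinearGroup.mkOfDetNeZero]
  · ext i j
    fin_cases i <;> fin_cases j <;>
      simp [Matrix.GeneralLinearGroup.mkOfDetNeZero, Matrix.mul_apply, Fin.sum_univ_two]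

lemma slash_eq_mul_slash {k M : ℕ} {W : GL (Fin 2) ℝ} (hM : M ≠ 0) (h : W.det.val = M) (f : ℍ → ℂ) :
    slash k W f = fun τ => ((M : ℂ) ^ ((k : ℤ) - 1))⁻¹ * (Real.sqrt M : ℂ) ^ k * (f ∣[(k : ℤ)] W) τ
        := by
  ext τ
  have hM' : (M : ℂ) ≠ 0 := by exact_mod_cast hM
  have hpos : 0 < W.det.val := by rw [h]; positivity
  rw [slash_eq_of_det h, ModularForm.slash_apply, σ, if_pos hpos, h, div_pow]
  simp
  field_simp

/-- A holomorphic function that is invariant under `Γ₀(N)`, for squarefree `N`, is a cusp form if it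
vanishes at infinity after the action of all Atkin-Lehner matrices. -/
theorem exists_cuspForm {N k : ℕ} (hN : Squarefree N) {h : ℍ → ℂ} (hol : MDiff h)
    (hinv : ∀ W : GL (Fin 2) ℝ, IsAtkinLehner N 1 W → slash k W h = h)
    (hzero : ∀ M : ℕ, M ∣ N → ∀ W : GL (Fin 2) ℝ, IsAtkinLehner N M W →
      Tendsto (slash k W h) atImInfty (𝓝 0)) :
    ∃ g : CuspForm (G0 N) k, ∀ τ : ℍ, h τ = g τ := by
  have : NeZero N := ⟨hN.ne_zero⟩
  refine ⟨{ toFun := h, slash_action_eq' := ?_, holo' := hol, zero_at_cusps' := ?_ }, fun τ => rfl⟩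
  · rintro _ ⟨γ, hγ, rfl⟩
    have hW := isAtkinLehner_of_mem_Gamma0 hγ
    have h1 := slash_eq_mul_slash (k := k) one_ne_zero hW.det_eq h
    rw [hinv _ hW] at h1
    ext τ
    simpa using (congrFun h1 τ).symm
  · intro c hc
    have hc' : IsCusp c 𝒮ℒ := (Subgroup.IsArithmetic.isCusp_iff_isCusp_SL2Z _).1 hc
    rw [OnePoint.isZeroAt_iff_forall_SL2Z hc']
    intro γ _
    obtain ⟨M, W, u, hM, hW, hWγ⟩ := exists_isAtkinLehner_mul hN γ
    have hM0 : M ≠ 0 := ne_zero_of_dvd_ne_zero hN.ne_zero hM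
    have hM' : (M : ℂ) ≠ 0 := by exact_mod_cast hM0
    have h1 := hzero M hM W hW
    rw [slash_eq_mul_slash hM0 hW.det_eq] at h1
    have hs : (Real.sqrt M : ℂ) ≠ 0 := by
      rw [ofReal_ne_zero]
      positivity
    have hC : ((M : ℂ) ^ ((k : ℤ) - 1))⁻¹ * (Real.sqrt M : ℂ) ^ k ≠ 0 :=
      mul_ne_zero (inv_ne_zero (zpow_ne_zero _ hM')) (pow_ne_zero _ hs)
    have h2 : IsZeroAtImInfty (h ∣[(k : ℤ)] W) := by
      have := h1.const_mul (((M : ℂ) ^ ((k : ℤ) - 1))⁻¹ * (Real.sqrt M : ℂ) ^ k)⁻¹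
      simp only [inv_mul_cancel_left₀ hC, mul_zero] at this
      exact this
    have hdet : (!![(M : ℝ), (u : ℝ); 0, 1]).det ≠ 0 := by simp [Matrix.det_fin_two_of, hM0]
    have hWeq : W = Matrix.SpecialLinearGroup.mapGL ℝ γ *
        Matrix.GeneralLinearGroup.mkOfDetNeZero _ hdet := Units.ext hWγ
    -- γ is W times an upper triangular matrix, and slashing with such a matrix preserves vanishing
    -- at i∞.
    have h3 : (Matrix.SpecialLinearGroup.mapGL ℝ γ : GL (Fin 2) ℝ) =
        W * (Matrix.GeneralLinearGroup.mkOfDetNeZero _ hdet)⁻¹ := by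
      rw [hWeq, mul_inv_cancel_right]
    have h4 : h ∣[(k : ℤ)] γ = (h ∣[(k : ℤ)] W) ∣[(k : ℤ)]
        (Matrix.GeneralLinearGroup.mkOfDetNeZero _ hdet)⁻¹ := by
      rw [← SlashAction.slash_mul, ← h3]
      rfl
    rw [h4]
    refine IsZeroAtImInfty.slash _ ?_ h2
    rw [Matrix.coe_units_inv]
    simp [Matrix.GeneralLinearGroup.mkOfDetNeZero, Matrix.inv_def, Matrix.adjugate_fin_two]

/-! ### Characters of the group of divisors -/

lemma star_mul_mul {g a b : ℕ} (hg : g ≠ 0) (h : Nat.Coprime a b) : star (g * a) (g * b) = a * b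
    := by
  rw [star, Nat.gcd_mul_left, h, mul_one]
  exact Nat.div_eq_of_eq_mul_left (by positivity) (by ring)

lemma exists_eq_mul_of_dvd {N a b : ℕ} (hN : Squarefree N) (ha : a ∣ N) (hb : b ∣ N) :
    ∃ g a' b' : ℕ, g ≠ 0 ∧ a = g * a' ∧ b = g * b' ∧ a'.Coprime b' ∧ g.Coprime a' ∧ g.Coprime b' ∧
      g * a' * b' ∣ N := by
  have ha0 : a ≠ 0 := ne_zero_of_dvd_ne_zero hN.ne_zero ha
  obtain ⟨g, a', b', hg, hc, h1, h2⟩ := Nat.exists_coprime' (m := a) (n := b)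
    (Nat.gcd_pos_of_pos_left _ (Nat.pos_of_ne_zero ha0))
  rw [mul_comm] at h1 h2
  refine ⟨g, a', b', hg.ne', h1, h2, hc, ?_, ?_, ?_⟩
  · exact Nat.coprime_of_squarefree_mul (hN.squarefree_of_dvd (h1 ▸ ha))
  · exact Nat.coprime_of_squarefree_mul (hN.squarefree_of_dvd (h2 ▸ hb))
  · have := Nat.lcm_dvd ha hb
    rwa [h1, h2, Nat.lcm_mul_left, hc.lcm_eq_mul, ← mul_assoc] at this

lemma star_dvd {N a b : ℕ} (hN : Squarefree N) (ha : a ∣ N) (hb : b ∣ N) : star a b ∣ N := by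
  obtain ⟨g, a', b', hg, rfl, rfl, hc, h1, h2, h⟩ := exists_eq_mul_of_dvd hN ha hb
  rw [star_mul_mul hg hc]
  exact (Dvd.intro_left g (by ring)).trans h

lemma star_star {N a b : ℕ} (hN : Squarefree N) (ha : a ∣ N) (hb : b ∣ N) :
    star (star a b) b = a := by
  obtain ⟨g, a', b', hg, rfl, rfl, hc, h1, h2, h⟩ := exists_eq_mul_of_dvd hN ha hb
  have hb' : b' ≠ 0 := by
    rintro rfl
    rw [mul_zero] at hb
    exact hN.ne_zero (zero_dvd_iff.1 hb)
  rw [star_mul_mul hg hc, mul_comm a', mul_comm g b', star_mul_mul hb' h1.symm, mul_comm]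

lemma star_eq_one_iff {N a b : ℕ} (hN : Squarefree N) (ha : a ∣ N) (hb : b ∣ N) :
    star a b = 1 ↔ a = b := by
  constructor
  · intro h
    rw [← star_star hN ha hb, h, star_one_left]
  · rintro rfl
    have ha0 : a ≠ 0 := ne_zero_of_dvd_ne_zero hN.ne_zero ha
    rw [star, Nat.gcd_self, ← sq, Nat.div_self (by positivity)]

lemma sum_divisors_star {N M : ℕ} (hN : Squarefree N) (hM : M ∣ N) (f : ℕ → ℂ) :
    ∑ d ∈ N.divisors, f (star d M) = ∑ d ∈ N.divisors, f d := by
  refine Finset.sum_nbij' (fun d => star d M) (fun d => star d M) ?_ ?_ ?_ ?_ ?_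
  · intro d hd
    exact Nat.mem_divisors.2 ⟨star_dvd hN (Nat.dvd_of_mem_divisors hd) hM, hN.ne_zero⟩
  · intro d hd
    exact Nat.mem_divisors.2 ⟨star_dvd hN (Nat.dvd_of_mem_divisors hd) hM, hN.ne_zero⟩
  · intro d hd
    exact star_star hN (Nat.dvd_of_mem_divisors hd) hM
  · intro d hd
    exact star_star hN (Nat.dvd_of_mem_divisors hd) hM
  · intro d _
    rfl

namespace ALChar

variable {N : ℕ}

lemma val_of_dvd (hN : N ≠ 0) (ε : ALChar N) {d : ℕ} (hd : d ∣ N) :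
    ε.val d = ((ε.1 ⟨d, Nat.mem_divisors.2 ⟨hd, hN⟩⟩ : ℤˣ) : ℤ) := by
  rw [val, dif_pos]

lemma val_of_not_dvd (ε : ALChar N) {d : ℕ} (hd : ¬ d ∣ N) : ε.val d = 0 := by
  rw [val, dif_neg]
  exact fun h => hd (Nat.dvd_of_mem_divisors h)

lemma val_star (hN : Squarefree N) (ε : ALChar N) {a b : ℕ} (ha : a ∣ N) (hb : b ∣ N) :
    ε.val (star a b) = ε.val a * ε.val b := by
  rw [val_of_dvd hN.ne_zero ε ha, val_of_dvd hN.ne_zero ε hb,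
    val_of_dvd hN.ne_zero ε (star_dvd hN ha hb),
    ε.2 ⟨a, Nat.mem_divisors.2 ⟨ha, hN.ne_zero⟩⟩ ⟨b, Nat.mem_divisors.2 ⟨hb, hN.ne_zero⟩⟩ _ rfl]
  push_cast
  rfl

lemma val_eq_or (hN : N ≠ 0) (ε : ALChar N) {d : ℕ} (hd : d ∣ N) :
    ε.val d = 1 ∨ ε.val d = -1 := by
  rw [val_of_dvd hN ε hd]
  rcases Int.units_eq_one_or (ε.1 ⟨d, Nat.mem_divisors.2 ⟨hd, hN⟩⟩) with h | h <;> simp [h]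

lemma val_mul_self (hN : N ≠ 0) (ε : ALChar N) {d : ℕ} (hd : d ∣ N) : ε.val d * ε.val d = 1 := by
  rcases val_eq_or hN ε hd with h | h <;> simp [h]

lemma val_ne_zero (hN : N ≠ 0) (ε : ALChar N) {d : ℕ} (hd : d ∣ N) : ε.val d ≠ 0 := by
  rcases val_eq_or hN ε hd with h | h <;> simp [h]

lemma val_one (hN : Squarefree N) (ε : ALChar N) : ε.val 1 = 1 := by
  have h := val_star hN ε (one_dvd N) (one_dvd N)
  rw [star_one_left, val_mul_self hN.ne_zero ε (one_dvd N)] at h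
  exact h

lemma val_mul (hN : Squarefree N) (ε : ALChar N) {a b : ℕ} (h : a.Coprime b) :
    ε.val (a * b) = ε.val a * ε.val b := by
  by_cases ha : a ∣ N
  · by_cases hb : b ∣ N
    · rw [← val_star hN ε ha hb, star, h]
      simp
    · rw [val_of_not_dvd ε hb, val_of_not_dvd ε fun h' => hb ((Dvd.intro_left _ rfl).trans h'),
        mul_zero]
  · rw [val_of_not_dvd ε ha, val_of_not_dvd ε fun h' => ha ((Dvd.intro _ rfl).trans h'), zero_mul]

lemma val_mul_val_div (hN : Squarefree N) (ε : ALChar N) {M : ℕ} (hM : M ∣ N) :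
    ε.val M * ε.val (N / M) = ε.val N := by
  obtain ⟨m, rfl⟩ := hM
  have hM0 : M ≠ 0 := by
    rintro rfl
    simp at hN
  rw [Nat.mul_div_cancel_left _ (Nat.pos_of_ne_zero hM0),
    val_mul hN ε (Nat.coprime_of_squarefree_mul hN)]

/-- `ε`, multiplied by a multiplicative function. -/
def twist (ε : ALChar N) (f : ℕ → ℂ) : ArithmeticFunction ℂ :=
  ⟨fun d => ε.val d * if d = 0 then 0 else f d, by simp⟩

lemma twist_apply (ε : ALChar N) (f : ℕ → ℂ) {d : ℕ} (hd : d ≠ 0) :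
    ε.twist f d = ε.val d * f d := by
  simp [twist, hd]

lemma twist_isMultiplicative (hN : Squarefree N) (ε : ALChar N) {f : ℕ → ℂ} (h1 : f 1 = 1)
    (hf : ∀ a b, f (a * b) = f a * f b) : (ε.twist f).IsMultiplicative := by
  refine ArithmeticFunction.IsMultiplicative.iff_ne_zero.2 ⟨?_, fun {a b} ha hb h => ?_⟩
  · rw [twist_apply ε f one_ne_zero, val_one hN, h1, mul_one]
  · rw [twist_apply ε f ha, twist_apply ε f hb, twist_apply ε f (mul_ne_zero ha hb),
      val_mul hN ε h, hf]
    ring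

/-- An Euler product: ε is multiplicative on coprime arguments, and the divisors of a squarefree
number are the products of subsets of its primes. -/
lemma sum_val_mul (hN : Squarefree N) (ε : ALChar N) {f : ℕ → ℂ} (h1 : f 1 = 1)
    (hf : ∀ a b, f (a * b) = f a * f b) :
    ∑ d ∈ N.divisors, ε.val d * f d = ∏ p ∈ N.primeFactors, (1 + ε.val p * f p) := by
  have h := (twist_isMultiplicative hN ε h1 hf).prodPrimeFactors_one_add_of_squarefree hN
  have e1 : ∀ d ∈ N.divisors, ε.twist f d = ε.val d * f d := fun d hd =>
    twist_apply ε f (Nat.pos_of_mem_divisors hd).ne'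
  have e2 : ∀ p ∈ N.primeFactors, 1 + ε.twist f p = 1 + ε.val p * f p := fun p hp => by
    rw [twist_apply ε f (Nat.prime_of_mem_primeFactors hp).ne_zero]
  rw [Finset.sum_congr rfl e1, Finset.prod_congr rfl e2] at h
  exact h.symm

lemma val_eq_prod (hN : Squarefree N) (ε : ALChar N) {d : ℕ} (hd : d ∣ N) :
    ε.val d = ∏ p ∈ d.primeFactors, ε.val p := by
  have h := (twist_isMultiplicative hN ε (f := fun _ => 1) rfl
      (by simp)).map_prod_of_subset_primeFactors
    d d.primeFactors le_rfl
  rw [Nat.prod_primeFactors_of_squarefree (hN.squarefree_of_dvd hd),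
    twist_apply ε _ (ne_zero_of_dvd_ne_zero hN.ne_zero hd), mul_one] at h
  rw [h]
  refine Finset.prod_congr rfl fun p hp => ?_
  rw [twist_apply ε _ (Nat.prime_of_mem_primeFactors hp).ne_zero, mul_one]

/-- The trivial character is the one with all values equal to `1`. -/
def IsTrivial (ε : ALChar N) : Prop := ∀ d ∈ N.divisors, ε.val d = 1

lemma isTrivial_iff (hN : Squarefree N) (ε : ALChar N) :
    ε.IsTrivial ↔ ∀ p ∈ N.primeFactors, ε.val p = 1 := by
  constructor
  · intro h p hp
    exact h p (Nat.mem_divisors.2 ⟨Nat.dvd_of_mem_primeFactors hp, hN.ne_zero⟩)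
  · intro h d hd
    rw [val_eq_prod hN ε (Nat.dvd_of_mem_divisors hd)]
    exact Finset.prod_eq_one fun p hp =>
      h p (Nat.primeFactors_mono (Nat.dvd_of_mem_divisors hd) hN.ne_zero hp)

lemma sum_val_eq_zero (hN : Squarefree N) {ε : ALChar N} (hε : ¬ ε.IsTrivial) :
    ∑ d ∈ N.divisors, ε.val d = 0 := by
  have h := sum_val_mul hN ε (f := fun _ => 1) rfl (by simp)
  simp only [mul_one] at h
  rw [h]
  rw [isTrivial_iff hN] at hε
  push Not at hε
  obtain ⟨p, hp, hp1⟩ := hε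
  refine Finset.prod_eq_zero hp ?_
  rw [(val_eq_or hN.ne_zero ε (Nat.dvd_of_mem_primeFactors hp)).resolve_left hp1]
  ring

lemma ext_val (hN : N ≠ 0) {ε ε' : ALChar N} (h : ∀ d, d ∣ N → ε.val d = ε'.val d) : ε = ε' := by
  refine Subtype.ext (funext fun d => ?_)
  have hd := Nat.dvd_of_mem_divisors d.2
  have h1 := h d hd
  rw [val_of_dvd hN ε hd, val_of_dvd hN ε' hd] at h1
  exact Units.ext (by exact_mod_cast h1)

/-- The trivial character. -/
def triv (N : ℕ) : ALChar N := ⟨fun _ => 1, by simp⟩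

lemma triv_isTrivial : (triv N).IsTrivial := by
  intro d hd
  simp [val, hd, triv]

/-- The product of two characters. -/
def mul (ε ε' : ALChar N) : ALChar N := ⟨fun d => ε.1 d * ε'.1 d, fun a b c h =>
  (congrArg₂ (· * ·) (ε.2 a b c h) (ε'.2 a b c h)).trans (mul_mul_mul_comm _ _ _ _)⟩

lemma mul_val (ε ε' : ALChar N) (d : ℕ) : (ε.mul ε').val d = ε.val d * ε'.val d := by
  simp only [val, mul]
  split_ifs <;> simp

/-- The character that is `-1` exactly on the divisors divisible by the prime `p`. -/
def atPrime (hN : Squarefree N) (p : ℕ) (hp : p.Prime) : ALChar N :=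
  ⟨fun d => if p ∣ d then -1 else 1, fun ⟨a, ha⟩ ⟨b, hb⟩ c h => by
    obtain ⟨g, a', b', hg, rfl, rfl, hc, h1, h2, -⟩ :=
      exists_eq_mul_of_dvd hN (Nat.dvd_of_mem_divisors ha) (Nat.dvd_of_mem_divisors hb)
    have hc' : (c : ℕ) = a' * b' := by rw [h]; exact star_mul_mul hg hc
    have e1 : p ∣ a' → ¬ p ∣ b' := fun i j => Nat.not_coprime_of_dvd_of_dvd hp.one_lt i j hc
    have e2 : p ∣ g → ¬ p ∣ a' := fun i j => Nat.not_coprime_of_dvd_of_dvd hp.one_lt i j h1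
    have e3 : p ∣ g → ¬ p ∣ b' := fun i j => Nat.not_coprime_of_dvd_of_dvd hp.one_lt i j h2
    simp only [hc', hp.dvd_mul]
    by_cases i1 : p ∣ g <;> by_cases i2 : p ∣ a' <;> by_cases i3 : p ∣ b' <;> simp_all⟩

/-- Multiplication by a character with value -1 at d permutes all characters and changes the sign of
the sum. -/
lemma sum_val_char (hN : Squarefree N) {d : ℕ} (hd : d ∣ N) (hd1 : d ≠ 1) :
    ∑ ε : ALChar N, ε.val d = 0 := by
  obtain ⟨p, hp, hpd⟩ := Nat.exists_prime_and_dvd hd1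
  have hval : (atPrime hN p hp).val d = -1 := by
    rw [val_of_dvd hN.ne_zero _ hd]
    simp [atPrime, hpd]
  have hinv : Function.Involutive fun ε : ALChar N => ε.mul (atPrime hN p hp) := fun ε =>
    ext_val hN.ne_zero fun e he => by
      rw [mul_val, mul_val, mul_assoc, val_mul_self hN.ne_zero _ he, mul_one]
  have h := Equiv.sum_comp hinv.toPerm fun ε => ε.val d
  simp only [Function.Involutive.coe_toPerm, mul_val, hval, ← Finset.sum_mul] at h
  linear_combination (-1 / 2 : ℂ) * h

/-- The double sum of ε(d) is evaluated in both orders: over ε first only d = 1 survives, over d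
first only the trivial character, with sum 2^t. -/
lemma card_eq (hN : Squarefree N) : (Fintype.card (ALChar N) : ℂ) = 2 ^ N.primeFactors.card := by
  have h1 : ∑ d ∈ N.divisors, ∑ ε : ALChar N, ε.val d = (Fintype.card (ALChar N) : ℂ) := by
    rw [Finset.sum_eq_single_of_mem 1 (Nat.one_mem_divisors.2 hN.ne_zero) fun d hd h =>
      sum_val_char hN (Nat.dvd_of_mem_divisors hd) h]
    simp [val_one hN]
  rw [← h1, Finset.sum_comm, Finset.sum_eq_single_of_mem (triv N) (Finset.mem_univ _)]
  · have := sum_val_mul hN (triv N) (f := fun _ => 1) rfl (by simp)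
    simp only [mul_one] at this
    rw [this, Finset.prod_congr rfl fun p hp => by
      rw [(isTrivial_iff hN _).1 triv_isTrivial p hp], Finset.prod_const]
    norm_num
  · intro ε _ hε
    refine sum_val_eq_zero hN fun h => hε (ext_val hN.ne_zero fun d hd => ?_)
    have hd' := Nat.mem_divisors.2 ⟨hd, hN.ne_zero⟩
    rw [h d hd', triv_isTrivial d hd']

/-- Fourier inversion on the group of divisors. -/
lemma sum_inversion (hN : Squarefree N) {M : ℕ} (hM : M ∣ N) (c : ℕ → ℂ) :
    ∑ ε : ALChar N, ε.val M * (((2 : ℂ) ^ N.primeFactors.card)⁻¹ * ∑ d ∈ N.divisors, ε.val d *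
        c d) =
      c M := by
  have e : ∀ ε : ALChar N, ε.val M * (((2 : ℂ) ^ N.primeFactors.card)⁻¹ *
      ∑ d ∈ N.divisors, ε.val d * c d) =
      ∑ d ∈ N.divisors, ((2 : ℂ) ^ N.primeFactors.card)⁻¹ * c d * ε.val (star M d) := fun ε => by
    rw [mul_left_comm, Finset.mul_sum, Finset.mul_sum]
    refine Finset.sum_congr rfl fun d hd => ?_
    rw [val_star hN ε hM (Nat.dvd_of_mem_divisors hd)]
    ring
  rw [Finset.sum_congr rfl fun ε (_ : ε ∈ Finset.univ) => e ε, Finset.sum_comm]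
  simp only [← Finset.mul_sum]
  rw [Finset.sum_eq_single_of_mem M (Nat.mem_divisors.2 ⟨hM, hN.ne_zero⟩) (fun d hd hdM => ?_)]
  swap
  · have hd' := Nat.dvd_of_mem_divisors hd
    rw [sum_val_char hN (star_dvd hN hM hd') fun h => hdM ((star_eq_one_iff hN hM hd').1 h).symm,
      mul_zero]
  rw [(star_eq_one_iff hN hM hM).2 rfl]
  simp only [val_one hN, Finset.sum_const, Finset.card_univ, nsmul_eq_mul, mul_one]
  rw [card_eq hN]
  field_simp

end ALChar

/-! ### The Hecke Eisenstein series -/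

lemma heckeEis_eq {N k : ℕ} (hk : Even k) (ε : ALChar N) (τ : ℍ) :
    heckeEis N k ε τ = ∑ d ∈ N.divisors, ε.val d * eisV k d τ := by
  rw [heckeEis, lift]
  refine Finset.sum_congr rfl fun d _ => ?_
  have : (((d : ℝ) ^ ((k : ℝ) / 2) : ℝ) : ℂ) = (d : ℂ) ^ (k / 2) := by
    obtain ⟨m, rfl⟩ := hk
    rw [show ((m + m : ℕ) : ℝ) / 2 = m by push_cast; ring, Real.rpow_natCast, ← two_mul,
      Nat.mul_div_cancel_left _ two_pos]
    push_cast
    rfl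
  rw [this, mul_assoc]
  rfl

/-- Reindexing by d ↦ d ⋆ M extracts ε(M). In weight two the corrections add up to a multiple of ∑
ε(d), which is zero for nontrivial ε. -/
lemma slash_heckeEis {N M k : ℕ} (hN : Squarefree N) (hk : 2 ≤ k) (hk2 : Even k) (ε : ALChar N)
    (hε : ¬ (k = 2 ∧ ε.IsTrivial)) {W : GL (Fin 2) ℝ} (hW : IsAtkinLehner N M W) (hM : M ∣ N) :
    slash k W (heckeEis N k ε) = fun τ => ε.val M * heckeEis N k ε τ := by
  ext τ
  have e1 : slash k W (heckeEis N k ε) τ = ∑ d ∈ N.divisors, ε.val d * slash k W (eisV k d) τ := by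
    rw [slash_eq_of_det hW.det_eq, heckeEis_eq hk2, Finset.mul_sum]
    refine Finset.sum_congr rfl fun d _ => ?_
    rw [slash_eq_of_det hW.det_eq]
    ring
  have e2 : ∀ d ∈ N.divisors, ε.val d * slash k W (eisV k d) τ =
      ε.val M * (ε.val (star d M) * eisV k (star d M) τ) +
        ε.val d * if k = 2 then quasiConst * (W 1 0) / denom W τ else 0 := fun d hd => by
    have hd' := Nat.dvd_of_mem_divisors hd
    rw [slash_eisV hN.ne_zero hk hk2 hW hM hd', mul_add, ALChar.val_star hN ε hd' hM]
    linear_combination -(ε.val d * eisV k (star d M) τ) * ALChar.val_mul_self hN.ne_zero ε hM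
  rw [e1, Finset.sum_congr rfl e2, Finset.sum_add_distrib, ← Finset.mul_sum, ← Finset.sum_mul,
    sum_divisors_star hN hM (fun d => ε.val d * eisV k d τ), heckeEis_eq hk2]
  split_ifs with h
  · rw [ALChar.sum_val_eq_zero hN fun h' => hε ⟨h, h'⟩, zero_mul, add_zero]
  · rw [mul_zero, add_zero]

lemma mdifferentiable_heckeEis {N k : ℕ} (hk : 2 ≤ k) (hk2 : Even k) (ε : ALChar N) :
    MDiff (heckeEis N k ε) := by
  rw [UpperHalfPlane.mdifferentiable_iff]
  have : DifferentiableOn ℂ (fun z => ∑ d ∈ N.divisors, ε.val d * eisV k d (ofComplex z))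
      {z | 0 < z.im} := DifferentiableOn.fun_sum fun d hd =>
    (UpperHalfPlane.mdifferentiable_iff.1
      (mdifferentiable_eisV hk hk2 (Nat.pos_of_mem_divisors hd).ne')).const_mul _
  exact this.congr fun z _ => heckeEis_eq hk2 ε (ofComplex z)

/-- The constant term of the Hecke Eisenstein series. -/
def eisConstTerm (N k : ℕ) (ε : ALChar N) : ℂ :=
  eisConst k * ∑ d ∈ N.divisors, ε.val d * (d : ℂ) ^ (k / 2)

lemma tendsto_heckeEis {N k : ℕ} (hk : 2 ≤ k) (hk2 : Even k) (ε : ALChar N) :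
    Tendsto (heckeEis N k ε) atImInfty (𝓝 (eisConstTerm N k ε)) := by
  rw [show heckeEis N k ε = fun τ => ∑ d ∈ N.divisors, ε.val d * eisV k d τ from
    funext fun τ => heckeEis_eq hk2 ε τ, eisConstTerm, Finset.mul_sum]
  refine tendsto_finsetSum _ fun d hd => ?_
  have := (tendsto_eisV (k := k) (by omega) (Nat.pos_of_mem_divisors hd).ne').const_mul (ε.val d)
  convert this using 2
  ring

/-! ### Fourier coefficients and `L`-series of the Hecke Eisenstein series -/

/-- The divisor sum `σ_j`, as a complex-valued arithmetic function. -/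
def sigmaC (j : ℕ) : ArithmeticFunction ℂ := (ArithmeticFunction.sigma j : ArithmeticFunction ℕ)

lemma sigmaC_apply (j n : ℕ) : sigmaC j n = (ArithmeticFunction.sigma j n : ℂ) := rfl

lemma sigmaC_eq (j : ℕ) : sigmaC j = ((ArithmeticFunction.zeta : ArithmeticFunction ℕ) :
    ArithmeticFunction ℂ) * ((ArithmeticFunction.pow j : ArithmeticFunction ℕ) :
    ArithmeticFunction ℂ) := by
  rw [sigmaC, ← ArithmeticFunction.zeta_mul_pow_eq_sigma, ArithmeticFunction.natCoe_mul]

lemma sigmaC_isMultiplicative (j : ℕ) : (sigmaC j).IsMultiplicative :=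
  ArithmeticFunction.isMultiplicative_sigma.natCast

lemma term_pow (j : ℕ) (s : ℂ) :
    LSeries.term (fun n => ((ArithmeticFunction.pow j n : ℕ) : ℂ)) s = LSeries.term 1 (s - j) := by
  ext n
  rcases eq_or_ne n 0 with rfl | hn
  · simp
  · have hn' : (n : ℂ) ≠ 0 := by exact_mod_cast hn
    rw [LSeries.term_of_ne_zero hn, LSeries.term_of_ne_zero hn, cpow_sub _ _ hn', cpow_natCast]
    simp [ArithmeticFunction.pow_apply, hn]

lemma LSeriesHasSum_pow {j : ℕ} {s : ℂ} (hs : (j : ℝ) + 1 < s.re) :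
    LSeriesHasSum (fun n => ((ArithmeticFunction.pow j n : ℕ) : ℂ)) s (riemannZeta (s - j)) := by
  have h1 : 1 < (s - j).re := by
    simp
    linarith
  have h := (LSeriesSummable_one_iff.2 h1).LSeriesHasSum
  rw [LSeries_one_eq_riemannZeta h1] at h
  rw [LSeriesHasSum, term_pow]
  exact h

lemma LSeriesHasSum_sigmaC {j : ℕ} {s : ℂ} (hs : (j : ℝ) + 1 < s.re) :
    LSeriesHasSum (fun n => sigmaC j n) s (riemannZeta s * riemannZeta (s - j)) := by
  have h1 : 1 < s.re := lt_of_le_of_lt (by linarith [(Nat.cast_nonneg j : (0 : ℝ) ≤ j)]) hs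
  rw [sigmaC_eq]
  have h2 := (ArithmeticFunction.LSeriesSummable_zeta_iff.2 h1).LSeriesHasSum
  rw [ArithmeticFunction.LSeries_zeta_eq_riemannZeta h1] at h2
  exact ArithmeticFunction.LSeriesHasSum_mul h2 (LSeriesHasSum_pow hs)

/-- The Euler factor `∑_{d ∣ N} ε(d) d^{k/2-s}` of the `L`-series of the Hecke Eisenstein series. -/
def eisFactor (N k : ℕ) (ε : ALChar N) (s : ℂ) : ℂ :=
  ∑ d ∈ N.divisors, ε.val d * ((d : ℂ) ^ (k / 2) / (d : ℂ) ^ s)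

lemma eisFactor_eq_prod {N : ℕ} (hN : Squarefree N) (k : ℕ) (ε : ALChar N) (s : ℂ) :
    eisFactor N k ε s =
      ∏ p ∈ N.primeFactors, (1 + ε.val p * ((p : ℂ) ^ (k / 2) / (p : ℂ) ^ s)) :=
  ALChar.sum_val_mul hN ε (f := fun d => (d : ℂ) ^ (k / 2) / (d : ℂ) ^ s) (by simp)
    fun a b => by
      rw [Nat.cast_mul, mul_pow, natCast_mul_natCast_cpow, mul_div_mul_comm]

lemma differentiable_eisFactor (N k : ℕ) (ε : ALChar N) : Differentiable ℂ (eisFactor N k ε) := by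
  refine Differentiable.fun_sum fun d hd => ?_
  have hd' : (d : ℂ) ≠ 0 := by exact_mod_cast (Nat.pos_of_mem_divisors hd).ne'
  refine ((differentiable_const _).fun_div (fun s => ?_) fun s => ?_).const_mul _
  · exact differentiableAt_id.const_cpow (Or.inl hd')
  · simp [cpow_eq_zero_iff, hd']

/-- The arithmetic function whose value at `n ≥ 1` is the `n`-th Fourier coefficient. -/
def eisCoeff (N k : ℕ) (ε : ALChar N) : ArithmeticFunction ℂ :=
  ε.twist (fun d => (d : ℂ) ^ (k / 2)) * sigmaC (k - 1)

lemma eisCoeff_isMultiplicative {N : ℕ} (hN : Squarefree N) (k : ℕ) (ε : ALChar N) :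
    (eisCoeff N k ε).IsMultiplicative :=
  (ALChar.twist_isMultiplicative hN ε (by simp) fun a b => by push_cast; rw [mul_pow]).mul
    (sigmaC_isMultiplicative _)

lemma LSeriesHasSum_twist {N : ℕ} (hN : N ≠ 0) (k : ℕ) (ε : ALChar N) (s : ℂ) :
    LSeriesHasSum (fun n => ε.twist (fun d => (d : ℂ) ^ (k / 2)) n) s (eisFactor N k ε s) := by
  have h : HasSum (LSeries.term (fun n => ε.twist (fun d => (d : ℂ) ^ (k / 2)) n) s)
      (∑ d ∈ N.divisors, LSeries.term (fun n => ε.twist (fun d => (d : ℂ) ^ (k / 2)) n) s d) := by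
    refine hasSum_sum_of_ne_finset_zero fun n hn => ?_
    rcases eq_or_ne n 0 with rfl | hn0
    · simp
    · rw [LSeries.term_of_ne_zero hn0, ALChar.twist_apply _ _ hn0,
        ALChar.val_of_not_dvd _ fun h => hn (Nat.mem_divisors.2 ⟨h, hN⟩)]
      simp
  rw [LSeriesHasSum, eisFactor]
  convert! h using 1
  refine Finset.sum_congr rfl fun d hd => ?_
  have hd0 := (Nat.pos_of_mem_divisors hd).ne'
  rw [LSeries.term_of_ne_zero hd0, ALChar.twist_apply _ _ hd0, mul_div_assoc]

lemma LSeriesHasSum_eisCoeff {N k : ℕ} (hN : N ≠ 0) (hk : 1 ≤ k) (ε : ALChar N) {s : ℂ}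
    (hs : (k : ℝ) < s.re) :
    LSeriesHasSum (fun n => eisCoeff N k ε n) s
      (eisFactor N k ε s * (riemannZeta s * riemannZeta (s - (k - 1 : ℕ)))) :=
  ArithmeticFunction.LSeriesHasSum_mul (LSeriesHasSum_twist hN k ε s)
    (LSeriesHasSum_sigmaC (by push_cast [hk]; linarith))

lemma eisCoeff_apply {N k n : ℕ} (hN : N ≠ 0) (hn : n ≠ 0) (ε : ALChar N) :
    eisCoeff N k ε n = ∑ d ∈ N.divisors, ε.val d * (d : ℂ) ^ (k / 2) *
      if d ∣ n then sigmaC (k - 1) (n / d) else 0 := by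
  rw [eisCoeff, ArithmeticFunction.mul_apply, Nat.sum_divisorsAntidiagonal
    (f := fun a b => ε.twist (fun d => (d : ℂ) ^ (k / 2)) a * sigmaC (k - 1) b)]
  have e1 : ∑ i ∈ n.divisors, ε.twist (fun d => (d : ℂ) ^ (k / 2)) i * sigmaC (k - 1) (n / i) =
      ∑ i ∈ n.divisors ∩ N.divisors, ε.val i * (i : ℂ) ^ (k / 2) * sigmaC (k - 1) (n / i) := by
    rw [← Finset.sum_subset Finset.inter_subset_left]
    · refine Finset.sum_congr rfl fun i hi => ?_
      rw [ALChar.twist_apply _ _ (Nat.pos_of_mem_divisors (Finset.mem_inter.1 hi).1).ne']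
    · intro i hi hi'
      rw [ALChar.twist_apply _ _ (Nat.pos_of_mem_divisors hi).ne', ALChar.val_of_not_dvd _ fun h =>
        hi' (Finset.mem_inter.2 ⟨hi, Nat.mem_divisors.2 ⟨h, hN⟩⟩)]
      simp
  have e2 : ∑ d ∈ N.divisors, ε.val d * (d : ℂ) ^ (k / 2) *
      (if d ∣ n then sigmaC (k - 1) (n / d) else 0) =
      ∑ i ∈ n.divisors ∩ N.divisors, ε.val i * (i : ℂ) ^ (k / 2) * sigmaC (k - 1) (n / i) := by
    rw [← Finset.sum_subset Finset.inter_subset_right]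
    · refine Finset.sum_congr rfl fun i hi => ?_
      rw [if_pos (Nat.dvd_of_mem_divisors (Finset.mem_inter.1 hi).1)]
    · intro i hi hi'
      rw [if_neg fun h => hi' (Finset.mem_inter.2 ⟨Nat.mem_divisors.2 ⟨h, hn⟩, hi⟩), mul_zero]
  rw [e1, e2]

lemma hasSum_eisV {k d : ℕ} (hk : 1 ≤ k) (hd : d ≠ 0) (τ : ℍ) :
    HasSum (fun n => ((d : ℂ) ^ (k / 2) * if d ∣ n then (eisSeries k).coeff (n / d) else 0) *
      cexp (2 * π * I * τ) ^ n) (eisV k d τ) := by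
  have h := (hasSum_eisG hk (scale d τ)).mul_left ((d : ℂ) ^ (k / 2))
  have hinj : Function.Injective fun n : ℕ => d * n := fun a b h => Nat.eq_of_mul_eq_mul_left
      (Nat.pos_of_ne_zero hd) h
  refine (hinj.hasSum_iff fun n hn => ?_).1 ?_
  · rw [if_neg fun ⟨m, hm⟩ => hn ⟨m, hm.symm⟩]
    simp
  · convert! h using 1
    ext n
    simp only [Function.comp_apply, dvd_mul_right, if_true,
      Nat.mul_div_cancel_left _ (Nat.pos_of_ne_zero hd)]
    rw [coe_scale hd, pow_mul, ← Complex.exp_nat_mul _ d]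
    ring_nf

lemma hasSum_heckeEis {N k : ℕ} (hN : N ≠ 0) (hk : 2 ≤ k) (hk2 : Even k) (ε : ALChar N) (τ : ℍ) :
    HasSum (fun n => (if n = 0 then eisConstTerm N k ε else eisCoeff N k ε n) *
      cexp (2 * π * I * τ) ^ n) (heckeEis N k ε τ) := by
  rw [heckeEis_eq hk2]
  have h := hasSum_sum fun d (hd : d ∈ N.divisors) =>
    (hasSum_eisV (k := k) (by omega) (Nat.pos_of_mem_divisors hd).ne' τ).mul_left (ε.val d)
  convert! h using 1
  ext n
  simp only [← mul_assoc, ← Finset.sum_mul]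
  congr 1
  split_ifs with hn
  · subst hn
    rw [eisConstTerm, Finset.mul_sum]
    refine Finset.sum_congr rfl fun d _ => ?_
    simp [eisSeries]
    ring
  · rw [eisCoeff_apply hN hn]
    refine Finset.sum_congr rfl fun d hd => ?_
    split_ifs with hdn
    · rw [eisSeries, PowerSeries.coeff_mk, if_neg, sigmaC_apply]
      exact (Nat.div_ne_zero_iff_of_dvd hdn).2 ⟨hn, (Nat.pos_of_mem_divisors hd).ne'⟩
    · rfl

lemma qParam_one (τ : ℍ) : Function.Periodic.qParam 1 (τ : ℂ) = cexp (2 * π * I * τ) := by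
  simp [Function.Periodic.qParam]

lemma periodic_of_hasSum_qParam {f : ℍ → ℂ} {c : ℕ → ℂ}
    (h : ∀ τ : ℍ, HasSum (fun n => c n * cexp (2 * π * I * τ) ^ n) (f τ)) :
    Function.Periodic (f ∘ ofComplex) ((1 : ℝ) : ℂ) := by
  intro z
  simp only [Function.comp_apply]
  by_cases hz : 0 < z.im
  · have hz' : 0 < (z + ((1 : ℝ) : ℂ)).im := by simpa using hz
    have h1 := h (ofComplex z)
    have h2 := h (ofComplex (z + ((1 : ℝ) : ℂ)))
    rw [ofComplex_apply_of_im_pos hz] at h1 ⊢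
    rw [ofComplex_apply_of_im_pos hz'] at h2 ⊢
    refine h2.unique ?_
    convert! h1 using 4
    simp only
    rw [show 2 * π * I * (z + ((1 : ℝ) : ℂ)) = 2 * π * I * z + 2 * π * I by push_cast; ring,
      Complex.exp_periodic]
  -- Off the upper half plane `ofComplex` takes one default value, so periodicity is trivial there.
  · rw [ofComplex_apply_of_im_nonpos (not_lt.1 hz), ofComplex_apply_of_im_nonpos]
    simpa using hz

lemma hasSum_qParam_heckeEis {N k : ℕ} (hN : N ≠ 0) (hk : 2 ≤ k) (hk2 : Even k) (ε : ALChar N)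
    (τ : ℍ) :
    HasSum (fun n => (if n = 0 then eisConstTerm N k ε else eisCoeff N k ε n) •
      Function.Periodic.qParam 1 (τ : ℂ) ^ n) (heckeEis N k ε τ) := by
  simpa only [qParam_one, smul_eq_mul] using hasSum_heckeEis hN hk hk2 ε τ

lemma isBoundedAtImInfty_heckeEis {N k : ℕ} (hN : N ≠ 0) (hk : 2 ≤ k) (hk2 : Even k)
    (ε : ALChar N) :
     IsBoundedAtImInfty (heckeEis N k ε) :=
  isBoundedAtImInfty_of_hasSum_qExpansion one_pos (hasSum_qParam_heckeEis hN hk hk2 ε)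

lemma analyticAt_cuspFunction_heckeEis {N k : ℕ} (hN : N ≠ 0) (hk : 2 ≤ k) (hk2 : Even k)
    (ε : ALChar N) :
     AnalyticAt ℂ (cuspFunction 1 (heckeEis N k ε)) 0 :=
  analyticAt_cuspFunction_zero one_pos (periodic_of_hasSum_qParam (hasSum_heckeEis hN hk hk2 ε))
    (mdifferentiable_heckeEis hk hk2 ε) (isBoundedAtImInfty_heckeEis hN hk hk2 ε)

lemma coeff_heckeEis {N k : ℕ} (hN : N ≠ 0) (hk : 2 ≤ k) (hk2 : Even k) (ε : ALChar N)
    (n : ℕ) : coeff (heckeEis N k ε) n =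
    if n = 0 then eisConstTerm N k ε else eisCoeff N k ε n := by
  have h1 := (hasFPowerSeriesOnBall_cuspFunction one_pos
    (analyticAt_cuspFunction_heckeEis hN hk hk2 ε)
    (hasSum_qParam_heckeEis hN hk hk2 ε)).hasFPowerSeriesAt
  have h2 : HasFPowerSeriesAt (cuspFunction 1 (heckeEis N k ε))
      (.ofScalars ℂ fun m => (qExpansion 1 (heckeEis N k ε)).coeff m) 0 := by
    simpa [qExpansion_coeff, div_eq_mul_inv, mul_comm]
      using (analyticAt_cuspFunction_heckeEis hN hk hk2 ε).hasFPowerSeriesAt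
  rw [coeff]
  simpa [FormalMultilinearSeries.coeff_ofScalars] using (congr_arg
      (FormalMultilinearSeries.coeff · n)
    (h1.eq_formalMultilinearSeries h2)).symm

lemma heckeEis_sub_isBigO {N k : ℕ} (hN : N ≠ 0) (hk : 2 ≤ k) (hk2 : Even k) (ε : ALChar N) :
     (fun τ => heckeEis N k ε τ - eisConstTerm N k ε) =O[atImInfty]
    fun τ => Real.exp (-2 * π * τ.im / 1) := by
  have h := exp_decay_sub_atImInfty one_pos
    (periodic_of_hasSum_qParam (hasSum_heckeEis hN hk hk2 ε))
    (mdifferentiable_heckeEis hk hk2 ε) (isBoundedAtImInfty_heckeEis hN hk hk2 ε)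
  rwa [show valueAtInfty (heckeEis N k ε) = eisConstTerm N k ε from
    (tendsto_heckeEis hk hk2 ε).limUnder_eq] at h

/-! ### The completed `L`-function of a Hecke Eisenstein series -/

/-- The restriction of `f` to the imaginary axis, scaled so that the fixed point of the Fricke
involution is `t = 1`. -/
def onAxis (N : ℕ) (f : ℍ → ℂ) (t : ℝ) : ℂ := f (ofComplex (I * t / (Real.sqrt N : ℂ)))

lemma im_axis {N : ℕ} (hN : N ≠ 0) {t : ℝ} (ht : 0 < t) : 0 < (I * t / (Real.sqrt N : ℂ)).im := by
  have h : 0 < Real.sqrt N := by positivity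
  rw [mul_div_assoc, ← ofReal_div, I_mul_im, ofReal_re]
  positivity

lemma coe_axis {N : ℕ} (hN : N ≠ 0) {t : ℝ} (ht : 0 < t) :
    (ofComplex (I * t / (Real.sqrt N : ℂ)) : ℂ) = I * t / (Real.sqrt N : ℂ) := by
  rw [ofComplex_apply_of_im_pos (im_axis hN ht)]

/-- The matrix of the Fricke involution. -/
def frickeMatrix {N : ℕ} (hN : N ≠ 0) : GL (Fin 2) ℝ :=
  Matrix.GeneralLinearGroup.mkOfDetNeZero !![(0 : ℝ), -1; (N : ℝ), 0] (by
    simpa [Matrix.det_fin_two_of] using hN)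

lemma isAtkinLehner_frickeMatrix {N : ℕ} (hN : N ≠ 0) : IsAtkinLehner N N (frickeMatrix hN) :=
  ⟨0, -1, N, 0, dvd_zero _, dvd_rfl, dvd_zero _, by simp, by
    ext i j
    fin_cases i <;> fin_cases j <;> simp [frickeMatrix, Matrix.GeneralLinearGroup.mkOfDetNeZero]⟩

/-- The Fricke involution τ ↦ -1/(Nτ) sends it/√N to i/(t√N), so the eigenvalue ε(N) becomes a
functional equation with root number ε(N)i^k. -/
lemma onAxis_one_div {N k : ℕ} (hN : Squarefree N) (hk : 2 ≤ k) (hk2 : Even k) (ε : ALChar N)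
    (hε : ¬ (k = 2 ∧ ε.IsTrivial)) {t : ℝ} (ht : 0 < t) :
    onAxis N (heckeEis N k ε) (1 / t) =
      ε.val N * I ^ k * t ^ k * onAxis N (heckeEis N k ε) t := by
  have hN0 := hN.ne_zero
  have hr : (Real.sqrt N : ℂ) ≠ 0 := by
    rw [ofReal_ne_zero]
    positivity
  have hr2 : (Real.sqrt N : ℂ) ^ 2 = N := by
    rw [← ofReal_pow, Real.sq_sqrt (by positivity)]
    simp
  have ht' : (t : ℂ) ≠ 0 := by exact_mod_cast ht.ne'
  have hW := isAtkinLehner_frickeMatrix hN0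
  have h := congrFun (slash_heckeEis hN hk hk2 ε hε hW dvd_rfl)
    (ofComplex (I * t / (Real.sqrt N : ℂ)))
  have hden : denom (frickeMatrix hN0) (ofComplex (I * t / (Real.sqrt N : ℂ))) =
      Real.sqrt N * (I * t) := by
    simp only [denom, frickeMatrix, coe_axis hN0 ht, Matrix.GeneralLinearGroup.mkOfDetNeZero]
    simp
    rw [← hr2]
    field_simp
  have hpt : frickeMatrix hN0 • ofComplex (I * t / (Real.sqrt N : ℂ)) =
      ofComplex (I * (1 / t : ℝ) / (Real.sqrt N : ℂ)) := by
    ext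
    rw [coe_smul_of_det_pos (by rw [hW.det_eq]; positivity), coe_axis hN0 (one_div_pos.2 ht), hden]
    simp only [num, frickeMatrix, Matrix.GeneralLinearGroup.mkOfDetNeZero]
    simp
    field_simp
    simp
  rw [slash_eq_of_det hW.det_eq, hden, hpt, ← div_div, div_self hr, div_pow, one_pow, mul_pow,
    one_div, inv_mul_eq_iff_eq_mul₀ (mul_ne_zero (pow_ne_zero _ I_ne_zero)
        (pow_ne_zero _ ht'))] at h
  rw [onAxis, h, onAxis]
  ring

/-- `(e I^k)² = 1`. -/
lemma rootNumber_sq {N k : ℕ} (hN : N ≠ 0) (hk2 : Even k) (ε : ALChar N) :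
    (ε.val N * I ^ k) * (ε.val N * I ^ k) = 1 := by
  obtain ⟨m, rfl⟩ := hk2
  rw [← two_mul, pow_mul, I_sq, mul_mul_mul_comm, ALChar.val_mul_self hN ε dvd_rfl, ← mul_pow]
  simp

lemma continuousOn_onAxis {N : ℕ} (hN : N ≠ 0) {f : ℍ → ℂ} (hf : MDiff f) :
    ContinuousOn (onAxis N f) (Set.Ioi 0) := by
  have h := (UpperHalfPlane.mdifferentiable_iff.1 hf).continuousOn
  have h2 : ContinuousOn (fun t : ℝ => I * (t : ℂ) / (Real.sqrt N : ℂ)) (Set.Ioi 0) := by fun_prop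
  exact h.comp h2 fun t ht => im_axis hN ht

lemma tendsto_axis {N : ℕ} (hN : N ≠ 0) :
    Tendsto (fun t : ℝ => ofComplex (I * t / (Real.sqrt N : ℂ))) atTop atImInfty := by
  rw [atImInfty, tendsto_comap_iff]
  have h : 0 < Real.sqrt N := by positivity
  refine (tendsto_id.atTop_div_const h).congr' ?_
  filter_upwards [eventually_gt_atTop 0] with t ht
  rw [Function.comp_apply, ← coe_im, coe_axis hN ht, mul_div_assoc, ← ofReal_div, I_mul_im,
      ofReal_re,
    id]

lemma onAxis_sub_isBigO {N k : ℕ} (hN : N ≠ 0) (hk : 2 ≤ k) (hk2 : Even k) (ε : ALChar N) (r : ℝ) :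
    (fun t => onAxis N (heckeEis N k ε) t - eisConstTerm N k ε) =O[atTop] fun t : ℝ => t ^ r := by
  have h := (heckeEis_sub_isBigO hN hk hk2 ε).comp_tendsto (tendsto_axis hN)
  have hs : 0 < Real.sqrt N := by positivity
  have hb : 0 < 2 * π / Real.sqrt N := by positivity
  refine (h.trans (EventuallyEq.isBigO ?_)).trans (isLittleO_exp_neg_mul_rpow_atTop hb r).isBigO
  filter_upwards [eventually_gt_atTop 0] with t ht
  rw [Function.comp_apply, ← coe_im, coe_axis hN ht, mul_div_assoc I, ← ofReal_div, I_mul_im,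
    ofReal_re]
  congr 1
  ring

/-- The functional equation data of a Hecke Eisenstein series. -/
def eisPair {N k : ℕ} (hN : Squarefree N) (hk : 2 ≤ k) (hk2 : Even k) (ε : ALChar N)
    (hε : ¬ (k = 2 ∧ ε.IsTrivial)) : WeakFEPair ℂ where
  f := onAxis N (heckeEis N k ε)
  g := onAxis N (heckeEis N k ε)
  k := k
  ε := ε.val N * I ^ k
  f₀ := eisConstTerm N k ε
  g₀ := eisConstTerm N k ε
  hf_int := (continuousOn_onAxis hN.ne_zero
    (mdifferentiable_heckeEis hk hk2 ε)).locallyIntegrableOn measurableSet_Ioi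
  hg_int := (continuousOn_onAxis hN.ne_zero
    (mdifferentiable_heckeEis hk hk2 ε)).locallyIntegrableOn measurableSet_Ioi
  hk := by positivity
  hε := mul_ne_zero (ALChar.val_ne_zero hN.ne_zero ε dvd_rfl) (pow_ne_zero _ I_ne_zero)
  h_feq t ht := by
    rw [onAxis_one_div hN hk hk2 ε hε ht, Real.rpow_natCast, ofReal_pow, smul_eq_mul]
  hf_top := onAxis_sub_isBigO hN.ne_zero hk hk2 ε
  hg_top := onAxis_sub_isBigO hN.ne_zero hk hk2 ε

section

variable {N k : ℕ} (hN : Squarefree N) (hk : 2 ≤ k) (hk2 : Even k) (ε : ALChar N)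
    (hε : ¬ (k = 2 ∧ ε.IsTrivial))

/-- The root number is its own inverse, so the functional equation relates Λ to itself. -/
lemma eisPair_symm : (eisPair hN hk hk2 ε hε).symm = eisPair hN hk hk2 ε hε := by
  have h : (ε.val N * I ^ k)⁻¹ = ε.val N * I ^ k :=
    inv_eq_of_mul_eq_one_left (rootNumber_sq hN.ne_zero hk2 ε)
  simp only [WeakFEPair.symm, eisPair, h]

lemma eisPair_functional_equation (s : ℂ) : (eisPair hN hk hk2 ε hε).Λ (k - s) =
    ε.val N * I ^ k * (eisPair hN hk hk2 ε hε).Λ s := by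
  have h := (eisPair hN hk hk2 ε hε).functional_equation s
  rw [eisPair_symm] at h
  exact h

lemma eisPair_Λ_of_lt_re {s : ℂ} (hs : (k : ℝ) < s.re) : (eisPair hN hk hk2 ε hε).Λ s =
    Gamma s * (2 * π / Real.sqrt N : ℝ) ^ (-s) *
      (eisFactor N k ε s * (riemannZeta s * riemannZeta (s - (k - 1 : ℕ)))) := by
  have hN0 := hN.ne_zero
  have hL := LSeriesHasSum_eisCoeff hN0 (by omega : 1 ≤ k) ε hs
  have hs0 : 0 < s.re := lt_of_le_of_lt (Nat.cast_nonneg k) hs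
  have hb : 0 < 2 * π / Real.sqrt N := by positivity
  rw [← ((eisPair hN hk hk2 ε hε).hasMellin hs).2]
  have key : HasSum (fun n : ℕ => Gamma s * eisCoeff N k ε n / ((2 * π / Real.sqrt N *
      n : ℝ) : ℂ) ^ s)
      (mellin (fun t => onAxis N (heckeEis N k ε) t - eisConstTerm N k ε) s) := by
    refine hasSum_mellin (fun n => ?_) hs0 (fun t ht => ?_) ?_
    · rcases Nat.eq_zero_or_pos n with rfl | hn
      · left
        simp
      · right
        positivity
    · have h := hasSum_ite_sub_hasSum (hasSum_heckeEis hN0 hk hk2 ε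
        (ofComplex (I * t / (Real.sqrt N : ℂ)))) 0
      convert! h using 1
      · ext n
        split_ifs with hn
        · simp [hn]
        · rw [coe_axis hN0 ht, ← Complex.exp_nat_mul, ofReal_exp]
          congr 2
          push_cast
          rw [show (n : ℂ) * (2 * π * I * (I * t / (Real.sqrt N : ℂ))) =
            (I * I) * (2 * π / (Real.sqrt N : ℂ) * n * t) by ring, I_mul_I]
          ring
      · simp [onAxis]
    · have h := hL.LSeriesSummable.norm
      have e : (fun i : ℕ => ‖eisCoeff N k ε i‖ / (2 * π / Real.sqrt N * i) ^ s.re) =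
          fun i : ℕ => ((2 * π / Real.sqrt N) ^ s.re)⁻¹ *
            ‖LSeries.term (fun n => eisCoeff N k ε n) s i‖ := by
        ext n
        rcases Nat.eq_zero_or_pos n with rfl | hn
        · simp
        · rw [LSeries.norm_term_eq, if_neg hn.ne', Real.mul_rpow hb.le (Nat.cast_nonneg n)]
          field_simp
      rw [e]
      exact h.mul_left _
  refine key.unique ?_
  have h := HasSum.mul_left (Gamma s * ((2 * π / Real.sqrt N : ℝ) : ℂ) ^ (-s)) hL
  convert! h using 1
  ext n
  rcases Nat.eq_zero_or_pos n with rfl | hn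
  · simp
  · rw [LSeries.term_of_ne_zero hn.ne', ofReal_mul, mul_cpow_ofReal_nonneg hb.le
      (Nat.cast_nonneg n),
      cpow_neg, ofReal_natCast]
    field_simp

/-- The analytic continuation of the `L`-series. -/
lemma eisPair_Λ_eq {s : ℂ} (h0 : s ≠ 0) (h1 : s ≠ 1) (h2 : s ≠ k) :
    (Gamma s)⁻¹ * ((2 * π / Real.sqrt N : ℝ) : ℂ) ^ s * (eisPair hN hk hk2 ε hε).Λ s =
      eisFactor N k ε s * (riemannZeta s * riemannZeta (s - (k - 1 : ℕ))) := by
  have hb : ((2 * π / Real.sqrt N : ℝ) : ℂ) ≠ 0 := by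
    have := hN.ne_zero
    rw [ofReal_ne_zero]
    positivity
  have hcast : ((k - 1 : ℕ) : ℂ) = k - 1 := by
    push_cast [show 1 ≤ k by omega]
    rfl
  have hd1 : DifferentiableOn ℂ (fun s => (Gamma s)⁻¹ * ((2 * π / Real.sqrt N : ℝ) : ℂ) ^ s *
      (eisPair hN hk hk2 ε hε).Λ s) ({0, 1, (k : ℂ)} : Set ℂ)ᶜ := fun z hz => by
    simp only [Set.mem_compl_iff, Set.mem_insert_iff, Set.mem_singleton_iff, not_or] at hz
    refine DifferentiableAt.differentiableWithinAt
        (((differentiable_one_div_Gamma z).mul ?_).mul ?_)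
    · exact differentiableAt_id.const_cpow (Or.inl hb)
    · exact (eisPair hN hk hk2 ε hε).differentiableAt_Λ (Or.inl hz.1) (Or.inl (by
        simpa [eisPair] using hz.2.2))
  have hd2 : DifferentiableOn ℂ (fun s => eisFactor N k ε s *
      (riemannZeta s * riemannZeta (s - (k - 1 : ℕ)))) ({0, 1, (k : ℂ)} : Set ℂ)ᶜ := fun z hz => by
    simp only [Set.mem_compl_iff, Set.mem_insert_iff, Set.mem_singleton_iff, not_or] at hz
    refine DifferentiableAt.differentiableWithinAt
      ((differentiable_eisFactor N k ε z).mul ((differentiableAt_riemannZeta hz.2.1).mul ?_))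
    refine DifferentiableAt.fun_comp' (f := fun s : ℂ => s - (k - 1 : ℕ)) z
      (differentiableAt_riemannZeta fun h => hz.2.2 ?_) (by fun_prop)
    rw [hcast] at h
    linear_combination h
  have hfin : ({0, 1, (k : ℂ)} : Set ℂ).Finite := by simp
  have hopen : IsOpen ({0, 1, (k : ℂ)} : Set ℂ)ᶜ := hfin.isClosed.isOpen_compl
  -- The plane minus a countable set is connected, so the identity theorem extends the formula from
  -- the half-plane of convergence.
  have hconn : IsPreconnected ({0, 1, (k : ℂ)} : Set ℂ)ᶜ :=
    (hfin.countable.isConnected_compl_of_one_lt_rank (by simp)).isPreconnected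
  have hmem : ∀ z : ℂ, (k : ℝ) < z.re → z ∈ ({0, 1, (k : ℂ)} : Set ℂ)ᶜ := fun z hz => by
    have hk1 : (1 : ℝ) < k := by exact_mod_cast (by omega : 1 < k)
    simp only [Set.mem_compl_iff, Set.mem_insert_iff, Set.mem_singleton_iff, not_or]
    refine ⟨?_, ?_, ?_⟩ <;> rintro rfl <;> simp at hz <;> linarith
  have hEv : (fun s => (Gamma s)⁻¹ * ((2 * π / Real.sqrt N : ℝ) : ℂ) ^ s *
      (eisPair hN hk hk2 ε hε).Λ s) =ᶠ[𝓝 ((k : ℂ) + 1)] fun s => eisFactor N k ε s *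
      (riemannZeta s * riemannZeta (s - (k - 1 : ℕ))) := by
    have : {z : ℂ | (k : ℝ) < z.re} ∈ 𝓝 ((k : ℂ) + 1) :=
      (isOpen_lt continuous_const Complex.continuous_re).mem_nhds (by simp)
    filter_upwards [this] with z hz
    have hG : Gamma z ≠ 0 := Gamma_ne_zero_of_re_pos (lt_of_le_of_lt (Nat.cast_nonneg k) hz)
    have hz0 : ((2 * π / Real.sqrt N : ℝ) : ℂ) ^ z ≠ 0 := fun h =>
      hb ((cpow_eq_zero_iff _ _).1 h).1
    rw [eisPair_Λ_of_lt_re hN hk hk2 ε hε hz, cpow_neg]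
    field_simp
  exact (hd1.analyticOnNhd hopen).eqOn_of_preconnected_of_eventuallyEq
      (hd2.analyticOnNhd hopen) hconn
    (hmem _ (by simp)) hEv (by simp [h0, h1, h2])

/-- The limit at `s = 1` of the `L`-series of a Hecke Eisenstein series. -/
def eisLimit : ℂ := ((2 * π / Real.sqrt N : ℝ) : ℂ) * (eisPair hN hk hk2 ε hε).Λ 1

/-- The limit exists because Λ can have poles only at 0 and k. In terms of the factors, the pole of
ζ(s) at 1 meets a zero of ζ(s-k+1) if k ≥ 4, and a zero of E if k = 2 and ε is nontrivial. -/
lemma tendsto_eisLimit : Tendsto (fun s => eisFactor N k ε s *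
    (riemannZeta s * riemannZeta (s - (k - 1 : ℕ)))) (𝓝[≠] 1) (𝓝 (eisLimit hN hk hk2 ε hε)) := by
  have hb : ((2 * π / Real.sqrt N : ℝ) : ℂ) ≠ 0 := by
    have := hN.ne_zero
    rw [ofReal_ne_zero]
    positivity
  have hk1 : (1 : ℂ) ≠ k := by exact_mod_cast (by omega : 1 ≠ k)
  have hc : ContinuousAt (fun s => (Gamma s)⁻¹ * ((2 * π / Real.sqrt N : ℝ) : ℂ) ^ s *
      (eisPair hN hk hk2 ε hε).Λ s) 1 := by
    refine DifferentiableAt.continuousAt (((differentiable_one_div_Gamma 1).mul ?_).mul ?_)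
    · exact differentiableAt_id.const_cpow (Or.inl hb)
    · exact (eisPair hN hk hk2 ε hε).differentiableAt_Λ (Or.inl one_ne_zero) (Or.inl (by
        simpa [eisPair] using hk1))
  have h := hc.tendsto.mono_left (nhdsWithin_le_nhds (s := {1}ᶜ))
  rw [Gamma_one, inv_one, one_mul, cpow_one] at h
  refine h.congr' ?_
  have h0 : {z : ℂ | z ≠ 0 ∧ z ≠ k} ∈ 𝓝 (1 : ℂ) :=
    (isOpen_ne.inter isOpen_ne).mem_nhds ⟨one_ne_zero, hk1⟩
  filter_upwards [self_mem_nhdsWithin, nhdsWithin_le_nhds h0] with s hs hs0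
  exact eisPair_Λ_eq hN hk hk2 ε hε hs0.1 hs hs0.2

end

/-! ### The period function of a Hecke Eisenstein series -/

/-- `∑_j (n choose j) X^{n-j} z^j J_j`. -/
def binomSum (n : ℕ) (X z : ℂ) (J : ℕ → ℂ) : ℂ :=
  ∑ j ∈ Finset.range (n + 1), (n.choose j : ℂ) * X ^ (n - j) * z ^ j * J j

lemma binomSum_congr {n : ℕ} {X z : ℂ} {J J' : ℕ → ℂ} (h : ∀ j ≤ n, J j = J' j) :
    binomSum n X z J = binomSum n X z J' :=
  Finset.sum_congr rfl fun j hj => by rw [h j (Nat.lt_succ_iff.1 (Finset.mem_range.1 hj))]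

lemma binomSum_add (n : ℕ) (X z : ℂ) (J J' : ℕ → ℂ) :
    binomSum n X z (fun j => J j + J' j) = binomSum n X z J + binomSum n X z J' := by
  simp only [binomSum, mul_add, Finset.sum_add_distrib]

lemma binomSum_const_mul (n : ℕ) (X z a : ℂ) (J : ℕ → ℂ) :
    binomSum n X z (fun j => a * J j) = a * binomSum n X z J := by
  simp only [binomSum, Finset.mul_sum]
  exact Finset.sum_congr rfl fun j _ => by ring

/-- The binomial theorem, integrated. -/
lemma binomSum_inv (n : ℕ) (X z : ℂ) :
    z * binomSum n X z (fun j => 1 / ((j : ℂ) + 1)) =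
      ((X + z) ^ (n + 1) - X ^ (n + 1)) / ((n : ℂ) + 1) := by
  have hn : (n : ℂ) + 1 ≠ 0 := by exact_mod_cast n.succ_ne_zero
  rw [eq_div_iff hn, add_comm X z, add_pow z X (n + 1), Finset.sum_range_succ', binomSum,
    Finset.mul_sum, Finset.sum_mul]
  simp only [pow_zero, Nat.sub_zero, Nat.choose_zero_right, Nat.cast_one, mul_one, one_mul,
    add_sub_cancel_right]
  refine Finset.sum_congr rfl fun j _ => ?_
  have hj : (j : ℂ) + 1 ≠ 0 := by exact_mod_cast j.succ_ne_zero
  have h : ((n : ℂ) + 1) * (n.choose j : ℂ) = ((n + 1).choose (j + 1) : ℂ) * ((j : ℂ) + 1) := by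
    exact_mod_cast Nat.add_one_mul_choose_eq n j
  rw [Nat.add_sub_add_right]
  field_simp
  linear_combination (z * X ^ (n - j) * z ^ j) * h

/-- The substitution X ↦ z²/X reverses the coefficients. With z = -i/√N it is X ↦ -1/(NX), the
Fricke involution on the period variable. -/
lemma binomSum_reflect (n : ℕ) {X : ℂ} (hX : X ≠ 0) (z : ℂ) (J : ℕ → ℂ) :
    X ^ n * binomSum n (z ^ 2 / X) z J = z ^ n * binomSum n X z (fun j => J (n - j)) := by
  rw [binomSum, binomSum, ← Finset.sum_range_reflect, Finset.mul_sum, Finset.mul_sum]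
  refine Finset.sum_congr rfl fun j hj => ?_
  have hj' : j ≤ n := Nat.lt_succ_iff.1 (Finset.mem_range.1 hj)
  obtain ⟨i, rfl⟩ := Nat.exists_eq_add_of_le hj'
  rw [show j + i + 1 - 1 - j = i by omega, show j + i - i = j by omega,
    show j + i - j = i by omega, Nat.choose_symm_add, div_pow, pow_add]
  field_simp
  ring

section

variable {N k : ℕ} (hN : Squarefree N) (hk : 2 ≤ k) (hk2 : Even k) (ε : ALChar N)
    (hε : ¬ (k = 2 ∧ ε.IsTrivial))

/-- The moments of the Hecke Eisenstein series on the upper half of the imaginary axis. -/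
def tailMoment (N k : ℕ) (ε : ALChar N) (j : ℕ) : ℂ :=
  ∫ u in Set.Ioi (1 : ℝ), (u : ℂ) ^ j * (onAxis N (heckeEis N k ε) u - eisConstTerm N k ε)

/-- The function `f - a_0` on `t > 1`, extended by zero. -/
def tailFun (N k : ℕ) (ε : ALChar N) : ℝ → ℂ :=
  (Set.Ioi 1).indicator fun u => onAxis N (heckeEis N k ε) u - eisConstTerm N k ε

lemma tailFun_eq : tailFun N k ε = (Set.Ioi 1).indicator (eisPair hN hk hk2 ε hε).f_modif := by
  ext t
  rw [tailFun]
  by_cases ht : t ∈ Set.Ioi (1 : ℝ)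
  · rw [Set.indicator_of_mem ht, Set.indicator_of_mem ht, WeakFEPair.f_modif, Pi.add_apply,
      Set.indicator_of_mem ht, Set.indicator_of_notMem, add_zero]
    · rfl
    · exact fun h => lt_asymm h.2 ht
  · rw [Set.indicator_of_notMem ht, Set.indicator_of_notMem ht]

lemma mellinConvergent_tailFun {N k : ℕ} (hN : Squarefree N) (hk : 2 ≤ k) (hk2 : Even k)
    (ε : ALChar N) (hε : ¬ (k = 2 ∧ ε.IsTrivial)) (s : ℂ) : MellinConvergent (tailFun N k ε) s := by
  have h : MellinConvergent (eisPair hN hk hk2 ε hε).f_modif s :=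
    ((eisPair hN hk hk2 ε hε).isStrongFEPair_toStrongFEPair.hasMellin s).1
  rw [tailFun_eq hN hk hk2 ε hε, MellinConvergent]
  have := IntegrableOn.indicator h (measurableSet_Ioi (a := (1 : ℝ)))
  convert! this using 1
  ext t
  simp only [Set.indicator, smul_eq_mul]
  split_ifs <;> simp

lemma mellin_tailFun (j : ℕ) : mellin (tailFun N k ε) ((j : ℂ) + 1) = tailMoment N k ε j := by
  have e : ∀ t : ℝ, (t : ℂ) ^ ((j : ℂ) + 1 - 1) • tailFun N k ε t = (Set.Ioi 1).indicator
      (fun u : ℝ => (u : ℂ) ^ j * (onAxis N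
          (heckeEis N k ε) u - eisConstTerm N k ε)) t := fun t => by
    rw [add_sub_cancel_right, cpow_natCast, tailFun, smul_eq_mul]
    simp only [Set.indicator]
    split_ifs <;> simp
  rw [mellin, tailMoment]
  simp only [e]
  rw [setIntegral_indicator measurableSet_Ioi, Set.inter_eq_right.2
      (Set.Ioi_subset_Ioi zero_le_one)]

/-- Riemann's splitting at t = 1: the part of the Mellin integral over (0, 1) is carried to (1, ∞)
by t ↦ 1/t and the functional equation. -/
lemma eisPair_Λ₀_eq (s : ℂ) : (eisPair hN hk hk2 ε hε).Λ₀ s =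
    mellin (tailFun N k ε) s + ε.val N * I ^ k * mellin (tailFun N k ε) (k - s) := by
  set P := eisPair hN hk hk2 ε hε with hP
  have h1 : MellinConvergent P.f_modif s := (P.isStrongFEPair_toStrongFEPair.hasMellin s).1
  have h2 := mellinConvergent_tailFun hN hk hk2 ε hε s
  have h3 := (hasMellin_sub h1 h2).2
  have h4 : mellin (fun t => P.f_modif t - tailFun N k ε t) s =
      ε.val N * I ^ k * mellin (tailFun N k ε) (k - s) := by
    have e : mellin (fun t => P.f_modif t⁻¹ - tailFun N k ε t⁻¹) (-s) =
        mellin (fun t : ℝ => (t : ℂ) ^ (k : ℂ) • (ε.val N * I ^ k) • tailFun N k ε t) (-s) := by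
      refine setIntegral_congr_fun measurableSet_Ioi fun t ht => ?_
      have ht0 : (0 : ℝ) < t := ht
      have htc : (t : ℂ) ≠ 0 := by exact_mod_cast ht0.ne'
      refine congrArg _ ?_
      rw [tailFun_eq hN hk hk2 ε hε, ← hP]
      beta_reduce
      rcases lt_or_ge 1 t with h1t | h1t
      · have hi : t⁻¹ ∈ Set.Ioo (0 : ℝ) 1 := ⟨inv_pos.2 ht0, inv_lt_one_of_one_lt₀ h1t⟩
        have hi' : t⁻¹ ∉ Set.Ioi (1 : ℝ) := fun h => lt_asymm hi.2 h
        have hi'' : t ∉ Set.Ioo (0 : ℝ) 1 := fun h => lt_asymm h.2 h1t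
        rw [Set.indicator_of_notMem hi', Set.indicator_of_mem (show t ∈ Set.Ioi 1 from h1t),
          WeakFEPair.f_modif, Pi.add_apply, Pi.add_apply, Set.indicator_of_notMem hi',
          Set.indicator_of_mem hi, Set.indicator_of_notMem hi'',
          Set.indicator_of_mem (show t ∈ Set.Ioi 1 from h1t)]
        have e1 := onAxis_one_div hN hk hk2 ε hε ht0
        rw [one_div] at e1
        simp only [hP, eisPair, e1, smul_eq_mul, Real.rpow_neg (inv_pos.2 ht0).le,
            Real.rpow_natCast,
          inv_pow, inv_inv, ofReal_pow, cpow_natCast]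
        ring
      · rw [Set.indicator_of_notMem (show t ∉ Set.Ioi 1 from not_lt.2 h1t), smul_zero, smul_zero,
          sub_eq_zero]
        -- For t < 1 both functions at 1/t are the same tail; at t = 1 both vanish, since neither
        -- indicator contains 1.
        rcases h1t.lt_or_eq with h | rfl
        · rw [Set.indicator_of_mem (show t⁻¹ ∈ Set.Ioi 1 from (one_lt_inv₀ ht0).2 h)]
        · simp [WeakFEPair.f_modif]
    rw [mellin_comp_inv (fun t => P.f_modif t - tailFun N k ε t), neg_neg, mellin_cpow_smul,
      mellin_const_smul, smul_eq_mul, neg_add_eq_sub] at e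
    exact e
  rw [← h4, h3]
  simp [WeakFEPair.Λ₀]

/-- Λ is Λ₀ minus the polar terms at s = 0 and s = k, evaluated at s = j + 1. -/
lemma eisPair_Λ_natCast {j : ℕ} (hj : j ≤ k - 2) : (eisPair hN hk hk2 ε hε).Λ (j + 1) =
    tailMoment N k ε j + ε.val N * I ^ k * tailMoment N k ε (k - 2 - j) -
      eisConstTerm N k ε * (1 / ((j : ℂ) + 1)) -
      ε.val N * I ^ k * eisConstTerm N k ε * (1 / (((k - 2 - j : ℕ) : ℂ) + 1)) := by
  have h := eisPair_Λ₀_eq hN hk hk2 ε hε (j + 1)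
  have hc : (k : ℂ) - (j + 1) = ((k - 2 - j : ℕ) : ℂ) + 1 := by
    obtain ⟨i, hi⟩ := Nat.exists_eq_add_of_le hj
    have : k = j + i + 2 := by omega
    rw [this, show j + i + 2 - 2 - j = i by omega]
    push_cast
    ring
  rw [hc, mellin_tailFun, mellin_tailFun, WeakFEPair.Λ₀_eq] at h
  simp only [eisPair, ofReal_natCast, smul_eq_mul, hc] at h
  simp only [eisPair]
  linear_combination h

lemma integrableOn_tail {N k : ℕ} (hN : Squarefree N) (hk : 2 ≤ k) (hk2 : Even k)
    (ε : ALChar N) (hε : ¬ (k = 2 ∧ ε.IsTrivial)) (j : ℕ) :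
    IntegrableOn (fun u : ℝ => (u : ℂ) ^ j * (onAxis N (heckeEis N k ε) u - eisConstTerm N k ε))
      (Set.Ioi 1) := by
  have h := (mellinConvergent_tailFun hN hk hk2 ε hε ((j : ℂ) + 1)).mono_set
    (Set.Ioi_subset_Ioi zero_le_one)
  refine h.congr_fun (fun t ht => ?_) measurableSet_Ioi
  beta_reduce
  rw [add_sub_cancel_right, cpow_natCast, tailFun, smul_eq_mul, Set.indicator_of_mem ht]

lemma integral_Ioi_comp_mul_add_one (h : ℝ → ℂ) {b : ℝ} (hb : 0 < b) :
    ∫ t in Set.Ioi (0 : ℝ), h (b * t + 1) = (b : ℂ)⁻¹ * ∫ u in Set.Ioi (1 : ℝ), h u := by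
  have h1 := integral_comp_mul_left_Ioi (fun v => h (v + 1)) 0 hb
  have h2 := (measurePreserving_add_right (volume : Measure ℝ) 1).setIntegral_preimage_emb
    (measurableEmbedding_addRight 1) h (Set.Ioi 1)
  rw [Set.preimage_add_const_Ioi, sub_self] at h2
  rw [h1, mul_zero, h2, real_smul, ofReal_inv]

/-- The vertical ray from i/√N is parametrized as iu/√N with u = √N t + 1 > 1, and the power of X -
τ' is expanded binomially into moments. -/
lemma truncPeriod_heckeEis {N k : ℕ} (hN : Squarefree N) (hk : 2 ≤ k) (hk2 : Even k)
    (ε : ALChar N) (hε : ¬ (k = 2 ∧ ε.IsTrivial)) (X : ℂ) :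
    truncPeriod k (heckeEis N k ε) X (ofComplex (I / (Real.sqrt N : ℂ))) =
      I / (Real.sqrt N : ℂ) * binomSum (k - 2) X (-(I / (Real.sqrt N : ℂ))) (tailMoment N k ε) +
        eisConstTerm N k ε * (X - I / (Real.sqrt N : ℂ)) ^ (k - 1) / ((k : ℂ) - 1) := by
  have hN0 := hN.ne_zero
  have hs : 0 < Real.sqrt N := by positivity
  have hs' : (Real.sqrt N : ℂ) ≠ 0 := by exact_mod_cast hs.ne'
  have hτ : (ofComplex (I / (Real.sqrt N : ℂ)) : ℂ) = I / (Real.sqrt N : ℂ) := by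
    simpa using coe_axis hN0 one_pos
  have hc0 : coeff (heckeEis N k ε) 0 = eisConstTerm N k ε := by
    rw [coeff_heckeEis hN0 hk hk2, if_pos rfl]
  rw [truncPeriod, hτ, hc0]
  congr 1
  have e1 : ∀ t : ℝ, I * ((heckeEis N k ε (ofComplex (I / (Real.sqrt N : ℂ) + I * t)) -
      eisConstTerm N k ε) * (X - (I / (Real.sqrt N : ℂ) + I * t)) ^ (k - 2)) =
      (fun u : ℝ => I * ((onAxis N (heckeEis N k ε) u - eisConstTerm N k ε) *
        (X - I * u / (Real.sqrt N : ℂ)) ^ (k - 2))) (Real.sqrt N * t + 1) := fun t => by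
    have : I / (Real.sqrt N : ℂ) + I * t = I * ((Real.sqrt N * t + 1 : ℝ) : ℂ) / (Real.sqrt N : ℂ)
        := by
      push_cast
      field_simp
      ring
    simp only [this, onAxis]
  simp only [e1]
  rw [integral_Ioi_comp_mul_add_one (fun u : ℝ => I * ((onAxis N (heckeEis N k ε) u -
    eisConstTerm N k ε) * (X - I * u / (Real.sqrt N : ℂ)) ^ (k - 2))) hs]
  have e2 : ∀ u : ℝ, I * ((onAxis N (heckeEis N k ε) u - eisConstTerm N k ε) *
      (X - I * u / (Real.sqrt N : ℂ)) ^ (k - 2)) = ∑ j ∈ Finset.range (k - 2 + 1),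
      I * (((k - 2).choose j : ℂ) * X ^ (k - 2 - j) * (-(I / (Real.sqrt N : ℂ))) ^ j) *
        ((u : ℂ) ^ j * (onAxis N (heckeEis N k ε) u - eisConstTerm N k ε)) := fun u => by
    rw [show X - I * u / (Real.sqrt N : ℂ) = -(I / (Real.sqrt N : ℂ)) * u + X by ring, add_pow,
      Finset.mul_sum, Finset.mul_sum]
    refine Finset.sum_congr rfl fun j _ => ?_
    rw [mul_pow]
    ring
  simp only [e2]
  rw [integral_finsetSum _ fun j _ => (integrableOn_tail hN hk hk2 ε hε j).const_mul _, binomSum,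
    Finset.mul_sum, Finset.mul_sum]
  refine Finset.sum_congr rfl fun j _ => ?_
  rw [integral_const_mul, tailMoment]
  ring

/-- Both truncated periods start at the Fricke fixed point. After the reflection their moments
combine into Λ(j+1) plus polar terms. By the integrated binomial theorem the polar terms absorb the
parts of the terms in a₀ that depend on the base point, leaving only X^{k-1} and X⁻¹. -/
lemma eisPeriod_heckeEis {X : ℂ} (hX : X ≠ 0) :
    eisPeriod N k (ε.val N) (heckeEis N k ε) X =
      I / (Real.sqrt N : ℂ) * binomSum (k - 2) X (-(I / (Real.sqrt N : ℂ)))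
        (fun j => (eisPair hN hk hk2 ε hε).Λ (j + 1)) +
      eisConstTerm N k ε / ((k : ℂ) - 1) *
        (X ^ (k - 1) + ε.val N * ((N : ℂ) ^ (k / 2))⁻¹ * X⁻¹) := by
  have hN' : (N : ℂ) ≠ 0 := by exact_mod_cast hN.ne_zero
  have hr2 : (Real.sqrt N : ℂ) ^ 2 = N := by
    rw [← ofReal_pow, Real.sq_sqrt (by positivity)]
    simp
  have hr : (Real.sqrt N : ℂ) ≠ 0 := fun h => hN' (by rw [← hr2, h]; simp)
  obtain ⟨z, hz⟩ : ∃ z, z = -(I / (Real.sqrt N : ℂ)) := ⟨_, rfl⟩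
  have hz2 : z ^ 2 = -1 / N := by
    rw [hz, neg_sq, div_pow, I_sq, hr2]
  obtain ⟨m, rfl⟩ : ∃ m, k = 2 * m + 2 := by
    obtain ⟨m, rfl⟩ := hk2
    exact ⟨m - 1, by omega⟩
  have hI : I / (Real.sqrt N : ℂ) = -z := by rw [hz, neg_neg]
  have hX' : -1 / (N * X) = z ^ 2 / X := by rw [hz2, div_div]
  have hm1 : ((2 * m : ℕ) : ℂ) + 1 ≠ 0 := by exact_mod_cast (2 * m).succ_ne_zero
  rw [eisPeriod, truncPeriod_heckeEis hN hk hk2 ε hε, truncPeriod_heckeEis hN hk hk2 ε hε, hI,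
      neg_neg,
    hX']
  rw [show 2 * m + 2 - 2 = 2 * m by omega, show (2 * m + 2) / 2 - 1 = m by omega,
    show (2 * m + 2) / 2 = m + 1 by omega, show 2 * m + 2 - 1 = 2 * m + 1 by omega,
    show ((2 * m + 2 : ℕ) : ℂ) - 1 = ((2 * m : ℕ) : ℂ) + 1 by push_cast; ring]
  obtain ⟨a, ha⟩ : ∃ a, a = eisConstTerm N (2 * m + 2) ε := ⟨_, rfl⟩
  obtain ⟨w, hw⟩ : ∃ w, w = ε.val N * I ^ (2 * m + 2) := ⟨_, rfl⟩
  have hΛ : binomSum (2 * m) X z (fun j => (eisPair hN hk hk2 ε hε).Λ (j + 1)) =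
      binomSum (2 * m) X z (tailMoment N (2 * m + 2) ε) +
      w * binomSum (2 * m) X z (fun j => tailMoment N (2 * m + 2) ε (2 * m - j)) -
      a * binomSum (2 * m) X z (fun j => 1 / ((j : ℂ) + 1)) -
      w * a * binomSum (2 * m) X z (fun j => 1 / (((2 * m - j : ℕ) : ℂ) + 1)) := by
    rw [binomSum_congr fun j hj => eisPair_Λ_natCast hN hk hk2 ε hε (by omega : j ≤ 2 * m + 2 - 2),
      ← hw, ← ha, show 2 * m + 2 - 2 = 2 * m by omega]
    simp only [binomSum, Finset.mul_sum, ← Finset.sum_add_distrib, ← Finset.sum_sub_distrib]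
    exact Finset.sum_congr rfl fun j _ => by ring
  have hNz : (N : ℂ) ^ m * z ^ (2 * m) = (-1) ^ m := by
    rw [pow_mul, hz2, ← mul_pow, mul_div_cancel₀ _ hN']
  have hwm : ε.val N * (-1) ^ m = -w := by
    rw [hw, pow_add, pow_mul, I_sq]
    ring
  have hrefl : ∀ J : ℕ → ℂ, ε.val N * (N : ℂ) ^ m * X ^ (2 * m) * binomSum (2 * m) (z ^ 2 / X) z J =
      -w * binomSum (2 * m) X z (fun j => J (2 * m - j)) := fun J => by
    rw [mul_assoc, binomSum_reflect _ hX, ← hwm, ← hNz]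
    ring
  have h1 := hrefl (tailMoment N (2 * m + 2) ε)
  have h2 := hrefl fun j => 1 / ((j : ℂ) + 1)
  have h3 := binomSum_inv (2 * m) X z
  have h4 := binomSum_inv (2 * m) (z ^ 2 / X) z
  have h5 : ε.val N * (N : ℂ) ^ m * X ^ (2 * m) * (z ^ 2 / X) ^ (2 * m + 1) =
      -(ε.val N * ((N : ℂ) ^ (m + 1))⁻¹ * X⁻¹) := by
    rw [hz2, show -1 / (N : ℂ) / X = -(N * X)⁻¹ by field_simp, (odd_two_mul_add_one m).neg_pow,
      inv_pow, mul_pow]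
    field_simp
    ring
  rw [hΛ, ← ha, sub_neg_eq_add, sub_neg_eq_add]
  generalize ε.val N * (N : ℂ) ^ m * X ^ (2 * m) = P at h1 h2 h5 ⊢
  generalize (z ^ 2 / X + z) ^ (2 * m + 1) = D at h4 ⊢
  generalize (z ^ 2 / X) ^ (2 * m + 1) = F at h4 h5
  linear_combination z * h1 - a * h3 + P * a * h4 - z * a * h2 - a / ((2 * m : ℕ) + 1) * h5

end

/-! ### Even and odd parts of the period function -/

lemma binomSum_neg {n : ℕ} (hn : Even n) (X z : ℂ) (J : ℕ → ℂ) :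
    binomSum n (-X) z J = binomSum n X z (fun j => (-1) ^ j * J j) := by
  refine Finset.sum_congr rfl fun j hj => ?_
  obtain ⟨i, rfl⟩ := Nat.exists_eq_add_of_le (Nat.lt_succ_iff.1 (Finset.mem_range.1 hj))
  have h : ((-1 : ℂ)) ^ i = (-1) ^ j := by
    rcases Nat.even_or_odd j with h | h
    · rw [h.neg_one_pow, ((Nat.even_add.1 hn).1 h).neg_one_pow]
    · have : Odd i := by
        rw [← Nat.not_even_iff_odd] at h ⊢
        exact fun h' => h ((Nat.even_add.1 hn).2 h')
      rw [h.neg_one_pow, this.neg_one_pow]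
  rw [show j + i - j = i by omega, neg_pow X, h]
  ring

section

variable {N k : ℕ} (hN : Squarefree N) (hk : 2 ≤ k) (hk2 : Even k) (ε : ALChar N)
    (hε : ¬ (k = 2 ∧ ε.IsTrivial))

/-- j = 0 is excluded because ζ has its pole at s = 1; that value is kept as `eisLimit`. -/
lemma eisPair_Λ_succ {j : ℕ} (hj0 : j ≠ 0) (hj : j ≤ k - 2) :
    (eisPair hN hk hk2 ε hε).Λ (j + 1) =
      j.factorial * ((2 * π / Real.sqrt N : ℝ) : ℂ)⁻¹ ^ (j + 1) *
        (eisFactor N k ε (j + 1) * (riemannZeta (j + 1) * riemannZeta (-((k - 2 - j : ℕ) : ℂ))))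
            := by
  have hb : ((2 * π / Real.sqrt N : ℝ) : ℂ) ≠ 0 := by
    have := hN.ne_zero
    rw [ofReal_ne_zero]
    positivity
  have h := eisPair_Λ_eq hN hk hk2 ε hε (s := (j : ℂ) + 1) (by exact_mod_cast j.succ_ne_zero)
    (by simpa using hj0) (by exact_mod_cast (by omega : j + 1 ≠ k))
  rw [Gamma_nat_eq_factorial, show (j : ℂ) + 1 = ((j + 1 : ℕ) : ℂ) by push_cast; rfl,
    cpow_natCast] at h
  have hf : (j.factorial : ℂ) ≠ 0 := by exact_mod_cast j.factorial_ne_zero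
  have hs : ((j + 1 : ℕ) : ℂ) - ((k - 1 : ℕ) : ℂ) = -((k - 2 - j : ℕ) : ℂ) := by
    obtain ⟨i, hi⟩ := Nat.exists_eq_add_of_le hj
    have : k = j + i + 2 := by omega
    rw [this, show j + i + 2 - 2 - j = i by omega, show j + i + 2 - 1 = j + i + 1 by omega]
    push_cast
    ring
  rw [hs] at h
  rw [show (j : ℂ) + 1 = ((j + 1 : ℕ) : ℂ) by push_cast; rfl, ← h]
  generalize ((2 * π / Real.sqrt N : ℝ) : ℂ) = b at hb
  rw [inv_pow]
  field_simp

/-- The argument -(k-2-j) is a negative even integer, a trivial zero of ζ. -/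
lemma eisPair_Λ_eq_zero {j : ℕ} (hj0 : j ≠ 0) (hj : j < k - 2) (hj2 : Even j) :
    (eisPair hN hk hk2 ε hε).Λ (j + 1) = 0 := by
  rw [eisPair_Λ_succ hN hk hk2 ε hε hj0 hj.le, riemannZeta_neg_nat_eq_bernoulli, bernoulli_odd]
  · simp
  · obtain ⟨m, rfl⟩ := hk2
    obtain ⟨i, rfl⟩ := hj2
    exact ⟨m - 1 - i, by omega⟩
  · omega

/-- By the trivial zeros only j = 0 and j = k-2 survive, and Λ(k-1) = ε(N)i^k Λ(1). In weight two
these two terms are one and the same, hence the separate value. -/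
lemma evPart_eisPeriod {X : ℂ} (hX : X ≠ 0) :
    evPart (eisPeriod N k (ε.val N) (heckeEis N k ε)) X =
      I / (2 * π) * eisLimit hN hk hk2 ε hε *
        if k = 2 then 1 else X ^ (k - 2) - ε.val N * ((N : ℂ) ^ (k / 2 - 1))⁻¹ := by
  have hN' : (N : ℂ) ≠ 0 := by exact_mod_cast hN.ne_zero
  have hr2 : (Real.sqrt N : ℂ) ^ 2 = N := by
    rw [← ofReal_pow, Real.sq_sqrt (by positivity)]
    simp
  have hr : (Real.sqrt N : ℂ) ≠ 0 := fun h => hN' (by rw [← hr2, h]; simp)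
  have hpi : (π : ℂ) ≠ 0 := ofReal_ne_zero.2 Real.pi_ne_zero
  have hodd : Odd (k - 1) := by
    obtain ⟨m, rfl⟩ := hk2
    exact ⟨m - 1, by omega⟩
  have hev : Even (k - 2) := by
    obtain ⟨m, rfl⟩ := hk2
    exact ⟨m - 1, by omega⟩
  have e1 : evPart (eisPeriod N k (ε.val N) (heckeEis N k ε)) X =
      I / (Real.sqrt N : ℂ) * binomSum (k - 2) X (-(I / (Real.sqrt N : ℂ)))
        (fun j => (1 + (-1) ^ j) / 2 * (eisPair hN hk hk2 ε hε).Λ (j + 1)) := by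
    rw [evPart, eisPeriod_heckeEis hN hk hk2 ε hε hX, eisPeriod_heckeEis hN hk hk2 ε hε
        (neg_ne_zero.2 hX),
      binomSum_neg hev, hodd.neg_pow, inv_neg]
    simp only [add_div, add_mul, div_mul_eq_mul_div, one_mul]
    rw [binomSum_add]
    simp only [← div_mul_eq_mul_div, div_eq_inv_mul _ (2 : ℂ), mul_assoc, binomSum_const_mul]
    ring
  have e2 : eisLimit hN hk hk2 ε hε = 2 * π / Real.sqrt N * (eisPair hN hk hk2 ε hε).Λ 1 := by
    rw [eisLimit]
    push_cast
    rfl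
  have e3 : I / (2 * π) * (2 * π / (Real.sqrt N : ℂ) * (eisPair hN hk hk2 ε hε).Λ 1) =
      I / (Real.sqrt N : ℂ) * (eisPair hN hk hk2 ε hε).Λ 1 := by
    field_simp
  rw [e1, e2, e3]
  split_ifs with h2
  · subst h2
    simp [binomSum]
  · obtain ⟨m, hm⟩ : ∃ m, k = 2 * (m + 1) + 2 := by
      obtain ⟨m, rfl⟩ := hk2
      exact ⟨m - 2, by omega⟩
    have hfe := eisPair_functional_equation hN hk hk2 ε hε 1
    have hz : (-(I / (Real.sqrt N : ℂ))) ^ (k - 2) * (ε.val N * I ^ k) =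
        -(ε.val N * ((N : ℂ) ^ (k / 2 - 1))⁻¹) := by
      rw [hm, show 2 * (m + 1) + 2 - 2 = 2 * (m + 1) by omega,
        show (2 * (m + 1) + 2) / 2 - 1 = m + 1 by omega, pow_mul, neg_sq, div_pow, I_sq, hr2,
            div_pow,
        show 2 * (m + 1) + 2 = 2 * (m + 2) by omega, pow_mul, I_sq, pow_succ _ (m + 1)]
      have h1 : (-1 : ℂ) ^ (m + 1) * (-1) ^ (m + 1) = 1 := by simp [← mul_pow]
      rw [div_eq_mul_inv]
      linear_combination -(ε.val N * ((N : ℂ) ^ (m + 1))⁻¹) * h1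
    rw [show (k : ℂ) - 1 = ((k - 2 : ℕ) : ℂ) + 1 by rw [Nat.cast_sub hk]; push_cast; ring] at hfe
    rw [binomSum, show k - 2 + 1 = (2 * m + 1) + 1 + 1 by omega, Finset.sum_range_succ,
      Finset.sum_range_succ', show 2 * m + 1 + 1 = k - 2 by omega, Finset.sum_eq_zero, hfe,
      hev.neg_one_pow]
    · simp only [Nat.choose_zero_right, Nat.choose_self, Nat.sub_zero, Nat.sub_self, pow_zero,
        Nat.cast_one, Nat.cast_zero, zero_add]
      generalize (-(I / (Real.sqrt N : ℂ))) ^ (k - 2) = A at hz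
      linear_combination I / (Real.sqrt N : ℂ) * (eisPair hN hk hk2 ε hε).Λ 1 * hz
    · intro j hj
      have hj' := Finset.mem_range.1 hj
      rcases Nat.even_or_odd (j + 1) with h | h
      · rw [eisPair_Λ_eq_zero hN hk hk2 ε hε j.succ_ne_zero (by omega) h, mul_zero, mul_zero]
      · rw [h.neg_one_pow]
        simp

/-- The sum `∑ β_r β_s E(s) X^{r-1}`, over even `r + s = k`, where `β_r = B_r / r!`. -/
def oddSum (N k : ℕ) (ε : ALChar N) (X : ℂ) : ℂ :=
  ∑ p ∈ (Finset.HasAntidiagonal.antidiagonal k).filter (fun p => Even p.1 ∧ Even p.2),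
    ((bernoulli p.1 : ℚ) : ℂ) / (p.1.factorial : ℂ) *
      (((bernoulli p.2 : ℚ) : ℂ) / (p.2.factorial : ℂ)) * eisFactor N k ε p.2 * X ^ ((p.1 : ℤ) - 1)

lemma eisFactor_zero (N k : ℕ) (ε : ALChar N) :
    eisFactor N k ε 0 = ∑ d ∈ N.divisors, ε.val d * (d : ℂ) ^ (k / 2) := by
  simp [eisFactor]

lemma eisFactor_natCast {N : ℕ} (ε : ALChar N) (k s : ℕ) :
    eisFactor N (2 * k) ε s = ∑ d ∈ N.divisors, ε.val d * (d : ℂ) ^ ((k : ℤ) - s) := by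
  refine Finset.sum_congr rfl fun d hd => ?_
  have hd' : (d : ℂ) ≠ 0 := by exact_mod_cast (Nat.pos_of_mem_divisors hd).ne'
  rw [Nat.mul_div_cancel_left _ two_pos, cpow_natCast, zpow_sub₀ hd', zpow_natCast, zpow_natCast]

/-- The symmetry `E(k - s) = ε(N) N^{s-k/2} E(s)`. -/
lemma eisFactor_symm {N : ℕ} (hN : Squarefree N) (ε : ALChar N) {k r s : ℕ} (h : r + s = 2 * k) :
    eisFactor N (2 * k) ε r = ε.val N * (N : ℂ) ^ ((s : ℤ) - k) * eisFactor N (2 * k) ε s := by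
  have hN' : (N : ℂ) ≠ 0 := by exact_mod_cast hN.ne_zero
  rw [eisFactor_natCast ε, eisFactor_natCast ε, Finset.mul_sum,
    ← Nat.sum_div_divisors]
  refine Finset.sum_congr rfl fun d hd => ?_
  have hd0 : d ∣ N := Nat.dvd_of_mem_divisors hd
  have hd' : (d : ℂ) ≠ 0 := by exact_mod_cast (Nat.pos_of_mem_divisors hd).ne'
  have h1 : ε.val (N / d) = ε.val N * ε.val d := by
    rw [← ALChar.val_mul_val_div hN ε hd0, mul_right_comm, ALChar.val_mul_self hN.ne_zero ε hd0,
      one_mul]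
  rw [h1, Nat.cast_div hd0 hd', div_zpow, show (k : ℤ) - r = (s : ℤ) - k by omega,
    show (k : ℤ) - s = -((s : ℤ) - k) by omega, zpow_neg]
  field_simp

lemma oddSum_eq_sum_range {n : ℕ} (hn : Even n) (N : ℕ) (ε : ALChar N) (X : ℂ) :
    oddSum N n ε X = ∑ s ∈ Finset.range (n + 1), if Even s then
      ((bernoulli (n - s) : ℚ) : ℂ) / ((n - s).factorial : ℂ) *
      (((bernoulli s : ℚ) : ℂ) / (s.factorial : ℂ)) * eisFactor N n ε s * X ^
          (((n - s : ℕ) : ℤ) - 1)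
      else 0 := by
  rw [oddSum, Finset.sum_filter, ← Finset.Nat.sum_antidiagonal_swap,
    Finset.Nat.sum_antidiagonal_eq_sum_range_succ_mk]
  refine Finset.sum_congr rfl fun s hs => ?_
  have hs' : s ≤ n := Nat.lt_succ_iff.1 (Finset.mem_range.1 hs)
  refine if_congr ?_ rfl rfl
  simp only [Prod.swap_prod_mk]
  rw [Nat.even_sub hs']
  tauto

/-- For odd j the factor ζ(j+1) gives B_{j+1} times a power of π, which cancels against Λ's factor,
and ζ at the negative odd integer gives the complementary Bernoulli number. -/
lemma odPart_eisPeriod {N k : ℕ} (hN : Squarefree N) (hk : 2 ≤ k) (hk2 : Even k) (ε : ALChar N)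
    (hε : ¬ (k = 2 ∧ ε.IsTrivial)) {X : ℂ} (hX : X ≠ 0) :
    odPart (eisPeriod N k (ε.val N) (heckeEis N k ε)) X =
      -((k - 2).factorial / 2 : ℂ) * oddSum N k ε X := by
  have hN0 := hN.ne_zero
  have hN' : (N : ℂ) ≠ 0 := by exact_mod_cast hN.ne_zero
  have hr2 : (Real.sqrt N : ℂ) ^ 2 = N := by
    rw [← ofReal_pow, Real.sq_sqrt (by positivity)]
    simp
  have hr : (Real.sqrt N : ℂ) ≠ 0 := fun h => hN' (by rw [← hr2, h]; simp)
  have hpi : (π : ℂ) ≠ 0 := ofReal_ne_zero.2 Real.pi_ne_zero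
  have hodd : Odd (k - 1) := by
    obtain ⟨m, rfl⟩ := hk2
    exact ⟨m - 1, by omega⟩
  have hev : Even (k - 2) := by
    obtain ⟨m, rfl⟩ := hk2
    exact ⟨m - 1, by omega⟩
  have e1 : odPart (eisPeriod N k (ε.val N) (heckeEis N k ε)) X =
      I / (Real.sqrt N : ℂ) * binomSum (k - 2) X (-(I / (Real.sqrt N : ℂ)))
        (fun j => (1 - (-1) ^ j) / 2 * (eisPair hN hk hk2 ε hε).Λ (j + 1)) +
      eisConstTerm N k ε / ((k : ℂ) - 1) *
        (X ^ (k - 1) + ε.val N * ((N : ℂ) ^ (k / 2))⁻¹ * X⁻¹) := by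
    rw [odPart, eisPeriod_heckeEis hN hk hk2 ε hε hX, eisPeriod_heckeEis hN hk hk2 ε hε
        (neg_ne_zero.2 hX),
      binomSum_neg hev, hodd.neg_pow, inv_neg]
    have hlin : binomSum (k - 2) X (-(I / (Real.sqrt N : ℂ)))
        (fun j => (1 - (-1) ^ j) / 2 * (eisPair hN hk hk2 ε hε).Λ (j + 1)) =
        1 / 2 * (binomSum (k - 2) X (-(I / (Real.sqrt N : ℂ)))
          (fun j => (eisPair hN hk hk2 ε hε).Λ (j + 1)) -
          binomSum (k - 2) X (-(I / (Real.sqrt N : ℂ)))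
          (fun j => (-1) ^ j * (eisPair hN hk hk2 ε hε).Λ (j + 1))) := by
      simp only [binomSum, ← Finset.sum_sub_distrib, Finset.mul_sum]
      exact Finset.sum_congr rfl fun j _ => by ring
    rw [hlin]
    ring
  obtain ⟨n, rfl⟩ : ∃ n, k = n + 2 := ⟨k - 2, by omega⟩
  rw [e1, oddSum_eq_sum_range hk2, Finset.sum_range_succ, Finset.sum_range_succ', if_pos hk2,
    if_pos Even.zero]
  simp only [Nat.add_sub_cancel] at hev ⊢
  have hn1 : (n : ℂ) + 1 ≠ 0 := by exact_mod_cast n.succ_ne_zero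
  have hn2 : (n : ℂ) + 2 ≠ 0 := by exact_mod_cast (n + 1).succ_ne_zero
  have hfac : ((n + 2).factorial : ℂ) = ((n : ℂ) + 2) * (((n : ℂ) + 1) * n.factorial) := by
    rw [Nat.factorial_succ, Nat.factorial_succ]
    push_cast
    ring
  have hn! : (n.factorial : ℂ) ≠ 0 := by exact_mod_cast n.factorial_ne_zero
  -- The terms s = 0 and s = k of the Bernoulli sum are the non-polynomial part of the period
  -- function, rewritten with E(k) = ε(N)N^{-k/2}E(0).
  have ends : eisConstTerm N (n + 2) ε / (((n + 2 : ℕ) : ℂ) - 1) *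
        (X ^ (n + 2 - 1) + ε.val N * ((N : ℂ) ^ ((n + 2) / 2))⁻¹ * X⁻¹) =
      -(n.factorial / 2 : ℂ) * (((bernoulli (n + 2 - 0) : ℚ) : ℂ) / ((n + 2 - 0).factorial : ℂ) *
      (((bernoulli 0 : ℚ) : ℂ) / (Nat.factorial 0 : ℂ)) * eisFactor N (n + 2) ε (0 : ℕ) *
        X ^ (((n + 2 - 0 : ℕ) : ℤ) - 1)) + -(n.factorial / 2 : ℂ) *
      (((bernoulli (n + 2 - (n + 2)) : ℚ) : ℂ) / ((n + 2 - (n + 2)).factorial : ℂ) *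
      (((bernoulli (n + 2) : ℚ) : ℂ) / ((n + 2).factorial : ℂ)) * eisFactor N (n + 2) ε (n +
          2 : ℕ) *
        X ^ (((n + 2 - (n + 2) : ℕ) : ℤ) - 1)) := by
    obtain ⟨m, hm⟩ : ∃ m, n + 2 = 2 * m := by
      obtain ⟨m, hm⟩ := hk2
      exact ⟨m, by omega⟩
    have hsymm : eisFactor N (n + 2) ε (n + 2 : ℕ) =
        ε.val N * ((N : ℂ) ^ ((n + 2) / 2))⁻¹ * eisFactor N (n + 2) ε (0 : ℕ) := by
      rw [hm, eisFactor_symm hN ε (show 2 * m + 0 = 2 * m by omega),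
        Nat.mul_div_cancel_left _ two_pos, Nat.cast_zero, zero_sub, zpow_neg, zpow_natCast]
    rw [hsymm, Nat.cast_zero, eisFactor_zero, eisConstTerm, eisConst]
    simp only [Nat.sub_zero, Nat.sub_self, bernoulli_zero, Rat.cast_one, Nat.factorial_zero,
      Nat.cast_one, Nat.cast_zero, zero_sub, zpow_neg_one, div_one, mul_one, one_mul, hfac,
      show n + 2 - 1 = n + 1 by omega]
    rw [show ((n + 2 : ℕ) : ℤ) - 1 = ((n + 1 : ℕ) : ℤ) by push_cast; ring, zpow_natCast]
    push_cast
    rw [show (n : ℂ) + 2 - 1 = n + 1 by ring]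
    field_simp
    ring
  rw [ends, mul_add, mul_add, ← add_assoc]
  congr 2
  rw [binomSum, Finset.mul_sum, Finset.mul_sum]
  refine Finset.sum_congr rfl fun j hj => ?_
  obtain ⟨i, rfl⟩ := Nat.exists_eq_add_of_le (Nat.lt_succ_iff.1 (Finset.mem_range.1 hj))
  rcases Nat.even_or_odd j with h | h
  · rw [h.neg_one_pow, if_neg (Nat.not_even_iff_odd.2 h.add_one)]
    simp
  · have hi : Odd i := by
      rw [← Nat.not_even_iff_odd] at h ⊢
      exact fun h' => h ((Nat.even_add.1 hev).2 h')
    have hj2 : Even (j + 1) := h.add_one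
    rw [if_pos hj2, h.neg_one_pow, eisPair_Λ_succ hN hk hk2 ε hε h.pos.ne' (by omega),
      riemannZeta_neg_nat_eq_bernoulli, show j + i + 2 - 2 - j = i by omega, hi.neg_one_pow,
      show j + i + 2 - (j + 1) = i + 1 by omega, show j + i - j = i by omega]
    have hz := zeta_even_eq hj2 j.succ_ne_zero
    push_cast at hz ⊢
    rw [hz]
    have hzb : (-(I / (Real.sqrt N : ℂ))) ^ j * (2 * π / (Real.sqrt N : ℂ))⁻¹ ^ (j + 1) *
        (I / (Real.sqrt N : ℂ)) = -((-1) ^ ((j + 1) / 2) / (2 * π) ^ (j + 1)) := by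
      have : (-(I / (Real.sqrt N : ℂ))) ^ j * (2 * π / (Real.sqrt N : ℂ))⁻¹ ^ (j + 1) *
          (I / (Real.sqrt N : ℂ)) = -(-(I / (Real.sqrt N : ℂ)) * (2 * π / (Real.sqrt N : ℂ))⁻¹) ^
              (j + 1) := by
        rw [mul_pow, pow_succ (-(I / (Real.sqrt N : ℂ))) j]
        ring
      rw [this, show -(I / (Real.sqrt N : ℂ)) * (2 * π / (Real.sqrt N : ℂ))⁻¹ = -I / (2 * π) by
        field_simp, div_pow]
      obtain ⟨h', hh⟩ := hj2
      rw [hh, ← two_mul, Nat.mul_div_cancel_left _ two_pos, pow_mul, neg_sq, I_sq]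
    have hfi : ((i + 1).factorial : ℂ) = ((i : ℂ) + 1) * i.factorial := by
      rw [Nat.factorial_succ]
      push_cast
      rfl
    have hch : ((j + i).choose j : ℂ) * j.factorial * i.factorial = (j + i).factorial := by
      rw [Nat.choose_symm_add]
      exact_mod_cast Nat.add_choose_mul_factorial_mul_factorial j i
    have hzz : -((-1) ^ ((j + 1) / 2) / (2 * π : ℂ) ^ (j + 1)) * (-(-1) ^ ((j + 1) / 2) *
        (2 * π) ^ (j + 1) * ((bernoulli (j + 1) : ℚ) : ℂ) / (2 * ((j + 1).factorial : ℂ))) =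
        ((bernoulli (j + 1) : ℚ) : ℂ) / (2 * ((j + 1).factorial : ℂ)) := by
      have h1 : (-1 : ℂ) ^ ((j + 1) / 2) * (-1) ^ ((j + 1) / 2) = 1 := by simp [← mul_pow]
      have hf : ((j + 1).factorial : ℂ) ≠ 0 := by exact_mod_cast (j + 1).factorial_ne_zero
      field_simp
      linear_combination ((bernoulli (j + 1) : ℚ) : ℂ) * h1
    rw [← hzb] at hzz
    have hi1 : (i : ℂ) + 1 ≠ 0 := by exact_mod_cast i.succ_ne_zero
    have hi! : (i.factorial : ℂ) ≠ 0 := by exact_mod_cast i.factorial_ne_zero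
    rw [hfi, add_sub_cancel_right, zpow_natCast, ← hch]
    generalize -(-1) ^ ((j + 1) / 2) * (2 * π : ℂ) ^ (j + 1) * ((bernoulli (j + 1) : ℚ) : ℂ) /
      (2 * ((j + 1).factorial : ℂ)) = Z at hzz ⊢
    generalize ((bernoulli (j + 1) : ℚ) : ℂ) = B at hzz ⊢
    generalize ((j + 1).factorial : ℂ) = F at hzz ⊢
    have h3 : (((j + i).choose j : ℂ) * j.factorial * i.factorial / 2) *
        (((bernoulli (i + 1) : ℚ) : ℂ) / (((i : ℂ) + 1) * i.factorial)) =
        ((j + i).choose j : ℂ) * j.factorial / 2 * (((bernoulli (i + 1) : ℚ) : ℂ) / ((i : ℂ) + 1))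
            := by
      field_simp
    linear_combination (-((j + i).choose j : ℂ) * X ^ i * j.factorial * eisFactor N (j + i + 2) ε
        (j + 1)
      * ((bernoulli (i + 1) : ℚ) : ℂ) / ((i : ℂ) + 1)) * hzz +
      (B / F * eisFactor N (j + i + 2) ε (j + 1) * X ^ i) * h3

end

/-! ### The Rankin series of a Hecke Eisenstein series -/

/-- The value `ε(p) p^{k/2}` which enters the Euler factor of a Hecke Eisenstein series. -/
def eisLocal {N : ℕ} (k : ℕ) (ε : ALChar N) (p : ℕ) : ℂ := ε.val p * (p : ℂ) ^ (k / 2)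

lemma pow_sub_one_ne_one {p k : ℕ} (hp : p.Prime) (hk : 2 ≤ k) : (p : ℂ) ^ (k - 1) - 1 ≠ 0 := by
  rw [sub_ne_zero]
  exact_mod_cast (Nat.one_lt_pow (by omega) hp.one_lt).ne'

lemma sigmaC_prime_pow {p k : ℕ} (hp : p.Prime) (hk : 2 ≤ k) (j : ℕ) :
    sigmaC (k - 1) (p ^ j) = (((p : ℂ) ^ (k - 1)) ^ (j + 1) - 1) / ((p : ℂ) ^ (k - 1) - 1) := by
  rw [← geom_sum_eq (sub_ne_zero.1 (pow_sub_one_ne_one hp hk)), sigmaC_apply,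
    ArithmeticFunction.sigma_apply_prime_pow hp]
  push_cast
  exact Finset.sum_congr rfl fun i _ => by rw [← pow_mul, mul_comm i, pow_mul]

/-- As N is squarefree, the coefficient is σ(p^j) + bσ(p^{j-1}) with b = `eisLocal k ε p`, which is
0 for p ∤ N. Written as a combination of α^j and 1, α = p^{k-1}, its square is a sum of three
geometric progressions. -/
lemma eisCoeff_prime_pow {N k : ℕ} (hN : Squarefree N) (hk : 2 ≤ k) (ε : ALChar N) {p : ℕ}
    (hp : p.Prime) (j : ℕ) : eisCoeff N k ε (p ^ j) =
      (((p : ℂ) ^ (k - 1)) ^ j * ((p : ℂ) ^ (k - 1) + eisLocal k ε p) - (1 + eisLocal k ε p)) /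
        ((p : ℂ) ^ (k - 1) - 1) := by
  have hα := pow_sub_one_ne_one hp hk
  rcases j with _ | j
  · rw [pow_zero, (eisCoeff_isMultiplicative hN k ε).1, eq_div_iff hα]
    ring
  · rw [eisCoeff, ArithmeticFunction.mul_apply, Nat.sum_divisorsAntidiagonal
      (f := fun a b => ε.twist (fun d => (d : ℂ) ^ (k / 2)) a * sigmaC (k - 1) b),
      Nat.sum_divisors_prime_pow hp, Finset.sum_range_succ', Finset.sum_range_succ',
      Finset.sum_eq_zero]
    · rw [zero_add, zero_add, pow_one, pow_zero, Nat.div_one, ALChar.twist_apply _ _ one_ne_zero,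
        ALChar.twist_apply _ _ hp.ne_zero, pow_succ p j, Nat.mul_div_cancel _ hp.pos, ← pow_succ,
        sigmaC_prime_pow hp hk, sigmaC_prime_pow hp hk, ALChar.val_one hN, eisLocal]
      field_simp
      push_cast
      ring
    · intro i _
      rw [ALChar.twist_apply _ _ (pow_ne_zero _ hp.ne_zero), ALChar.val_of_not_dvd, zero_mul,
        zero_mul]
      intro h
      have := (Nat.squarefree_pow_iff hp.ne_one (by omega)).1 (hN.squarefree_of_dvd h)
      omega

/-- The numerator of the local Rankin factor. -/
def rankinNum (α b x : ℂ) : ℂ :=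
  ((α + b) ^ 2 * (1 - x) * (1 - α * x) - 2 * (α + b) * (1 + b) * (1 - x) * (1 - α ^ 2 * x) +
    (1 + b) ^ 2 * (1 - α * x) * (1 - α ^ 2 * x)) / (α - 1) ^ 2

/-- At primes not dividing N this yields the factor 1 + αx of Ramanujan's formula. -/
lemma rankinNum_zero {α : ℂ} (hα : α - 1 ≠ 0) (x : ℂ) : rankinNum α 0 x = 1 + α * x := by
  rw [rankinNum, div_eq_iff (pow_ne_zero _ hα)]
  ring

lemma hasSum_rankin_local {α b x : ℂ} (h0 : ‖x‖ < 1) (h1 : ‖α * x‖ < 1)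
    (h2 : ‖α ^ 2 * x‖ < 1) :
    HasSum (fun j : ℕ => ((α ^ j * (α + b) - (1 + b)) / (α - 1)) ^ 2 * x ^ j)
      (rankinNum α b x / ((1 - x) * (1 - α * x) * (1 - α ^ 2 * x))) := by
  have n0 : 1 - x ≠ 0 := sub_ne_zero.2 fun h => by simp [← h] at h0
  have n1 : 1 - α * x ≠ 0 := sub_ne_zero.2 fun h => by simp [← h] at h1
  have n2 : 1 - α ^ 2 * x ≠ 0 := sub_ne_zero.2 fun h => by rw [← h] at h2; simp at h2
  have h := (((hasSum_geometric_of_norm_lt_one h2).mul_left ((α + b) ^ 2)).sub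
    ((hasSum_geometric_of_norm_lt_one h1).mul_left (2 * (α + b) * (1 + b)))).add
    ((hasSum_geometric_of_norm_lt_one h0).mul_left ((1 + b) ^ 2))
  convert! h.mul_left (((α - 1) ^ 2)⁻¹) using 1
  · ext j
    rw [mul_pow, mul_pow, ← pow_mul, mul_comm 2 j, pow_mul, div_pow]
    ring
  · rw [rankinNum]
    generalize ((α - 1) ^ 2) = c
    field_simp

/-- The correction at `p` of the Rankin series. -/
def rankinFactor {N : ℕ} (k : ℕ) (ε : ALChar N) (p : ℕ) (s : ℂ) : ℂ :=
  rankinNum ((p : ℂ) ^ (k - 1)) (eisLocal k ε p) ((p : ℂ) ^ (-s)) /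
    (1 + (p : ℂ) ^ (k - 1) * (p : ℂ) ^ (-s))

/-- A crude half-plane is enough: the continuation is determined by any half-plane of convergence.
-/
lemma LSeriesSummable_eisCoeff_sq {N k : ℕ} (hN : N ≠ 0) (hk : 1 ≤ k) (ε : ALChar N) {s : ℂ}
    (hs : 2 * (k : ℝ) + 3 < s.re) : LSeriesSummable (fun n => eisCoeff N k ε n ^ 2) s := by
  obtain ⟨C, hC⟩ := (LSeriesHasSum_eisCoeff hN hk ε (s := (k + 1 : ℝ))
    (by simp)).LSeriesSummable.le_const_mul_rpow
  refine LSeriesSummable_of_le_const_mul_rpow hs ⟨C ^ 2, fun n hn => ?_⟩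
  have h := hC n hn
  rw [ofReal_re] at h
  calc ‖eisCoeff N k ε n ^ 2‖ = ‖eisCoeff N k ε n‖ ^ 2 := norm_pow _ _
    _ ≤ (C * (n : ℝ) ^ ((k : ℝ) + 1)) ^ 2 := by gcongr
    _ = C ^ 2 * (n : ℝ) ^ (2 * (k : ℝ) + 3 - 1) := by
      rw [mul_pow, ← Real.rpow_natCast ((n : ℝ) ^ ((k : ℝ) + 1)) 2, ← Real.rpow_mul (by positivity)]
      congr 2
      push_cast
      ring

lemma norm_pow_mul_cpow_lt_one {p m : ℕ} (hp : p.Prime) {s : ℂ} (hs : (m : ℝ) < s.re) :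
    ‖(p : ℂ) ^ m * (p : ℂ) ^ (-s)‖ < 1 := by
  rw [norm_mul, norm_pow, norm_natCast, norm_natCast_cpow_of_pos hp.pos, ← Real.rpow_natCast,
    ← Real.rpow_add (by exact_mod_cast hp.pos)]
  exact Real.rpow_lt_one_of_one_lt_of_neg (by exact_mod_cast hp.one_lt) (by simp; linarith)

lemma cpow_neg_sub_natCast {p : ℕ} (hp : p.Prime) (s : ℂ) (m : ℕ) :
    (p : ℂ) ^ (-(s - m)) = (p : ℂ) ^ m * (p : ℂ) ^ (-s) := by
  have hp' : (p : ℂ) ≠ 0 := by exact_mod_cast hp.ne_zero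
  rw [neg_sub, sub_eq_add_neg, cpow_add _ _ hp', cpow_natCast]

lemma natCast_pow_cpow (p j : ℕ) (z : ℂ) : ((p ^ j : ℕ) : ℂ) ^ z = ((p : ℂ) ^ z) ^ j := by
  induction j with
  | zero => simp
  | succ j ih => rw [pow_succ, Nat.cast_mul, natCast_mul_natCast_cpow, ih, pow_succ]

lemma hasProd_rankin {N k : ℕ} (hN : Squarefree N) (hk : 2 ≤ k) (ε : ALChar N) {s : ℂ}
    (hs : 2 * (k : ℝ) + 3 < s.re) :
    HasProd (fun p : Nat.Primes => rankinNum ((p : ℂ) ^ (k - 1)) (eisLocal k ε p) ((p : ℂ) ^ (-s)) /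
      ((1 - (p : ℂ) ^ (-s)) * (1 - (p : ℂ) ^ (k - 1) * (p : ℂ) ^ (-s)) *
        (1 - ((p : ℂ) ^ (k - 1)) ^ 2 * (p : ℂ) ^ (-s))))
      (LSeries (fun n => eisCoeff N k ε n ^ 2) s) := by
  have hm := eisCoeff_isMultiplicative hN k ε
  have h := EulerProduct.eulerProduct_hasProd
    (f := LSeries.term (fun n => eisCoeff N k ε n ^ 2) s) (by simp [LSeries.term, hm.1])
    (fun {m n} hmn => ?_) (LSeriesSummable_eisCoeff_sq hN.ne_zero (by omega) ε hs).norm (by simp)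
  · rw [LSeries]
    convert! h using 2 with p
    have hp := p.2
    rw [← (hasSum_rankin_local (α := (p : ℂ) ^ (k - 1)) (b := eisLocal k ε p)
      (x := (p : ℂ) ^ (-s)) ?_ ?_ ?_).tsum_eq]
    · refine tsum_congr fun j => ?_
      rw [LSeries.term_of_ne_zero (pow_ne_zero _ hp.ne_zero), eisCoeff_prime_pow hN hk ε hp,
        div_eq_mul_inv (_ ^ 2), ← cpow_neg, natCast_pow_cpow]
    · simpa using norm_pow_mul_cpow_lt_one (m := 0) hp (s := s)
        (by simp; linarith [(Nat.cast_nonneg k : (0 : ℝ) ≤ k)])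
    · exact norm_pow_mul_cpow_lt_one hp
        (by push_cast [show 1 ≤ k by omega]; linarith [(Nat.cast_nonneg k : (0 : ℝ) ≤ k)])
    · rw [← pow_mul]
      exact norm_pow_mul_cpow_lt_one hp
          (by push_cast [show 1 ≤ k by omega]; linarith [(Nat.cast_nonneg k : (0 : ℝ) ≤ k)])
  · rcases eq_or_ne m 0 with rfl | hm0
    · simp
    rcases eq_or_ne n 0 with rfl | hn0
    · simp
    rw [LSeries.term_of_ne_zero (mul_ne_zero hm0 hn0), LSeries.term_of_ne_zero hm0,
      LSeries.term_of_ne_zero hn0, hm.2 hmn, Nat.cast_mul, natCast_mul_natCast_cpow, mul_pow,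
      mul_div_mul_comm]

/-- Ramanujan's formula ∑ σ_a(n)² n^{-s} = ζ(s)ζ(s-a)²ζ(s-2a)/ζ(2s-2a) with a = k-1, corrected at p
∣ N. It is proved by comparing Euler factors, with 1 - α²x² = (1-αx)(1+αx). -/
lemma LSeries_rankin {N k : ℕ} (hN : Squarefree N) (hk : 2 ≤ k) (ε : ALChar N) {s : ℂ}
    (hs : 2 * (k : ℝ) + 3 < s.re) :
    LSeries (fun n => eisCoeff N k ε n ^ 2) s * riemannZeta (2 * s - (2 * (k - 1) : ℕ)) =
      riemannZeta s * riemannZeta (s - (k - 1 : ℕ)) ^ 2 * riemannZeta (s - (2 * (k - 1) : ℕ)) *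
        ∏ p ∈ N.primeFactors, rankinFactor k ε p s := by
  have hk0 : (0 : ℝ) ≤ k := Nat.cast_nonneg k
  have hk1 : ((k - 1 : ℕ) : ℝ) = k - 1 := by push_cast [show 1 ≤ k by omega]; rfl
  have r1 : 1 < (s - (k - 1 : ℕ)).re := by rw [sub_re, natCast_re, hk1]; linarith
  have r2 : 1 < (s - (2 * (k - 1) : ℕ)).re := by
    rw [sub_re, natCast_re, Nat.cast_mul, hk1]
    push_cast
    linarith
  have r3 : 1 < (2 * s - (2 * (k - 1) : ℕ)).re := by
    rw [sub_re, natCast_re, Nat.cast_mul, hk1, mul_re]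
    simp
    linarith
  have hprod : HasProd (fun p : Nat.Primes => if (p : ℕ) ∣ N then rankinFactor k ε p s else 1)
      (∏ p ∈ N.primeFactors, rankinFactor k ε p s) := by
    have h1 := hasProd_prod_of_ne_finset_one (L := SummationFilter.unconditional _)
      (f := fun p : Nat.Primes => if (p : ℕ) ∣ N then rankinFactor k ε p s else 1)
      (s := N.primeFactors.subtype Nat.Prime) (fun p hp => if_neg fun h => hp
        (Finset.mem_subtype.2 (Nat.mem_primeFactors.2 ⟨p.2, h, hN.ne_zero⟩)))
    convert! h1 using 1
    rw [← Finset.prod_subtype_of_mem (fun p => rankinFactor k ε p s)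
      fun p hp => Nat.prime_of_mem_primeFactors hp]
    exact Finset.prod_congr rfl fun p hp => (if_pos
      (Nat.dvd_of_mem_primeFactors (Finset.mem_subtype.1 hp))).symm
  have hl := (hasProd_rankin hN hk ε hs).mul (riemannZeta_eulerProduct_hasProd r3)
  have z1 := riemannZeta_eulerProduct_hasProd r1
  have hr := (((riemannZeta_eulerProduct_hasProd (s := s) (by linarith)).mul (z1.mul z1)).mul
    (riemannZeta_eulerProduct_hasProd r2)).mul hprod
  rw [pow_two]
  refine hl.unique ?_
  convert! hr using 2 with p
  have hp := p.2
  have n0 : ‖(p : ℂ) ^ (-s)‖ < 1 := by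
    simpa using norm_pow_mul_cpow_lt_one (m := 0) hp (s := s) (by simp; linarith)
  have n1 : ‖(p : ℂ) ^ (k - 1) * (p : ℂ) ^ (-s)‖ < 1 :=
    norm_pow_mul_cpow_lt_one hp (by rw [hk1]; linarith)
  have n2 : ‖((p : ℂ) ^ (k - 1)) ^ 2 * (p : ℂ) ^ (-s)‖ < 1 := by
    rw [← pow_mul]
    exact norm_pow_mul_cpow_lt_one hp (by rw [Nat.cast_mul, hk1]; push_cast; linarith)
  have hb : ¬ (p : ℕ) ∣ N → eisLocal k ε p = 0 := fun h => by
    rw [eisLocal, ALChar.val_of_not_dvd _ h, zero_mul]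
  rw [cpow_neg_sub_natCast hp, cpow_neg_sub_natCast hp, cpow_neg_sub_natCast hp, mul_comm 2 (k - 1),
    pow_mul, show -(2 * s) = -s + -s by ring, cpow_add _ _ (by exact_mod_cast hp.ne_zero)]
  have hif : (if (p : ℕ) ∣ N then rankinFactor k ε p s else 1) = rankinFactor k ε p s := by
    split_ifs with h
    · rfl
    · rw [rankinFactor, hb h, rankinNum_zero (pow_sub_one_ne_one hp hk), div_self]
      intro h
      rw [add_comm, add_eq_zero_iff_eq_neg] at h
      rw [h] at n1
      simp at n1
  rw [hif, rankinFactor]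
  generalize (p : ℂ) ^ (-s) = x at *
  generalize (p : ℂ) ^ (k - 1) = α at *
  have m0 : 1 - x ≠ 0 := sub_ne_zero.2 fun h => by simp [← h] at n0
  have m1 : 1 - α * x ≠ 0 := sub_ne_zero.2 fun h => by simp [← h] at n1
  have m2 : 1 - α ^ 2 * x ≠ 0 := sub_ne_zero.2 fun h => by rw [← h] at n2; simp at n2
  have m3 : 1 + α * x ≠ 0 := fun h => by
    rw [add_comm, add_eq_zero_iff_eq_neg] at h
    rw [h] at n1
    simp at n1
  have m4 : 1 - α ^ 2 * (x * x) = (1 - α * x) * (1 + α * x) := by ring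
  rw [m4]
  field_simp

/-! ### Meromorphic continuation of the Rankin series and its residue -/

lemma meromorphic_riemannZeta : Meromorphic riemannZeta := by
  intro s
  have h : MeromorphicAt (fun s => (s - 1)⁻¹ * riemannZeta₁ s) s :=
    MeromorphicAt.mul (by fun_prop) (differentiable_riemannZeta₁.analyticAt s).meromorphicAt
  refine h.congr ?_
  rcases eq_or_ne s 1 with rfl | hs
  · filter_upwards [self_mem_nhdsWithin] with z hz
    exact (riemannZeta_eq_inv_sub_mul hz).symm
  · filter_upwards [(eventually_ne_nhds hs).filter_mono nhdsWithin_le_nhds] with z hz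
    exact (riemannZeta_eq_inv_sub_mul hz).symm

lemma meromorphic_riemannZeta_comp {g : ℂ → ℂ} (hg : Differentiable ℂ g) :
    Meromorphic fun s => riemannZeta (g s) :=
  fun s => (meromorphic_riemannZeta (g s)).comp_analyticAt (hg.analyticAt s)

/-- Meromorphic functions that agree on a half-plane agree near every point. -/
lemma eventuallyEq_of_meromorphic {F G : ℂ → ℂ} (hF : Meromorphic F) (hG : Meromorphic G) {σ : ℝ}
    (h : ∀ s : ℂ, σ < s.re → F s = G s) (z : ℂ) : F =ᶠ[𝓝[≠] z] G := by
  have hD : MeromorphicOn (F - G) Set.univ := meromorphicOn_univ.2 (hF.sub hG)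
  have h0 : meromorphicOrderAt (F - G) ((σ + 1 : ℝ) : ℂ) = ⊤ := by
    rw [meromorphicOrderAt_eq_top_iff]
    have : ∀ᶠ s : ℂ in 𝓝 ((σ + 1 : ℝ) : ℂ), σ < s.re :=
      Complex.continuous_re.continuousAt.eventually_const_lt (by simp)
    filter_upwards [this.filter_mono nhdsWithin_le_nhds] with s hs
    simp [h s hs]
  have h1 : meromorphicOrderAt (F - G) z = ⊤ := by
    by_contra hz
    exact hD.meromorphicOrderAt_ne_top_of_isPreconnected isPreconnected_univ (Set.mem_univ z)
      (Set.mem_univ _) hz h0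
  filter_upwards [meromorphicOrderAt_eq_top_iff.1 h1] with s hs
  exact sub_eq_zero.1 hs

/-- Two continuations agree on a punctured neighbourhood of k, so the arbitrary choice in the
definition has no effect. -/
lemma rankinResidue_eq {a : ℕ → ℂ} {k : ℕ} {F : ℂ → ℂ} (hF : IsRankinContinuation a F) {L : ℂ}
    (hL : Tendsto (fun s => (s - k) * F s) (𝓝[≠] (k : ℂ)) (𝓝 L)) : rankinResidue a k = L := by
  have hex : ∃ F : ℂ → ℂ, IsRankinContinuation a F := ⟨F, hF⟩
  rw [rankinResidue, dif_pos hex]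
  obtain ⟨hm, σ, hσ⟩ := hex.choose_spec
  obtain ⟨hm', σ', hσ'⟩ := hF
  have he := eventuallyEq_of_meromorphic hm hm' (σ := max σ σ')
    (fun s hs => by rw [(hσ s ((le_max_left _ _).trans_lt hs)).2,
      (hσ' s ((le_max_right _ _).trans_lt hs)).2]) k
  refine Tendsto.limUnder_eq (hL.congr' ?_)
  filter_upwards [he] with s hs
  rw [hs]

lemma differentiable_cpow_neg {p : ℕ} (hp : p ≠ 0) : Differentiable ℂ fun s : ℂ => (p : ℂ) ^ (-s) :=
  fun s => (differentiable_neg s).const_cpow (Or.inl (by exact_mod_cast hp))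

lemma differentiable_rankinNum (α b : ℂ) {p : ℕ} (hp : p ≠ 0) :
    Differentiable ℂ fun s : ℂ => rankinNum α b ((p : ℂ) ^ (-s)) := by
  have := differentiable_cpow_neg hp
  unfold rankinNum
  fun_prop

/-- The meromorphic continuation of the Rankin series of a Hecke Eisenstein series. -/
def rankinZeta (N k : ℕ) (ε : ALChar N) (s : ℂ) : ℂ :=
  riemannZeta s * riemannZeta (s - (k - 1 : ℕ)) ^ 2 * riemannZeta (s - (2 * (k - 1) : ℕ)) *
    (∏ p ∈ N.primeFactors, rankinFactor k ε p s) / riemannZeta (2 * s - (2 * (k - 1) : ℕ))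

lemma isRankinContinuation_rankinZeta {N k : ℕ} (hN : Squarefree N) (hk : 2 ≤ k) (hk2 : Even k)
    (ε : ALChar N) : IsRankinContinuation (coeff (heckeEis N k ε)) (rankinZeta N k ε) := by
  have hcoeff : ∀ n : ℕ, n ≠ 0 → coeff (heckeEis N k ε) n ^ 2 =
      eisCoeff N k ε n ^ 2 := fun n hn => by
    rw [coeff_heckeEis hN.ne_zero hk hk2 ε, if_neg hn]
  refine ⟨?_, 2 * k + 3, fun s hs => ⟨?_, ?_⟩⟩
  · have hz := meromorphic_riemannZeta_comp (g := fun s => s - (k - 1 : ℕ)) (by fun_prop)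
    have hz2 := meromorphic_riemannZeta_comp (g := fun s => s - (2 * (k - 1) : ℕ)) (by fun_prop)
    have hz3 := meromorphic_riemannZeta_comp (g := fun s => 2 * s - (2 * (k - 1) : ℕ)) (by fun_prop)
    have hp : Meromorphic fun s => ∏ p ∈ N.primeFactors, rankinFactor k ε p s := by
      intro s
      refine MeromorphicAt.fun_prod fun p hp => ?_
      have hp0 := (Nat.prime_of_mem_primeFactors hp).ne_zero
      have hd := differentiable_cpow_neg hp0
      exact ((differentiable_rankinNum _ _ hp0).analyticAt s).meromorphicAt.div
        ((Differentiable.analyticAt (f := fun s => 1 + (p : ℂ) ^ (k - 1) * (p : ℂ) ^ (-s))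
          (by fun_prop) s).meromorphicAt)
    exact (((meromorphic_riemannZeta.mul (hz.pow (n := 2))).mul hz2).mul hp).div hz3
  · exact (LSeriesSummable_congr s fun {n} hn => hcoeff n hn).2
      (LSeriesSummable_eisCoeff_sq hN.ne_zero (by omega) ε hs)
  · rw [LSeries_congr (fun {n} hn => hcoeff n hn), rankinZeta, ← LSeries_rankin hN hk ε hs,
      mul_div_cancel_right₀]
    have hk1 : ((k - 1 : ℕ) : ℝ) = k - 1 := by push_cast [show 1 ≤ k by omega]; rfl
    refine riemannZeta_ne_zero_of_one_lt_re ?_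
    rw [sub_re, natCast_re, Nat.cast_mul, hk1, mul_re]
    simp
    linarith [(Nat.cast_nonneg k : (0 : ℝ) ≤ k)]

/-- The prime `p` is exceptional if the Euler factor `1 + ε(p) p^{k/2-s}` vanishes at `s = 1`. -/
def IsExceptional {N : ℕ} (k : ℕ) (ε : ALChar N) (p : ℕ) : Prop := k = 2 ∧ ε.val p = -1

/-- Taking absolute values in ε(p)p^{k/2} = -p forces k/2 = 1. -/
lemma eisLocal_add_eq_zero_iff {N k p : ℕ} (hk : 2 ≤ k) (hk2 : Even k) (ε : ALChar N)
    (hN : N ≠ 0) (hp : p.Prime) (hpN : p ∣ N) : eisLocal k ε p + p = 0 ↔ IsExceptional k ε p := by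
  have hp0 : (p : ℂ) ≠ 0 := by exact_mod_cast hp.ne_zero
  obtain ⟨m, rfl⟩ : ∃ m, k = 2 * m := hk2.exists_two_nsmul.imp fun m hm => by simpa using hm
  rw [eisLocal, IsExceptional, Nat.mul_div_cancel_left _ two_pos]
  constructor
  · intro h
    have h2 : m = 1 := by
      by_contra hm
      have h3 : (p : ℝ) ^ m = p := by
        have h4 : ‖ε.val p * (p : ℂ) ^ m‖ = ‖(p : ℂ)‖ := by
          rw [eq_neg_of_add_eq_zero_left h, norm_neg]
        rcases ALChar.val_eq_or hN ε hpN with h5 | h5 <;> simpa [h5] using h4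
      have h5 : p ^ 1 < p ^ m := Nat.pow_lt_pow_right hp.one_lt (by omega)
      rw [pow_one] at h5
      have h6 : p ^ m = p := by exact_mod_cast h3
      omega
    subst h2
    refine ⟨rfl, mul_right_cancel₀ hp0 ?_⟩
    linear_combination h
  · rintro ⟨h1, h2⟩
    obtain rfl : m = 1 := by omega
    rw [h2]
    ring

open Classical in
/-- The value at `s = k` of the quotient of the local factors of the Rankin series and of
`L(s - k + 1)`. -/
def rankinRatio {N : ℕ} (k : ℕ) (ε : ALChar N) (p : ℕ) : ℂ :=
  (if IsExceptional k ε p then 1 / 2 else 1) *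
    (2 * p * (eisLocal k ε p + 1) / (eisLocal k ε p * (p + 1)))

lemma eisLocal_sq {N k p : ℕ} (hk : 2 ≤ k) (hk2 : Even k) (ε : ALChar N) (hN : N ≠ 0)
    (hpN : p ∣ N) : eisLocal k ε p ^ 2 = (p : ℂ) ^ (k - 1) * p := by
  rw [eisLocal, mul_pow, pow_two (ε.val p), ALChar.val_mul_self hN ε hpN, one_mul, ← pow_mul,
    Nat.div_mul_cancel hk2.two_dvd, ← pow_succ]
  congr 1
  omega

/-- The Euler factor of E(s-k+1) is extracted from the Rankin factor, because L(s-k+1) has to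
reappear in the residue. At an exceptional prime this Euler factor vanishes at s = k, so the
division must be made algebraically before passing to the limit. -/
lemma exists_rankinFactor_eq {N k p : ℕ} (hk : 2 ≤ k) (hk2 : Even k) (ε : ALChar N) (hN : N ≠ 0)
    (hp : p.Prime) (hpN : p ∣ N) : ∃ κ : ℂ → ℂ, ContinuousAt κ k ∧ κ k = rankinRatio k ε p ∧
      ∀ᶠ s : ℂ in 𝓝 (k : ℂ), rankinFactor k ε p s =
        κ s * (1 + eisLocal k ε p * ((p : ℂ) ^ (k - 1) * (p : ℂ) ^ (-s))) := by
  have hp0 : (p : ℂ) ≠ 0 := by exact_mod_cast hp.ne_zero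
  have hp1 : (p : ℂ) + 1 ≠ 0 := by exact_mod_cast p.succ_ne_zero
  have hα := pow_sub_one_ne_one hp hk
  have hd := differentiable_cpow_neg hp.ne_zero
  have hca : ContinuousAt (fun s : ℂ => (p : ℂ) ^ (-s)) k := hd.continuous.continuousAt
  have hx : (p : ℂ) ^ (k - 1) * (p : ℂ) ^ (-(k : ℂ)) = (p : ℂ)⁻¹ := by
    rw [cpow_neg, cpow_natCast]
    obtain ⟨j, rfl⟩ : ∃ j, k = j + 1 := ⟨k - 1, by omega⟩
    rw [Nat.add_sub_cancel, pow_succ]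
    field_simp
  have hden : 1 + (p : ℂ) ^ (k - 1) * (p : ℂ) ^ (-(k : ℂ)) ≠ 0 := by
    rw [hx]
    field_simp
    exact div_ne_zero hp1 hp0
  by_cases hex : IsExceptional k ε p
  -- Here b = -p = -α, so the numerator reduces to (1-αx)(1-α²x), and 1-α²x is the vanishing Euler
  -- factor.
  · refine ⟨fun s => (1 - (p : ℂ) ^ (k - 1) * (p : ℂ) ^ (-s)) /
      (1 + (p : ℂ) ^ (k - 1) * (p : ℂ) ^ (-s)), ?_, ?_, ?_⟩
    · exact ContinuousAt.div (by fun_prop) (by fun_prop) hden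
    · have hb := eq_neg_of_add_eq_zero_left ((eisLocal_add_eq_zero_iff hk hk2 ε hN hp hpN).2 hex)
      beta_reduce
      rw [rankinRatio, if_pos hex, hx, hb]
      field_simp
      ring
    · refine Eventually.of_forall fun s => ?_
      have hb := eq_neg_of_add_eq_zero_left ((eisLocal_add_eq_zero_iff hk hk2 ε hN hp hpN).2 hex)
      obtain ⟨rfl, -⟩ := hex
      rw [rankinFactor, hb, div_mul_eq_mul_div, rankinNum]
      congr 1
      rw [div_eq_iff (pow_ne_zero _ hα)]
      ring
  · have hb : eisLocal k ε p + p ≠ 0 := fun h =>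
      hex ((eisLocal_add_eq_zero_iff hk hk2 ε hN hp hpN).1 h)
    have hE : 1 + eisLocal k ε p * ((p : ℂ) ^ (k - 1) * (p : ℂ) ^ (-(k : ℂ))) ≠ 0 := by
      rw [hx]
      field_simp
      exact div_ne_zero (by rwa [add_comm]) hp0
    refine ⟨fun s => rankinFactor k ε p s /
      (1 + eisLocal k ε p * ((p : ℂ) ^ (k - 1) * (p : ℂ) ^ (-s))), ?_, ?_, ?_⟩
    · refine ContinuousAt.div (ContinuousAt.div ?_
        (continuousAt_const.add (continuousAt_const.mul hca)) hden) (continuousAt_const.add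
        (continuousAt_const.mul (continuousAt_const.mul hca))) hE
      exact (differentiable_rankinNum _ _ hp.ne_zero).continuous.continuousAt
    · beta_reduce
      have hbb := eisLocal_sq hk hk2 ε hN hpN
      have hb0 : eisLocal k ε p ≠ 0 := fun h => by
        rw [h, zero_pow two_ne_zero] at hbb
        exact mul_ne_zero (pow_ne_zero _ hp0) hp0 hbb.symm
      -- Because b² = p^k, both p^{-k} and α = p^{k-1} are expressed through b and p, and the claim
      -- becomes an identity of rational functions.
      have hx' : (p : ℂ) ^ (-(k : ℂ)) = (eisLocal k ε p ^ 2)⁻¹ := by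
        rw [hbb]
        apply mul_left_cancel₀ (pow_ne_zero (k - 1) hp0)
        rw [hx]
        field_simp
      have hα' : (p : ℂ) ^ (k - 1) = eisLocal k ε p ^ 2 / p := by
        rw [hbb]
        field_simp
      rw [rankinRatio, if_neg hex, rankinFactor, rankinNum, hx', hα']
      rw [hα'] at hα
      generalize eisLocal k ε p = b at *
      generalize (p : ℂ) = P at *
      have hα2 : b ^ 2 - P ≠ 0 := fun h => hα (by
        rw [sub_eq_zero.1 h]
        field_simp
        ring)
      have e1 : 1 + b ^ 2 / P * (b ^ 2)⁻¹ = (P + 1) / P := by field_simp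
      have e2 : 1 + b * (b ^ 2 / P * (b ^ 2)⁻¹) = (b + P) / P := by field_simp; ring
      rw [e1, e2, show b ^ 2 / P - 1 = (b ^ 2 - P) / P by field_simp]
      field_simp
      ring
    · have hcE : ContinuousAt (fun s : ℂ =>
          1 + eisLocal k ε p * ((p : ℂ) ^ (k - 1) * (p : ℂ) ^ (-s))) k := by fun_prop
      filter_upwards [hcE.eventually_ne hE] with s hs
      rw [div_mul_cancel₀ _ hs]

/-- Put s' = s-k+1 → 1. One of the two factors ζ(s') supplies the pole; the other, with ζ(s'-k+1)
and the extracted E(s'), forms the L-series, whose limit is `eisLimit`. What remains is ∏κ_p ·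
ζ(k)/ζ(2). -/
lemma rankinResidue_heckeEis {N k : ℕ} (hN : Squarefree N) (hk : 2 ≤ k) (hk2 : Even k)
    (ε : ALChar N) (hε : ¬ (k = 2 ∧ ε.IsTrivial)) :
    rankinResidue (coeff (heckeEis N k ε)) k = eisLimit hN hk hk2 ε hε *
      (∏ p ∈ N.primeFactors, rankinRatio k ε p) * riemannZeta k / riemannZeta 2 := by
  refine rankinResidue_eq (isRankinContinuation_rankinZeta hN hk hk2 ε) ?_
  have hcast : ((k - 1 : ℕ) : ℂ) = k - 1 := by push_cast [show 1 ≤ k by omega]; rfl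
  choose! κ hκ1 hκ2 hκ3 using fun p (hp : p ∈ N.primeFactors) =>
    exists_rankinFactor_eq hk hk2 ε hN.ne_zero (Nat.prime_of_mem_primeFactors hp)
      (Nat.dvd_of_mem_primeFactors hp)
  have hshift : Tendsto (fun s : ℂ => s - (k - 1 : ℕ)) (𝓝[≠] (k : ℂ)) (𝓝[≠] 1) := by
    refine tendsto_nhdsWithin_iff.2 ⟨?_, ?_⟩
    · have : ContinuousAt (fun s : ℂ => s - (k - 1 : ℕ)) k := by fun_prop
      have h := this.tendsto.mono_left (nhdsWithin_le_nhds (s := {(k : ℂ)}ᶜ))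
      rw [hcast, sub_sub_cancel] at h
      rwa [hcast]
    · filter_upwards [self_mem_nhdsWithin] with s hs h
      exact hs (by rw [Set.mem_singleton_iff] at h ⊢; rw [hcast] at h; linear_combination h)
  have l1 := riemannZeta_residue_one.comp hshift
  have l2 := (tendsto_eisLimit hN hk hk2 ε hε).comp hshift
  have hk1 : (k : ℂ) ≠ 1 := by exact_mod_cast (by omega : k ≠ 1)
  have l3 : Tendsto riemannZeta (𝓝[≠] (k : ℂ)) (𝓝 (riemannZeta k)) :=
    (differentiableAt_riemannZeta hk1).continuousAt.tendsto.mono_left nhdsWithin_le_nhds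
  have l4 : Tendsto (fun s : ℂ => riemannZeta (2 * s - (2 * (k - 1) : ℕ))) (𝓝[≠] (k : ℂ))
      (𝓝 (riemannZeta 2)) := by
    have h2 : (2 : ℂ) * k - (2 * (k - 1) : ℕ) = 2 := by
      rw [Nat.cast_mul, hcast]
      push_cast
      ring
    have : ContinuousAt (fun s : ℂ => riemannZeta (2 * s - (2 * (k - 1) : ℕ))) k :=
      ContinuousAt.comp (g := riemannZeta) (f := fun s : ℂ => 2 * s - (2 * (k - 1) : ℕ))
        (by rw [h2]; exact (differentiableAt_riemannZeta (by norm_num)).continuousAt) (by fun_prop)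
    have h := this.tendsto.mono_left (nhdsWithin_le_nhds (s := {(k : ℂ)}ᶜ))
    rwa [h2] at h
  have l5 : Tendsto (fun s => ∏ p ∈ N.primeFactors, κ p s) (𝓝[≠] (k : ℂ))
      (𝓝 (∏ p ∈ N.primeFactors, rankinRatio k ε p)) :=
    tendsto_finsetProd _ fun p hp => by
      rw [← hκ2 p hp]
      exact (hκ1 p hp).tendsto.mono_left nhdsWithin_le_nhds
  have hz2 : riemannZeta 2 ≠ 0 := riemannZeta_ne_zero_of_one_lt_re (by simp)
  have hlim := ((((l1.mul l2).mul l5).mul l3).div l4 hz2)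
  rw [one_mul] at hlim
  refine hlim.congr' ?_
  have hall : ∀ᶠ s : ℂ in 𝓝[≠] (k : ℂ), ∀ p ∈ N.primeFactors, rankinFactor k ε p s =
      κ p s * (1 + eisLocal k ε p * ((p : ℂ) ^ (k - 1) * (p : ℂ) ^ (-s))) :=
    (Filter.eventually_all_finset _).2 fun p hp => (hκ3 p hp).filter_mono nhdsWithin_le_nhds
  filter_upwards [hall] with s hs
  have hE : eisFactor N k ε (s - (k - 1 : ℕ)) =
      ∏ p ∈ N.primeFactors, (1 + eisLocal k ε p * ((p : ℂ) ^ (k - 1) * (p : ℂ) ^ (-s))) := by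
    rw [eisFactor_eq_prod hN]
    refine Finset.prod_congr rfl fun p hp => ?_
    rw [← cpow_neg_sub_natCast (Nat.prime_of_mem_primeFactors hp), eisLocal, cpow_neg]
    ring
  have e2 : s - ((k - 1 : ℕ) : ℂ) - ((k - 1 : ℕ) : ℂ) = s - (2 * (k - 1) : ℕ) := by
    push_cast
    ring
  simp only [Function.comp_apply, Pi.div_apply, rankinZeta]
  rw [Finset.prod_congr rfl hs, Finset.prod_mul_distrib, ← hE, e2,
    show s - ((k - 1 : ℕ) : ℂ) - 1 = s - k by rw [hcast]; ring]
  ring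

/-! ### Nonvanishing of the limit of the `L`-series -/

lemma one_add_val_mul_ne_zero {N : ℕ} (hN : N ≠ 0) (ε : ALChar N) {p : ℕ} (hpN : p ∣ N) {z : ℂ}
    (hz : ‖z‖ ≠ 1) : 1 + ε.val p * z ≠ 0 := by
  intro h
  apply hz
  have h1 := congrArg norm (eq_neg_of_add_eq_zero_right h)
  rw [norm_neg, norm_one, norm_mul] at h1
  rcases ALChar.val_eq_or hN ε hpN with h2 | h2 <;> simpa [h2] using h1

lemma tendsto_one_sub_cpow_div {p : ℕ} (hp : p ≠ 0) :
    Tendsto (fun s : ℂ => (1 - (p : ℂ) / (p : ℂ) ^ s) / (s - 1)) (𝓝[≠] 1) (𝓝 (Complex.log p)) := by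
  have hp' : (p : ℂ) ≠ 0 := by exact_mod_cast hp
  have h : HasDerivAt (fun s : ℂ => 1 - (p : ℂ) ^ (1 - s)) (Complex.log p) 1 := by
    have h1 := (((hasDerivAt_id (1 : ℂ)).const_sub 1).const_cpow (c := (p : ℂ))
      (Or.inl hp')).const_sub 1
    simpa using h1
  refine (hasDerivAt_iff_tendsto_slope.1 h).congr fun s => ?_
  rw [slope_def_field, cpow_sub _ _ hp', cpow_one]
  simp

/-- A nontrivial character is -1 at some prime; nondegeneracy allows only one. -/
lemma card_exceptional {N : ℕ} (hN : Squarefree N) (ε : ALChar N) (hε : ¬ ε.IsTrivial)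
    (hdeg : ¬ 2 ≤ (N.primeFactors.filter (fun p => ε.val p = -1)).card) :
    (N.primeFactors.filter (fun p => ε.val p = -1)).card = 1 := by
  have h2 : (N.primeFactors.filter (fun p => ε.val p = -1)).card ≠ 0 := by
    rw [Finset.card_ne_zero]
    by_contra h
    rw [Finset.not_nonempty_iff_eq_empty, Finset.filter_eq_empty_iff] at h
    refine hε ((ALChar.isTrivial_iff hN ε).2 fun p hp => ?_)
    exact (ALChar.val_eq_or hN.ne_zero ε (Nat.dvd_of_mem_primeFactors hp)).resolve_right (h hp)
  omega

/-- In weight two exactly one Euler factor vanishes, simply and with derivative log q; against the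
pole of ζ the limit is log q · 2^{t-1} · ζ(0). For k ≥ 4 the functional equation moves the question
to s = k-1, where E, ζ(k-1) and ζ(0) are all nonzero. -/
lemma eisLimit_ne_zero {N k : ℕ} (hN : Squarefree N) (hk : 2 ≤ k) (hk2 : Even k)
    (ε : ALChar N) (hε : ¬ (k = 2 ∧ ε.IsTrivial))
    (hdeg : ¬ (k = 2 ∧ 2 ≤ (N.primeFactors.filter (fun p => ε.val p = -1)).card)) :
    eisLimit hN hk hk2 ε hε ≠ 0 := by
  rcases eq_or_ne k 2 with rfl | hk4
  · have hcard := card_exceptional hN ε (fun h => hε ⟨rfl, h⟩) (fun h => hdeg ⟨rfl, h⟩)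
    obtain ⟨q, hq⟩ := Finset.card_eq_one.1 hcard
    have hqm : q ∈ N.primeFactors ∧ ε.val q = -1 := by
      have : q ∈ N.primeFactors.filter (fun p => ε.val p = -1) := by
        rw [hq]
        exact Finset.mem_singleton_self q
      exact Finset.mem_filter.1 this
    have hq0 := Nat.prime_of_mem_primeFactors hqm.1
    have l1 := tendsto_one_sub_cpow_div hq0.ne_zero
    have l2 := riemannZeta_residue_one
    have l3 : Tendsto (fun s : ℂ => riemannZeta (s - 1)) (𝓝[≠] 1) (𝓝 (-1 / 2)) := by
      have : ContinuousAt (fun s : ℂ => riemannZeta (s - 1)) 1 :=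
        ContinuousAt.comp (g := riemannZeta) (f := fun s : ℂ => s - 1)
          (by rw [sub_self]; exact (differentiableAt_riemannZeta zero_ne_one).continuousAt)
          (by fun_prop)
      have h := this.tendsto.mono_left (nhdsWithin_le_nhds (s := {(1 : ℂ)}ᶜ))
      rwa [sub_self, riemannZeta_zero] at h
    have l4 : Tendsto (fun s : ℂ => ∏ p ∈ N.primeFactors.erase q,
        (1 + ε.val p * ((p : ℂ) ^ (2 / 2) / (p : ℂ) ^ s))) (𝓝[≠] 1)
        (𝓝 (∏ p ∈ N.primeFactors.erase q, 2)) := by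
      refine tendsto_finsetProd _ fun p hp => ?_
      obtain ⟨hpq, hp⟩ := Finset.mem_erase.1 hp
      have hp0 : (p : ℂ) ≠ 0 := by exact_mod_cast (Nat.prime_of_mem_primeFactors hp).ne_zero
      have h1 : ε.val p = 1 := by
        refine (ALChar.val_eq_or hN.ne_zero ε (Nat.dvd_of_mem_primeFactors hp)).resolve_right
          fun h => hpq ?_
        have : p ∈ N.primeFactors.filter (fun p => ε.val p = -1) := Finset.mem_filter.2 ⟨hp, h⟩
        rw [hq] at this
        exact Finset.mem_singleton.1 this
      have hc : ContinuousAt (fun s : ℂ => 1 + ε.val p * ((p : ℂ) ^ (2 / 2) / (p : ℂ) ^ s)) 1 := by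
        refine continuousAt_const.add (continuousAt_const.mul (continuousAt_const.div ?_ ?_))
        · exact (continuousAt_id).const_cpow (Or.inl hp0)
        · simp [hp0]
      have h := hc.tendsto.mono_left (nhdsWithin_le_nhds (s := {(1 : ℂ)}ᶜ))
      simp only [h1, Nat.div_self two_pos, pow_one, cpow_one, div_self hp0, one_mul] at h ⊢
      rwa [one_add_one_eq_two] at h
    have hl := ((l1.mul l2).mul l4).mul l3
    have hu := tendsto_nhds_unique (tendsto_eisLimit hN hk hk2 ε hε) (hl.congr' ?_)
    · rw [hu]
      have hlog : Complex.log q ≠ 0 := by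
        rw [← natCast_log, ofReal_ne_zero]
        exact (Real.log_pos (by exact_mod_cast hq0.one_lt)).ne'
      refine mul_ne_zero (mul_ne_zero (mul_ne_zero hlog one_ne_zero) ?_) (by norm_num)
      exact Finset.prod_ne_zero_iff.2 fun _ _ => two_ne_zero
    · filter_upwards [self_mem_nhdsWithin] with s hs
      have hs1 : s - 1 ≠ 0 := sub_ne_zero.2 hs
      rw [eisFactor_eq_prod hN, ← Finset.mul_prod_erase _ _ hqm.1, hqm.2]
      simp only [Nat.div_self two_pos, pow_one, show 2 - 1 = 1 from rfl, Nat.cast_one]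
      field_simp
      ring
  · intro h
    have hk4 : 4 ≤ k := by
      obtain ⟨m, rfl⟩ := hk2
      omega
    have hcast : ((k - 1 : ℕ) : ℂ) = k - 1 := by push_cast [show 1 ≤ k by omega]; rfl
    have hb : ((2 * π / Real.sqrt N : ℝ) : ℂ) ≠ 0 := by
      have := hN.ne_zero
      rw [ofReal_ne_zero]
      positivity
    have hΛ : (eisPair hN hk hk2 ε hε).Λ 1 = 0 := (mul_eq_zero.1 h).resolve_left hb
    have hfe := eisPair_functional_equation hN hk hk2 ε hε 1
    rw [hΛ, mul_zero] at hfe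
    have he := eisPair_Λ_eq hN hk hk2 ε hε (s := (k : ℂ) - 1)
      (by rw [← hcast]; exact_mod_cast (by omega : k - 1 ≠ 0))
      (by rw [← hcast]; exact_mod_cast (by omega : k - 1 ≠ 1)) (by simp)
    rw [hfe, mul_zero, hcast, sub_self, riemannZeta_zero, ← hcast] at he
    have hz : riemannZeta ((k - 1 : ℕ) : ℂ) ≠ 0 :=
      riemannZeta_ne_zero_of_one_lt_re (by rw [natCast_re]; exact_mod_cast (by omega : 1 < k - 1))
    have hE : eisFactor N k ε ((k - 1 : ℕ) : ℂ) ≠ 0 := by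
      rw [eisFactor_eq_prod hN]
      refine Finset.prod_ne_zero_iff.2 fun p hp => ?_
      have hp0 := Nat.prime_of_mem_primeFactors hp
      refine one_add_val_mul_ne_zero hN.ne_zero ε (Nat.dvd_of_mem_primeFactors hp) ?_
      rw [cpow_natCast, norm_div, norm_pow, norm_pow, Complex.norm_natCast]
      have h1 : (p : ℝ) ^ (k / 2) < (p : ℝ) ^ (k - 1) :=
        pow_lt_pow_right₀ (by exact_mod_cast hp0.one_lt) (by omega)
      exact ((div_lt_one (by have := hp0.pos; positivity)).2 h1).ne
    exact mul_ne_zero hE (mul_ne_zero hz (by norm_num)) he.symm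

/-! ### The index of `Γ₀(N)` -/

/-- The action of `Γ₀(a)` on the projective line over `ℤ/p`. -/
abbrev gamma0Action (a p : ℕ) [Fact p.Prime] :
    MulAction (CongruenceSubgroup.Gamma0 a) (OnePoint (ZMod p)) :=
  MulAction.compHom _ ((Matrix.SpecialLinearGroup.mapGL (ZMod p)).comp
    (CongruenceSubgroup.Gamma0 a).subtype)

/-- Γ₀(a) acts transitively on the p + 1 points of the projective line over ℤ/p, and Γ₀(pa) is the
stabilizer of ∞. -/
lemma Gamma0_mul_prime_relIndex {a p : ℕ} (hp : p.Prime) (hpa : p.Coprime a) :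
    (CongruenceSubgroup.Gamma0 (p * a)).relIndex (CongruenceSubgroup.Gamma0 a) = p + 1 := by
  have : Fact p.Prime := ⟨hp⟩
  let := gamma0Action a p
  have hdef : ∀ g : CongruenceSubgroup.Gamma0 a, g • (OnePoint.infty : OnePoint (ZMod p)) =
      if ((g.1 1 0 : ℤ) : ZMod p) = 0 then OnePoint.infty else
        ((((g.1 0 0 : ℤ) : ZMod p) / ((g.1 1 0 : ℤ) : ZMod p) : ZMod p) : OnePoint (ZMod p)) :=
    fun g => OnePoint.smul_infty_eq_ite (K := ZMod p) (Matrix.SpecialLinearGroup.mapGL (ZMod p) g.1)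
  have hstab : (CongruenceSubgroup.Gamma0 (p * a)).subgroupOf (CongruenceSubgroup.Gamma0 a) =
      MulAction.stabilizer (CongruenceSubgroup.Gamma0 a) (OnePoint.infty : OnePoint (ZMod p)) := by
    ext g
    rw [Subgroup.mem_subgroupOf, CongruenceSubgroup.Gamma0_mem, MulAction.mem_stabilizer_iff, hdef]
    have hg : ((g.1 1 0 : ℤ) : ZMod a) = 0 := g.2
    rw [ZMod.intCast_zmod_eq_zero_iff_dvd] at hg
    have hiff : ((g.1 1 0 : ℤ) : ZMod (p * a)) = 0 ↔ ((g.1 1 0 : ℤ) : ZMod p) = 0 := by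
      rw [ZMod.intCast_zmod_eq_zero_iff_dvd, ZMod.intCast_zmod_eq_zero_iff_dvd, Nat.cast_mul]
      exact ⟨fun h => (dvd_mul_right _ _).trans h, fun h =>
        (Nat.isCoprime_iff_coprime.2 hpa).mul_dvd h hg⟩
    rw [hiff]
    split_ifs with h
    · simp [h]
    · simp [h]
  have horb : MulAction.orbit (CongruenceSubgroup.Gamma0 a) (OnePoint.infty : OnePoint (ZMod p)) =
      Set.univ := by
    refine Set.eq_univ_of_forall fun x => ?_
    induction x using OnePoint.rec with
    | infty => exact MulAction.mem_orbit_self _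
    | coe t =>
      -- With u ≡ ta mod p and u ≡ 1 mod a, the column (u, a) is unimodular and maps ∞ to u/a = t.
      obtain ⟨u, hu1, hu2⟩ := Nat.chineseRemainder hpa (t * a).val 1
      have hua : IsCoprime (u : ℤ) (a : ℤ) := Nat.isCoprime_iff_coprime.2 (by
        rw [Nat.Coprime, hu2.gcd_eq, Nat.gcd_one_left])
      obtain ⟨v, w, hvw⟩ := hua
      have hdet : (!![(u : ℤ), -w; (a : ℤ), v]).det = 1 := by
        rw [Matrix.det_fin_two_of]
        linear_combination hvw
      let γ : SL(2, ℤ) := ⟨!![(u : ℤ), -w; (a : ℤ), v], hdet⟩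
      have h00 : γ 0 0 = u := rfl
      have h10 : γ 1 0 = a := rfl
      have hγ : γ ∈ CongruenceSubgroup.Gamma0 a := by
        rw [CongruenceSubgroup.Gamma0_mem, h10]
        simp
      refine ⟨⟨γ, hγ⟩, ?_⟩
      have ha : (a : ZMod p) ≠ 0 := by
        rw [Ne, ZMod.natCast_eq_zero_iff, ← hp.coprime_iff_not_dvd]
        exact hpa
      have hut : (u : ZMod p) = t * a := by
        rw [(ZMod.natCast_eq_natCast_iff _ _ _).2 hu1, ZMod.natCast_zmod_val]
      beta_reduce
      rw [hdef, h00, h10]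
      simp [ha, hut]
  rw [Subgroup.relIndex, hstab, MulAction.index_stabilizer, horb, Set.ncard_univ]
  exact Finite.card_option.trans (by rw [Nat.card_zmod])

lemma Gamma0_index {N : ℕ} (hN : Squarefree N) :
    (CongruenceSubgroup.Gamma0 N).index = ∏ p ∈ N.primeFactors, (p + 1) := by
  induction N using induction_on_primes with
  | zero => exact absurd hN not_squarefree_zero
  | one =>
    rw [Nat.primeFactors_one, Finset.prod_empty, Subgroup.index_eq_one, Subgroup.eq_top_iff']
    intro g
    rw [CongruenceSubgroup.Gamma0_mem]
    exact Subsingleton.elim _ _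
  | prime_mul p a hp ih =>
    have hpa : p.Coprime a := Nat.coprime_of_squarefree_mul hN
    have ha : Squarefree a := hN.of_mul_right
    have hle : CongruenceSubgroup.Gamma0 (p * a) ≤ CongruenceSubgroup.Gamma0 a := by
      intro g hg
      rw [CongruenceSubgroup.Gamma0_mem, ZMod.intCast_zmod_eq_zero_iff_dvd] at hg ⊢
      exact (by exact_mod_cast dvd_mul_left a p : (a : ℤ) ∣ ((p * a : ℕ) : ℤ)).trans hg
    rw [← Subgroup.relIndex_mul_index hle, Gamma0_mul_prime_relIndex hp hpa, ih ha,
      Nat.primeFactors_mul hp.ne_zero ha.ne_zero, hp.primeFactors, Finset.prod_union,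
      Finset.prod_singleton]
    rw [Finset.disjoint_singleton_left]
    exact fun h => (hp.coprime_iff_not_dvd.1 hpa) (Nat.dvd_of_mem_primeFactors h)

/-! ### The constant terms of the Eisenstein part of the generating function -/

/-- Since √M^{r-s} = M^{k/2-s}, the sum over M turns each Bernoulli term into a multiple of E(s).
The part with (NXY)^{s-1} is brought to the same form by exchanging r and s and using the symmetry
of E. -/
lemma sum_val_mul_cuspValue {N k : ℕ} (hN : Squarefree N) (hk : 2 ≤ k) (hk2 : Even k)
    (ε : ALChar N) {X Y : ℂ} (hX : X ≠ 0) (hY : Y ≠ 0) :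
    ∑ M ∈ N.divisors, ε.val M * cuspValue N X Y M k =
      (1 - ε.val N * (N : ℂ) ^ (k / 2 - 1) * Y ^ (k - 2)) * oddSum N k ε X +
      (1 - ε.val N * (N : ℂ) ^ (k / 2 - 1) * X ^ (k - 2)) * oddSum N k ε Y := by
  have hN' : (N : ℂ) ≠ 0 := by exact_mod_cast hN.ne_zero
  obtain ⟨h, rfl⟩ : ∃ m, k = 2 * m := hk2.exists_two_nsmul.imp fun m hm => by simpa using hm
  rw [Nat.mul_div_cancel_left _ two_pos]
  have e1 : ∀ M ∈ N.divisors, ε.val M * cuspValue N X Y M (2 * h) =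
      ∑ p ∈ (Finset.HasAntidiagonal.antidiagonal (2 * h)).filter (fun p => Even p.1 ∧ Even p.2),
        ((bernoulli p.1 : ℚ) : ℂ) / (p.1.factorial : ℂ) *
        (((bernoulli p.2 : ℚ) : ℂ) / (p.2.factorial : ℂ)) * (ε.val M * (M : ℂ) ^ ((h : ℤ) - p.2)) *
        ((X ^ ((p.1 : ℤ) - 1) + Y ^ ((p.1 : ℤ) - 1)) * (1 - (N * X * Y) ^ ((p.2 : ℤ) - 1))) := by
    intro M hM
    have hM0 : M ≠ 0 := (Nat.pos_of_mem_divisors hM).ne'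
    have hm2 : (Real.sqrt M : ℂ) ^ 2 = M := by
      rw [← ofReal_pow, Real.sq_sqrt (by positivity)]
      simp
    have hm : (Real.sqrt M : ℂ) ≠ 0 := fun h => by
      rw [h, zero_pow two_ne_zero] at hm2
      exact hM0 (by exact_mod_cast hm2.symm)
    rw [cuspValue, thetaCoeff_eq_sum_bernoulli hN.ne_zero hm hX hY, Finset.mul_sum]
    refine Finset.sum_congr rfl fun p hp => ?_
    have hp1 := Finset.HasAntidiagonal.mem_antidiagonal.1 (Finset.mem_filter.1 hp).1
    rw [show (p.1 : ℤ) - p.2 = 2 * ((h : ℤ) - p.2) by omega, zpow_mul, zpow_ofNat, hm2]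
    ring
  rw [Finset.sum_congr rfl e1, Finset.sum_comm]
  have e2 : ∀ Z : ℂ, ε.val N * (N : ℂ) ^ (h - 1) * oddSum N (2 * h) ε Z =
      ∑ p ∈ (Finset.HasAntidiagonal.antidiagonal (2 * h)).filter (fun p => Even p.1 ∧ Even p.2),
        ((bernoulli p.1 : ℚ) : ℂ) / (p.1.factorial : ℂ) *
        (((bernoulli p.2 : ℚ) : ℂ) / (p.2.factorial : ℂ)) * eisFactor N (2 * h) ε p.2 *
        (N * Z) ^ ((p.2 : ℤ) - 1) := by
    intro Z
    rw [oddSum, Finset.mul_sum, Finset.sum_filter, Finset.sum_filter,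
      ← Finset.Nat.sum_antidiagonal_swap]
    refine Finset.sum_congr rfl fun p hp => ?_
    have hp1 := Finset.HasAntidiagonal.mem_antidiagonal.1 hp
    refine if_congr and_comm ?_ rfl
    simp only [Prod.fst_swap, Prod.snd_swap]
    rw [eisFactor_symm hN ε (show p.2 + p.1 = 2 * h by omega), mul_zpow,
      ← zpow_natCast (N : ℂ) (h - 1), show ((h - 1 : ℕ) : ℤ) = ((p.1 : ℤ) - h) + ((p.2 : ℤ) - 1) by
        omega, zpow_add₀ hN']
    ring
  have e3 : ∀ Z V : ℂ, (1 - ε.val N * (N : ℂ) ^ (h - 1) * V) * oddSum N (2 * h) ε Z =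
      oddSum N (2 * h) ε Z - V * (ε.val N * (N : ℂ) ^ (h - 1) * oddSum N (2 * h) ε Z) :=
    fun Z V => by ring
  rw [e3, e3, e2, e2, oddSum, oddSum, Finset.mul_sum, Finset.mul_sum, ← Finset.sum_sub_distrib,
    ← Finset.sum_sub_distrib, ← Finset.sum_add_distrib]
  refine Finset.sum_congr rfl fun p hp => ?_
  have hp1 := Finset.HasAntidiagonal.mem_antidiagonal.1 (Finset.mem_filter.1 hp).1
  have hXY : ∀ Z : ℂ, Z ≠ 0 → Z ^ (2 * h - 2) = Z ^ ((p.1 : ℤ) - 1) * Z ^ ((p.2 : ℤ) - 1) :=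
    fun Z hZ => by
      rw [← zpow_natCast, ← zpow_add₀ hZ]
      congr 1
      omega
  rw [eisFactor_natCast ε, ← Finset.sum_mul, ← Finset.mul_sum, hXY X hX, hXY Y hY, mul_zpow,
    mul_zpow, mul_zpow]
  ring

lemma sum_val_eq_prod_eisLocal {N : ℕ} (hN : Squarefree N) (k : ℕ) (ε : ALChar N) :
    ∑ d ∈ N.divisors, ε.val d * (d : ℂ) ^ (k / 2) = ∏ p ∈ N.primeFactors, (1 + eisLocal k ε p) :=
  ALChar.sum_val_mul hN ε (f := fun d => (d : ℂ) ^ (k / 2)) (by simp)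
    fun a b => by rw [Nat.cast_mul, mul_pow]

lemma prod_eisLocal {N : ℕ} (hN : Squarefree N) (k : ℕ) (ε : ALChar N) :
    ∏ p ∈ N.primeFactors, eisLocal k ε p = ε.val N * (N : ℂ) ^ (k / 2) := by
  simp only [eisLocal]
  rw [Finset.prod_mul_distrib, Finset.prod_pow, ← Nat.cast_prod,
    Nat.prod_primeFactors_of_squarefree hN, ALChar.val_eq_prod hN ε dvd_rfl]

lemma prod_eisLocal_add_one_ne_zero {N k : ℕ} (hN : Squarefree N) (hk : 2 ≤ k) (ε : ALChar N) :
    ∏ p ∈ N.primeFactors, (1 + eisLocal k ε p) ≠ 0 := by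
  refine Finset.prod_ne_zero_iff.2 fun p hp => ?_
  refine one_add_val_mul_ne_zero hN.ne_zero ε (Nat.dvd_of_mem_primeFactors hp) ?_
  rw [norm_pow, Complex.norm_natCast]
  have hp1 := (Nat.prime_of_mem_primeFactors hp).one_lt
  exact (one_lt_pow₀ (by exact_mod_cast hp1) (by omega)).ne'

lemma val_eq_neg_one_pow {N : ℕ} (hN : Squarefree N) (ε : ALChar N) :
    ε.val N = (-1) ^ (N.primeFactors.filter (fun p => ε.val p = -1)).card := by
  rw [ALChar.val_eq_prod hN ε dvd_rfl, ← Finset.prod_const, Finset.prod_filter]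
  refine Finset.prod_congr rfl fun p hp => ?_
  split_ifs with h
  · exact h
  · exact (ALChar.val_eq_or hN.ne_zero ε (Nat.dvd_of_mem_primeFactors hp)).resolve_right h

/-- The factor `1/2` by which both the even period and the norm deviate in weight two. -/
def weightTwoFactor (k : ℕ) : ℂ := if k = 2 then 1 / 2 else 1

lemma weightTwoFactor_ne_zero (k : ℕ) : weightTwoFactor k ≠ 0 := by
  rw [weightTwoFactor]
  split_ifs <;> norm_num

section

variable {N k : ℕ} (hN : Squarefree N) (hk : 2 ≤ k) (hk2 : Even k) (ε : ALChar N)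
  (hε : ¬ (k = 2 ∧ ε.IsTrivial))
  (hdeg : ¬ (k = 2 ∧ 2 ≤ (N.primeFactors.filter (fun p => ε.val p = -1)).card))

/-- The index ∏(p+1) cancels the denominators p + 1. In weight two there is exactly one exceptional
prime, which accounts for a single factor 1/2. -/
lemma prod_rankinRatio (hN : Squarefree N) (hk : 2 ≤ k) (hk2 : Even k)
    (hε : ¬ (k = 2 ∧ ε.IsTrivial))
    (hdeg : ¬ (k = 2 ∧ 2 ≤ (N.primeFactors.filter (fun p => ε.val p = -1)).card)) :
    ((CongruenceSubgroup.Gamma0 N).index : ℂ) * ∏ p ∈ N.primeFactors, rankinRatio k ε p =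
      weightTwoFactor k * (2 ^ N.primeFactors.card * N *
        (∏ p ∈ N.primeFactors, (1 + eisLocal k ε p)) / (ε.val N * (N : ℂ) ^ (k / 2))) := by
  classical
  have h1 : ∏ p ∈ N.primeFactors, (if IsExceptional k ε p then (1 / 2 : ℂ) else 1) =
      weightTwoFactor k := by
    rw [weightTwoFactor]
    split_ifs with h2
    · have hc := card_exceptional hN ε (fun h => hε ⟨h2, h⟩) (fun h => hdeg ⟨h2, h⟩)
      have h3 : ∀ p, IsExceptional k ε p ↔ ε.val p = -1 := fun p => ⟨fun h => h.2, fun h => ⟨h2, h⟩⟩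
      simp only [h3]
      rw [← Finset.prod_filter, Finset.prod_const, hc, pow_one]
    · exact Finset.prod_eq_one fun p _ => if_neg fun h => h2 h.1
  have hcardN : (N : ℂ) = ∏ p ∈ N.primeFactors, (p : ℂ) := by
    rw [← Nat.cast_prod, Nat.prod_primeFactors_of_squarefree hN]
  rw [Gamma0_index hN, ← prod_eisLocal hN]
  simp only [rankinRatio]
  rw [Finset.prod_mul_distrib, h1, mul_left_comm, ← Finset.prod_const, hcardN,
    ← Finset.prod_mul_distrib, ← Finset.prod_mul_distrib, ← Finset.prod_div_distrib,
    Nat.cast_prod, ← Finset.prod_mul_distrib]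
  congr 1
  refine Finset.prod_congr rfl fun p hp => ?_
  have hp1 : (p : ℂ) + 1 ≠ 0 := by exact_mod_cast p.succ_ne_zero
  have hb : eisLocal k ε p ≠ 0 := fun h => by
    have h2 := eisLocal_sq hk hk2 ε hN.ne_zero (Nat.dvd_of_mem_primeFactors hp)
    have hp0 : (p : ℂ) ≠ 0 := by exact_mod_cast (Nat.prime_of_mem_primeFactors hp).ne_zero
    rw [h, zero_pow two_ne_zero] at h2
    exact mul_ne_zero (pow_ne_zero _ hp0) hp0 h2.symm
  push_cast
  field_simp
  ring

/-- Here ε(N) = -1 in weight two, so 1 - ε(N) = 2, and with the factor 1/2 one formula covers all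
weights. -/
lemma evPart_eisPeriod_eq {X : ℂ} (hX : X ≠ 0)
    (hdeg : ¬ (k = 2 ∧ 2 ≤ (N.primeFactors.filter (fun p => ε.val p = -1)).card)) :
    evPart (eisPeriod N k (ε.val N) (heckeEis N k ε)) X =
      -(I / (2 * π) * eisLimit hN hk hk2 ε hε * weightTwoFactor k * ε.val N *
        ((N : ℂ) ^ (k / 2 - 1))⁻¹) * (1 - ε.val N * (N : ℂ) ^ (k / 2 - 1) * X ^ (k - 2)) := by
  have hN' : (N : ℂ) ≠ 0 := by exact_mod_cast hN.ne_zero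
  rw [evPart_eisPeriod hN hk hk2 ε hε hX, weightTwoFactor]
  have he := ALChar.val_mul_self hN.ne_zero ε dvd_rfl
  split_ifs with h2
  · have hc := card_exceptional hN ε (fun h => hε ⟨h2, h⟩) (fun h => hdeg ⟨h2, h⟩)
    subst h2
    rw [val_eq_neg_one_pow hN ε, hc]
    norm_num
    ring
  · have hNk : (N : ℂ) ^ (k / 2 - 1) ≠ 0 := pow_ne_zero _ hN'
    generalize (N : ℂ) ^ (k / 2 - 1) = n at *
    field_simp
    linear_combination (-(X ^ (k - 2) * n * eisLimit hN hk hk2 ε hε)) * he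

lemma eisNorm_heckeEis
    (hdeg : ¬ (k = 2 ∧ 2 ≤ (N.primeFactors.filter (fun p => ε.val p = -1)).card)) :
    eisNorm N k (heckeEis N k ε) =
      -(-1) ^ (k / 2) * ((bernoulli k : ℚ) : ℂ) / (π * k * 2 ^ k) * eisLimit hN hk hk2 ε hε *
      (weightTwoFactor k * (2 ^ N.primeFactors.card * N *
        (∏ p ∈ N.primeFactors, (1 + eisLocal k ε p)) / (ε.val N * (N : ℂ) ^ (k / 2)))) := by
  rw [eisNorm, rankinResidue_heckeEis hN hk hk2 ε hε, riemannZeta_two, zeta_even_eq hk2 (by omega),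
    ← prod_rankinRatio ε hN hk hk2 hε hdeg]
  obtain ⟨j, rfl⟩ : ∃ j, k = j + 1 := ⟨k - 1, by omega⟩
  have hj : ((j : ℂ) + 1) ≠ 0 := by exact_mod_cast j.succ_ne_zero
  have hf : (j.factorial : ℂ) ≠ 0 := by exact_mod_cast j.factorial_ne_zero
  have hpi : (π : ℂ) ≠ 0 := ofReal_ne_zero.2 Real.pi_ne_zero
  rw [Nat.add_sub_cancel, Nat.factorial_succ, show (4 * (π : ℂ)) = 2 * (2 * π) by ring,
    mul_pow 2 (2 * (π : ℂ))]
  have h2 : (2 * (π : ℂ)) ^ (j + 1) ≠ 0 := pow_ne_zero _ (by simp [hpi])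
  generalize (2 * (π : ℂ)) ^ (j + 1) = w at *
  push_cast
  field_simp
  ring

/-- The limit of the L-series and the factor of weight two occur in both the even period and the
norm and cancel. The product ∏(1+ε(p)p^{k/2}) cancels between the norm and the constant term, and
the 2^t of the norm becomes the 2^{-t} of Fourier inversion. -/
lemma eisR_mul_eisConstTerm {X Y : ℂ} (hX : X ≠ 0) (hY : Y ≠ 0) (hN : Squarefree N) (hk : 2 ≤ k)
    (hk2 : Even k) (hε : ¬ (k = 2 ∧ ε.IsTrivial)) :
    1 / ((k - 2).factorial : ℂ) * (eisR N k ε X Y * eisConstTerm N k ε) =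
      ((2 : ℂ) ^ N.primeFactors.card)⁻¹ * ∑ M ∈ N.divisors, ε.val M * cuspValue N X Y M k := by
  rw [sum_val_mul_cuspValue hN hk hk2 ε hX hY, eisConstTerm, sum_val_eq_prod_eisLocal hN]
  have hA := prod_eisLocal_add_one_ne_zero hN hk ε
  have he := ALChar.val_mul_self hN.ne_zero ε dvd_rfl
  have hN' : (N : ℂ) ≠ 0 := by exact_mod_cast hN.ne_zero
  rw [eisR]
  split_ifs with hdeg
  · obtain ⟨rfl, hdeg⟩ := hdeg
    -- In weight two dʳ⁻¹ = d^{1-s}, so summing Q₂(dZ) against ε produces the factors E(s) of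
    -- `oddSum`.
    have hodd : ∀ Z : ℂ, ∑ d ∈ N.divisors, ε.val d * Qk 2 (d * Z) = oddSum N 2 ε Z := by
      intro Z
      rw [oddSum]
      simp only [Qk, Finset.mul_sum]
      rw [Finset.sum_comm]
      refine Finset.sum_congr rfl fun p hp => ?_
      have hp1 := Finset.HasAntidiagonal.mem_antidiagonal.1 (Finset.mem_filter.1 hp).1
      rw [show (2 : ℕ) = 2 * 1 from rfl, eisFactor_natCast ε, Finset.mul_sum, Finset.sum_mul]
      refine Finset.sum_congr rfl fun d _ => ?_
      rw [mul_zpow, show ((1 : ℕ) : ℤ) - p.2 = (p.1 : ℤ) - 1 by omega]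
      ring
    have hprod : ∏ p ∈ N.primeFactors, (1 + eisLocal 2 ε p) =
        ∏ p ∈ N.primeFactors, (1 + ε.val p * p) := by
      simp [eisLocal]
    rw [eisFrakR₂, eisFrakR₂, hodd, hodd, ← hprod, eisConst, bernoulli_two]
    norm_num
    field_simp
    ring
  · rw [periodPair, evPart_eisPeriod_eq hN hk hk2 ε hε hX hdeg,
      evPart_eisPeriod_eq hN hk hk2 ε hε hY hdeg,
      odPart_eisPeriod hN hk hk2 ε hε hX, odPart_eisPeriod hN hk hk2 ε hε hY,
      eisNorm_heckeEis hN hk hk2 ε hε hdeg, eisConst]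
    have hl := eisLimit_ne_zero hN hk hk2 ε hε hdeg
    have hB := bernoulli_ne_zero_of_even hk2 (by omega)
    have hw := weightTwoFactor_ne_zero k
    have hpi : (π : ℂ) ≠ 0 := ofReal_ne_zero.2 Real.pi_ne_zero
    have hf : ((k - 2).factorial : ℂ) ≠ 0 := by exact_mod_cast (k - 2).factorial_ne_zero
    have hk0 : (k : ℂ) ≠ 0 := by exact_mod_cast (by omega : k ≠ 0)
    have he0 : ε.val N ≠ 0 := fun h => by simp [h] at he
    have hI : (2 * I) ^ ((k : ℤ) - 3) = 2 ^ k / 8 * ((-1) ^ (k / 2) * I) := by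
      have h2I : (2 * I : ℂ) ≠ 0 := by simp
      rw [zpow_sub₀ h2I, zpow_natCast, mul_pow, zpow_ofNat, mul_pow, I_pow_three]
      have hIk : I ^ k = (-1) ^ (k / 2) := by
        rw [← I_sq, ← pow_mul, Nat.mul_div_cancel' hk2.two_dvd]
      rw [hIk]
      field_simp
      norm_num [I_sq]
    have hs : (-1 : ℂ) ^ (k / 2) * (-1) ^ (k / 2) = 1 := by simp [← mul_pow]
    have hs0 : (-1 : ℂ) ^ (k / 2) ≠ 0 := by simp
    have hNk : (N : ℂ) ^ (k / 2) = N * (N : ℂ) ^ (k / 2 - 1) := by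
      rw [← pow_succ']
      congr 1
      omega
    have hNk0 : (N : ℂ) ^ (k / 2 - 1) ≠ 0 := pow_ne_zero _ hN'
    rw [hI, hNk]
    generalize eisLimit hN hk hk2 ε hε = l at *
    generalize (N : ℂ) ^ (k / 2 - 1) = n at *
    generalize ∏ p ∈ N.primeFactors, (1 + eisLocal k ε p) = A at *
    generalize ((bernoulli k : ℚ) : ℂ) = B at *
    generalize weightTwoFactor k = w at *
    generalize ((k - 2).factorial : ℂ) = f at *
    generalize oddSum N k ε X = x at *
    generalize oddSum N k ε Y = y at *
    generalize X ^ (k - 2) = X' at *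
    generalize Y ^ (k - 2) = Y' at *
    generalize (-1 : ℂ) ^ (k / 2) = s at *
    generalize ε.val N = e at *
    have h2k : (2 : ℂ) ^ k ≠ 0 := by simp
    generalize (2 : ℂ) ^ k = v at *
    have hI0 := I_ne_zero
    field_simp
    linear_combination 8 * ((1 - e * n * X') * y + x * (1 - e * n * Y')) * (he - hs)

end

/-! ### Values at infinity of the generating function -/

lemma isCusp_smul_infty {N M : ℕ} {W : GL (Fin 2) ℝ} (hW : IsAtkinLehner N M W) :
    IsCusp (W • (OnePoint.infty : OnePoint ℝ)) 𝒮ℒ := by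
  obtain ⟨a, b, c, d, -, -, -, -, h⟩ := hW
  have h00 : W 0 0 = a := by rw [h]; rfl
  have h10 : W 1 0 = c := by rw [h]; rfl
  rw [isCusp_SL2Z_iff, OnePoint.smul_infty_eq_ite, h00, h10]
  split_ifs
  · exact ⟨OnePoint.infty, rfl⟩
  · exact ⟨((a / c : ℚ) : OnePoint ℚ), by simp⟩

lemma tendsto_slash_cuspForm {N M k : ℕ} (hN : N ≠ 0) (hM : M ∣ N) {W : GL (Fin 2) ℝ}
    (hW : IsAtkinLehner N M W) (g : CuspForm (G0 N) k) :
    Tendsto (slash k W g) atImInfty (𝓝 0) := by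
  have : NeZero N := ⟨hN⟩
  have hc : IsCusp (W • (OnePoint.infty : OnePoint ℝ)) (G0 N) :=
    (Subgroup.IsArithmetic.isCusp_iff_isCusp_SL2Z _).2 (isCusp_smul_infty hW)
  have h0 : Tendsto ((g : ℍ → ℂ) ∣[(k : ℤ)] W) atImInfty (𝓝 0) := g.zero_at_cusps' hc W rfl
  rw [slash_eq_mul_slash (ne_zero_of_dvd_ne_zero hN hM) hW.det_eq]
  have h := h0.const_mul (((M : ℂ) ^ ((k : ℤ) - 1))⁻¹ * (Real.sqrt M : ℂ) ^ k)
  rwa [mul_zero] at h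

lemma slash_add (k : ℕ) (W : GL (Fin 2) ℝ) (f g : ℍ → ℂ) :
    slash k W (fun τ => f τ + g τ) = fun τ => slash k W f τ + slash k W g τ := by
  ext τ
  rw [slash, slash, slash, mul_add]

lemma slash_sub (k : ℕ) (W : GL (Fin 2) ℝ) (f g : ℍ → ℂ) :
    slash k W (fun τ => f τ - g τ) = fun τ => slash k W f τ - slash k W g τ := by
  ext τ
  rw [slash, slash, slash, mul_sub]

lemma slash_zero (k : ℕ) (W : GL (Fin 2) ℝ) : slash k W (fun _ => 0) = fun _ => 0 := by
  ext τ
  rw [slash, mul_zero]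

open Classical in
/-- The characters that contribute to the Eisenstein part in weight `k`. -/
def eisChars (N k : ℕ) : Finset (ALChar N) :=
  Finset.univ.filter (fun ε : ALChar N => ¬ (k = 2 ∧ ε.IsTrivial))

lemma mem_eisChars {N k : ℕ} {ε : ALChar N} : ε ∈ eisChars N k ↔ ¬ (k = 2 ∧ ε.IsTrivial) := by
  simp [eisChars]

lemma eisC_of_even {N k : ℕ} (hk2 : Even k) (X Y : ℂ) : eisC N k X Y = fun τ =>
    (1 / ((k - 2).factorial : ℂ)) * ∑ ε ∈ eisChars N k, eisR N k ε X Y * heckeEis N k ε τ := by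
  ext τ
  rw [eisC, if_pos hk2]
  refine congrArg _ (Finset.sum_congr ?_ fun _ _ => rfl)
  ext ε
  rw [mem_eisChars, Finset.mem_filter, ALChar.IsTrivial]
  simp only [Finset.mem_univ, true_and]

lemma eisC_of_odd {N k : ℕ} (hk2 : Odd k) (X Y : ℂ) : eisC N k X Y = fun _ => 0 := by
  ext τ
  rw [eisC, if_neg (Nat.not_even_iff_odd.2 hk2)]

lemma slash_eisC {N M k : ℕ} (hN : Squarefree N) (hk : 2 ≤ k) (hk2 : Even k) (X Y : ℂ)
    {W : GL (Fin 2) ℝ} (hW : IsAtkinLehner N M W) (hM : M ∣ N) :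
    slash k W (eisC N k X Y) = fun τ => (1 / ((k - 2).factorial : ℂ)) *
      ∑ ε ∈ eisChars N k, eisR N k ε X Y * (ε.val M * heckeEis N k ε τ) := by
  ext τ
  rw [eisC_of_even hk2, slash, mul_left_comm, Finset.mul_sum]
  congr 1
  refine Finset.sum_congr rfl fun ε hε => ?_
  rw [← congrFun (slash_heckeEis hN hk hk2 ε (mem_eisChars.1 hε) hW hM) τ, slash]
  ring

lemma cuspValue_odd (N : ℕ) (X Y : ℂ) (M : ℕ) {k : ℕ} (hk : Odd k) : cuspValue N X Y M k = 0 :=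
  thetaCoeff_odd _ _ _ _ _ hk

lemma tendsto_slash_eisC {N M k : ℕ} (hN : Squarefree N) (hk : 2 ≤ k) {X Y : ℂ} (hX : X ≠ 0)
    (hY : Y ≠ 0) {W : GL (Fin 2) ℝ} (hW : IsAtkinLehner N M W) (hM : M ∣ N) :
    Tendsto (slash k W (eisC N k X Y)) atImInfty (𝓝 (cuspValue N X Y M k)) := by
  rcases Nat.even_or_odd k with hk2 | hk2
  · rw [slash_eisC hN hk hk2 X Y hW hM]
    have h : Tendsto (fun τ => (1 / ((k - 2).factorial : ℂ)) *
        ∑ ε ∈ eisChars N k, eisR N k ε X Y * (ε.val M * heckeEis N k ε τ)) atImInfty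
        (𝓝 ((1 / ((k - 2).factorial : ℂ)) *
        ∑ ε ∈ eisChars N k, eisR N k ε X Y * (ε.val M * eisConstTerm N k ε))) :=
      (tendsto_finsetSum _ fun ε _ =>
        ((tendsto_heckeEis hk hk2 ε).const_mul _).const_mul _).const_mul _
    convert! h using 2
    rw [← ALChar.sum_inversion hN hM fun M => cuspValue N X Y M k, Finset.mul_sum,
        ← Finset.sum_subset (Finset.subset_univ
      (eisChars N k))]
    · refine Finset.sum_congr rfl fun ε hε => ?_
      rw [← eisR_mul_eisConstTerm ε hX hY hN hk hk2 (mem_eisChars.1 hε)]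
      ring
    -- The trivial character has no Eisenstein series in weight two. Its Fourier coefficient also
    -- vanishes, since 1 - ε(N)N⁰X⁰ = 0.
    · intro ε _ hε
      rw [mem_eisChars, not_not] at hε
      obtain ⟨rfl, hε⟩ := hε
      rw [sum_val_mul_cuspValue hN hk hk2 ε hX hY,
        hε N (Nat.mem_divisors_self N hN.ne_zero)]
      simp
  · rw [eisC_of_odd hk2, cuspValue_odd _ _ _ _ hk2]
    rw [slash_zero]
    exact tendsto_const_nhds

lemma mdifferentiable_eisC {N k : ℕ} (hk : 2 ≤ k) (X Y : ℂ) : MDiff (eisC N k X Y) := by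
  rcases Nat.even_or_odd k with hk2 | hk2
  · rw [UpperHalfPlane.mdifferentiable_iff, eisC_of_even hk2]
    refine DifferentiableOn.const_mul (DifferentiableOn.fun_sum fun ε _ =>
      DifferentiableOn.const_mul ?_ _) _
    exact UpperHalfPlane.mdifferentiable_iff.1 (mdifferentiable_heckeEis hk hk2 ε)
  · rw [eisC_of_odd hk2]
    exact mdifferentiable_const

lemma slash_one_eisC {N k : ℕ} (hN : Squarefree N) (hk : 2 ≤ k) (X Y : ℂ) {W : GL (Fin 2) ℝ}
    (hW : IsAtkinLehner N 1 W) : slash k W (eisC N k X Y) = eisC N k X Y := by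
  rcases Nat.even_or_odd k with hk2 | hk2
  · rw [slash_eisC hN hk hk2 X Y hW (one_dvd N), eisC_of_even hk2]
    simp only [ALChar.val_one hN, one_mul]
  · rw [eisC_of_odd hk2]
    exact slash_zero k W

lemma genC_eq {N k : ℕ} (hk : 2 ≤ k) (X Y : ℂ) :
    genC N X Y k = fun τ => cuspC N k X Y τ + eisC N k X Y τ := by
  obtain ⟨j, rfl⟩ : ∃ j, k = j + 2 := ⟨k - 2, by omega⟩
  rfl

lemma thetaB_zero (N : ℕ) (X Y : ℂ) (τ : ℍ) : thetaB N X Y 0 τ = genC N X Y 0 τ := by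
  simp [thetaB, thetaCoeff, expCoeff, genC, thetaLead]

lemma thetaB_odd (N : ℕ) (X Y : ℂ) {k : ℕ} (hk : Odd k) (τ : ℍ) : thetaB N X Y k τ = 0 :=
  thetaCoeff_odd _ _ _ _ _ hk

lemma tendsto_slash_genC {N M : ℕ} (hN : Squarefree N) {X Y : ℂ} (hX : X ≠ 0)
    (hY : Y ≠ 0) {W : GL (Fin 2) ℝ} (hW : IsAtkinLehner N M W) (hM : M ∣ N) (k : ℕ) :
    Tendsto (slash k W (genC N X Y k)) atImInfty (𝓝 (cuspValue N X Y M k)) := by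
  rcases lt_or_ge k 2 with hk | hk
  · have h : genC N X Y k = thetaB N X Y k := by
      ext τ
      interval_cases k
      · exact (thetaB_zero N X Y τ).symm
      · exact (thetaB_odd N X Y odd_one τ).symm
    rw [h]
    exact tendsto_slash_thetaB hN.ne_zero X Y k hW hM
  · rw [genC_eq hk, slash_add]
    have h := (tendsto_slash_cuspForm hN.ne_zero hM hW (cuspC N k X Y)).add
      (tendsto_slash_eisC hN hk hX hY hW hM)
    rwa [zero_add] at h

/-- The cusp criterion is applied to the theta coefficient minus the Eisenstein part alone; the
cuspidal part is already a cusp form and is subtracted afterwards, whatever its coefficients are. -/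
theorem exists_cuspForm_thetaB_sub_genC {N k : ℕ} (hN : Squarefree N) (hk : 2 ≤ k) {X Y : ℂ}
    (hX : X ≠ 0) (hY : Y ≠ 0) :
    ∃ g : CuspForm (G0 N) k, ∀ τ : ℍ, thetaB N X Y k τ - genC N X Y k τ = g τ := by
  have hol : MDiff (fun τ => thetaB N X Y k τ - eisC N k X Y τ) :=
    (mdifferentiable_thetaB hN.ne_zero X Y k).sub (mdifferentiable_eisC hk X Y)
  obtain ⟨g, hg⟩ := exists_cuspForm (k := k) hN hol
    (fun W hW => by
      rw [slash_sub, slash_one_eisC hN hk X Y hW, slash_thetaB hN.ne_zero X Y k hW (one_dvd N),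
        thetaB_eq hN.ne_zero])
    (fun M hM W hW => by
      have h := (tendsto_slash_thetaB hN.ne_zero X Y k hW hM).sub
        (tendsto_slash_eisC hN hk hX hY hW hM)
      rw [sub_self] at h
      rwa [slash_sub])
  refine ⟨g - cuspC N k X Y, fun τ => ?_⟩
  rw [genC_eq hk, sub_apply, ← hg]
  ring

end PeriodGen

end

theorem mainTheorem5 (N : ℕ) (hN : Squarefree N) (X Y : ℂ) (hX : X ≠ 0) (hY : Y ≠ 0) :
    -- the values at `∞` of the coefficients of the generating function slashed by `W_M`
    ∃ c : ℕ → ℕ → ℂ,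
      (∀ M : ℕ, M ∣ N →
        (∀ W : GL (Fin 2) ℝ, PeriodGen.IsAtkinLehner N M W → ∀ k : ℕ,
          Tendsto (PeriodGen.slash k W (PeriodGen.genC N X Y k)) atImInfty (𝓝 (c M k))) ∧
        (∀ T : ℂ, T ≠ 0 →
          ‖(Real.sqrt M : ℂ) * X * T‖ < 2 * π → ‖(Real.sqrt M : ℂ) * Y * T‖ < 2 * π →
          ‖T / (Real.sqrt M : ℂ)‖ < 2 * π → ‖N * X * Y * T / (Real.sqrt M : ℂ)‖ < 2 * π →
          HasSum (fun k : ℕ => c M k * T ^ ((k : ℤ) - 2))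
            (PeriodGen.sinhRatio N (Real.sqrt M : ℂ) X Y T))) ∧
      -- the Eisenstein parts of the generating function and of the theta product agree
      ∃ B : ℕ → ℍ → ℂ,
        (∀ τ : ℍ, ∀ᶠ T in 𝓝[≠] (0 : ℂ),
          HasSum (fun k : ℕ => B k τ * T ^ ((k : ℤ) - 2)) (PeriodGen.thetaProd N X Y τ T)) ∧
        (∀ M : ℕ, M ∣ N → ∀ W : GL (Fin 2) ℝ, PeriodGen.IsAtkinLehner N M W → ∀ k : ℕ,
          Tendsto (PeriodGen.slash k W (B k)) atImInfty (𝓝 (c M k))) ∧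
        (∀ τ : ℍ, B 0 τ = PeriodGen.genC N X Y 0 τ ∧ B 1 τ = PeriodGen.genC N X Y 1 τ) ∧
        (∀ k : ℕ, 2 ≤ k → ∃ g : CuspForm (PeriodGen.G0 N) k,
          ∀ τ : ℍ, B k τ - PeriodGen.genC N X Y k τ = g τ) := by
  refine ⟨PeriodGen.cuspValue N X Y, fun M hM => ⟨fun W hW k =>
    PeriodGen.tendsto_slash_genC hN hX hY hW hM k, fun T hT h1 h2 h3 h4 => ?_⟩,
    PeriodGen.thetaB N X Y, PeriodGen.hasSum_thetaProd hN.ne_zero hX hY, fun M hM W hW k =>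
    PeriodGen.tendsto_slash_thetaB hN.ne_zero X Y k hW hM, fun τ => ⟨PeriodGen.thetaB_zero N X Y τ,
    PeriodGen.thetaB_odd N X Y odd_one τ⟩, fun k hk =>
    PeriodGen.exists_cuspForm_thetaB_sub_genC hN hk hX hY⟩
  have hm : (Real.sqrt M : ℂ) ≠ 0 := by
    have := ne_zero_of_dvd_ne_zero hN.ne_zero hM
    rw [ofReal_ne_zero]
    positivity
  exact PeriodGen.hasSum_sinhRatio hN.ne_zero hm hX hY hT h1 h2 h3 h4
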